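/- \textbf{Theorem (Existence and continuity of local unstable sets).} \emph{Setting.} Let $X$ be a separable Banach space, $(\Omega,\mathcal F,\mathbb P)$ a probability space, and $\{\theta_t:\Omega\to\Omega\}_{t\in\mathbb R}$ a random flow ($\theta_0=\mathrm{Id}$, $\theta_{t+s}=\theta_t\circ\theta_s$, each $\theta_t$ measurable). Write $\omega_\tau=(\tau,\omega)\in\mathbb R\times\Omega$ and $\Theta_t\omega_\tau=(t+\tau,\theta_t\omega)$; a function $m$ on $\mathbb R\times\Omega$ is $\Theta$-invariant if $m(\Theta_t\omega_\tau)=m(\omega_\tau)$ for all $t,\omega_\tau$. Let $A$ generate a $C^0$-semigroup $\{e^{At}\}_{t\ge0}$ on $X$. For $\eta\in[0,1]$ let $A_\eta(\omega_\tau)=A+B_\eta(\omega_\tau)$ with $B_\eta(\omega_\tau)\in\mathcal L(X)$, $B_0=0$, and let $h_\eta:\mathbb R\times\Omega\times X\to X$ be such that $h_\eta(\omega_\tau,\cdot)\in C^1(X)$, $h_\eta(\omega_\tau,0)=0$, $(h_\eta)_x(\omega_\tau,0)=0$, with $h_0(\omega_\tau,\cdot)=h_0:X\to X$ independent of $\omega_\tau$;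 the maps $t\mapsto B_\eta(\Theta_t\omega_\tau)x$ and $t\mapsto h_\eta(\Theta_t\omega_\tau,x)$ are strongly measurable. Assume that for all $\omega_\tau$ and all $r>0$ $$\lim_{\eta\to0}\sup_{t\in\mathbb R}\|B_\eta(\Theta_t\omega_\tau)\|_{\mathcal L(X)}=0,$$ $$\lim_{\eta\to0}\ \sup_{t\in\mathbb R,\ \|x\|<r}\big\{\|h_\eta(\Theta_t\omega_\tau,x)-h_0(x)\|_X+\|(h_\eta)_x(\Theta_t\omega_\tau,x)-h_0'(x)\|_{\mathcal L(X)}\big\}=0.$$ Assume that for every $\eta\in[0,1]$ the equation $$\dot z=A_\eta(\Theta_t\omega_\tau)z+h_\eta(\Theta_t\omega_\tau,z)\qquad(\ast)$$ is globally well posed: there is a nonautonomous random dynamical system $\psi_\eta$ driven by $\Theta$ (measurable in $(t,\omega,x)$ for each $\tau$, $\psi_\eta(0,\omega_\tau)=\mathrm{Id}$, $\psi_\eta(t+s,\omega_\tau)=\psi_\eta(t,\Theta_s\omega_\tau)\psi_\eta(s,\omega_\tau)$, $(t,x)\mapsto\psi_\eta(t,\omega_\tau)x$ continuous) such that $z(t)=\psi_\eta(t,\omega_\tau)z_0$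 is a mild solution: $z(t)=e^{At}z_0+\int_0^te^{A(t-r)}[B_\eta(\Theta_r\omega_\tau)z(r)+h_\eta(\Theta_r\omega_\tau,z(r))]\,dr$, $t\ge0$. \emph{Notions.} A linear evolution process $\{\varphi(t,s):t\ge s\}$ admits an exponential dichotomy with (unstable) projections $\{\Pi^u(t)\}_{t\in\mathbb R}\subset\mathcal L(X)$ if, for some $M\ge1$, $\alpha>0$ and all $t\ge s$: $\Pi^u(t)\varphi(t,s)=\varphi(t,s)\Pi^u(s)$; $\varphi(t,s):R(\Pi^u(s))\to R(\Pi^u(t))$ is an isomorphism, with inverse denoted $\varphi(s,t)$; $\|\varphi(t,s)(\mathrm{Id}-\Pi^u(s))\|\le Me^{-\alpha(t-s)}$; and $\|\varphi(s,t)\Pi^u(t)\|\le Me^{\alpha(s-t)}$. Assume that $0$ is hyperbolic for $\eta=0$: $\{e^{A(t-s)}\}$ admits an exponential dichotomy with constant projection $\Pi^u_0$. The local unstable set $W^{u,\delta}_\eta(0)(s)$ (for fixed $\omega_\tau$) is the set of $z\in X$ for which there is $\zeta:\mathbb R\to X$ with $\psi_\eta(t-r,\Theta_r\omega_\tau)\zeta(r)=\zeta(t)$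 for all $t\ge r$, $\zeta(s)=z$, $\|\zeta(r)\|_X\le\delta$ for all $r\le s$, and $\zeta(r)\to0$ as $r\to-\infty$. \emph{Conclusion.} There are $\Theta$-invariant functions $\eta_0:\mathbb R\times\Omega\to(0,1]$ and $\delta_0:\mathbb R\times\Omega\to(0,\infty)$ ($\delta_0$ independent of $\eta$) and a constant $L>0$ such that: 1. For each $\omega_\tau$ and $\eta\in(0,\eta_0(\omega_\tau)]$, $0$ is a hyperbolic solution of $(\ast)$: it is a global solution, and the linear part $\dot z=A_\eta(\Theta_t\omega_\tau)z$ generates (in the mild sense) a linear evolution process $\{\varphi_\eta(t-s,\Theta_s\omega_\tau):t\ge s\}$ that admits an exponential dichotomy with projections $\Pi^u_\eta(s)=\Pi^u_\eta(\Theta_s\omega_\tau)$. 2. For each $\omega_\tau$, $\lim_{\eta\to0}\sup_{t\in\mathbb R}\|\Pi^u_\eta(t)-\Pi^u_0\|_{\mathcal L(X)}=0$. 3. For each $\omega_\tau$ and $\eta\in[0,\eta_0(\omega_\tau)]$ there is a map $(s,z)\mapsto\Sigma^u_\eta(s,\Pi^u_\eta(s)z)\in R(\mathrm{Id}-\Pi^u_\eta(s))$,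 $s\in\mathbb R$, $\|z\|_X\le\delta_0(\omega_\tau)$, bounded by $L$ and satisfying $\|\Sigma^u_\eta(s,\Pi^u_\eta(s)z)-\Sigma^u_\eta(s,\Pi^u_\eta(s)\tilde z)\|_X\le L\|\Pi^u_\eta(s)z-\Pi^u_\eta(s)\tilde z\|_X$, where $\Sigma^u_0$ depends on neither $s$ nor $\omega_\tau$, such that for every $\delta\in(0,\delta_0(\omega_\tau))$ there are $0<\delta''<\delta'<\delta$ (independent of $\eta$ and $s$) with, for all $\eta\in[0,\eta_0(\omega_\tau)]$ and $s\in\mathbb R$, $$\{\Pi^u_\eta(s)z+\Sigma^u_\eta(s,\Pi^u_\eta(s)z):\|z\|_X\le\delta''\}\subset W^{u,\delta'}_\eta(0)(s)\subset\{\Pi^u_\eta(s)z+\Sigma^u_\eta(s,\Pi^u_\eta(s)z):\|z\|_X\le\delta\}.$$ 4. For each $\omega_\tau$ and $s\in\mathbb R$, $$\sup_{t\le s}\ \sup_{\|z\|_X\le\delta_0(\omega_\tau)}\big\{\|\Pi^u_\eta(t)-\Pi^u_0\|_{\mathcal L(X)}+\|\Sigma^u_\eta(t,\Pi^u_\eta(t)z)-\Sigma^u_0(\Pi^u_0z)\|_X\big\}\longrightarrow0\quad\text{as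 }\eta\to0.$$ -/

import Mathlib

open Set Filter Topology MeasureTheory
open scoped NNReal ENNReal

namespace RandomPerturbation

section Driving

variable {Ω : Type*}

/-- A random flow `θ` on a measurable space `Ω`. -/
structure IsRandomFlow [MeasurableSpace Ω] (θ : ℝ → Ω → Ω) : Prop where
  zero : θ 0 = id
  add : ∀ t s, θ (t + s) = θ t ∘ θ s
  measurable : ∀ t, Measurable (θ t)

/-- The driving flow `Θ_t (τ, ω) = (t + τ, θ_t ω)` on `ℝ × Ω`. -/
def drive (θ : ℝ → Ω → Ω) (t : ℝ) (w : ℝ × Ω) : ℝ × Ω := (t + w.1, θ t w.2)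

/-- `Θ`-invariance of a real function on `ℝ × Ω`. -/
def IsThetaInvariant (θ : ℝ → Ω → Ω) (m : ℝ × Ω → ℝ) : Prop :=
  ∀ w t, m (drive θ t w) = m w

end Driving

section Processes

variable {X : Type*} [NormedAddCommGroup X]

/-- An evolution process `{S(t,s) : t ≥ s}`; the values `S t s` with `t < s` play no role. -/
structure IsEvolutionProcess (S : ℝ → ℝ → X → X) : Prop where
  refl : ∀ t x, S t t x = x
  comp : ∀ t s r, r ≤ s → s ≤ t → ∀ x, S t s (S s r x) = S t r x
  continuousOn : ContinuousOn (fun p : (ℝ × ℝ) × X => S p.1.1 p.1.2 p.2)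
    ({q : ℝ × ℝ | q.2 ≤ q.1} ×ˢ univ)

/-- `ζ : ℝ → X` is a global solution of the process `S`. -/
def IsGlobalSolution (S : ℝ → ℝ → X → X) (ζ : ℝ → X) : Prop :=
  ∀ s t, s ≤ t → S t s (ζ s) = ζ t

/-- The local unstable set of radius `δ` of the global solution `ξ` of `S`. -/
def localUnstableSet (S : ℝ → ℝ → X → X) (ξ : ℝ → X) (δ : ℝ) : Set (ℝ × X) :=
  {p | ∃ ζ : ℝ → X, IsGlobalSolution S ζ ∧ ζ p.1 = p.2 ∧
    (∀ s ≤ p.1, ‖ζ s - ξ s‖ ≤ δ) ∧ Tendsto (fun s => ‖ζ s - ξ s‖) atBot (𝓝 0)}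

/-- Section at time `t` of a subset of `ℝ × X`. -/
def timeSection (W : Set (ℝ × X)) (t : ℝ) : Set X := {z | (t, z) ∈ W}

/-- A nonautonomous random dynamical system (co-cycle) on `X` driven by `Θ`, jointly continuous
in time and state; the values `ψ t w` with `t < 0` play no role. -/
structure IsCocycle {Ω : Type*} [MeasurableSpace Ω] [MeasurableSpace X]
    (θ : ℝ → Ω → Ω) (ψ : ℝ → ℝ × Ω → X → X) : Prop where
  measurable : ∀ τ : ℝ, Measurable (fun p : ℝ≥0 × Ω × X => ψ (p.1 : ℝ) (τ, p.2.1) p.2.2)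
  zero : ∀ w x, ψ 0 w x = x
  add : ∀ t s, 0 ≤ t → 0 ≤ s → ∀ w x, ψ (t + s) w x = ψ t (drive θ s w) (ψ s w x)
  continuousOn : ∀ w, ContinuousOn (fun p : ℝ × X => ψ p.1 w p.2) (Ici 0 ×ˢ univ)

/-- The family `{ψ(t - s, Θ_s w)}` along the orbit of `w`. -/
def orbitProcess {Ω Y : Type*} (θ : ℝ → Ω → Ω) (ψ : ℝ → ℝ × Ω → Y) (w : ℝ × Ω) : ℝ → ℝ → Y :=
  fun t s => ψ (t - s) (drive θ s w)

variable [NormedSpace ℝ X]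

/-- A `C⁰`-semigroup `T t = e^{At}`, `t ≥ 0`, of bounded operators; the values `T t` with `t < 0`
play no role. -/
structure IsC0Semigroup (T : ℝ → X →L[ℝ] X) : Prop where
  zero : T 0 = ContinuousLinearMap.id ℝ X
  add : ∀ t s, 0 ≤ t → 0 ≤ s → T (t + s) = T t ∘L T s
  continuousOn : ∀ x, ContinuousOn (fun t => T t x) (Ici 0)

/-- `u` is a mild solution on `[s, ∞)` of `u' = (A + b(t)) u + g(t, u)`, where `T t = e^{At}`:
`u(t) = e^{A(t-s)} u(s) + ∫_s^t e^{A(t-r)} (b(r) u(r) + g(r, u(r))) dr` for `t ≥ s`. -/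
structure IsMildSolution (T : ℝ → X →L[ℝ] X) (b : ℝ → X →L[ℝ] X) (g : ℝ → X → X)
    (s : ℝ) (u : ℝ → X) : Prop where
  continuousOn : ContinuousOn u (Ici s)
  integrable : ∀ t, s ≤ t →
    IntervalIntegrable (fun r => T (t - r) (b r (u r) + g r (u r))) volume s t
  eq : ∀ t, s ≤ t →
    u t = T (t - s) (u s) + ∫ r in s..t, T (t - r) (b r (u r) + g r (u r))

/-- `φ` is the linear evolution process generated by `z' = (A + b(t)) z`, where `T t = e^{At}`. -/
def IsLinearProcess (T : ℝ → X →L[ℝ] X) (b : ℝ → X →L[ℝ] X) (φ : ℝ → ℝ → X →L[ℝ] X) : Prop :=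
  IsEvolutionProcess (fun t s x => φ t s x) ∧
    ∀ s x, IsMildSolution T b (fun _ _ => 0) s (fun t => φ t s x)

/-- Exponential dichotomy of the linear process `{φ(t,s) : t ≥ s}` with unstable projections
`Pu t`, stable projections `1 - Pu t`, bound `M` and exponent `α`. The last field is the estimate
`‖φ(s,t) Pu(t)‖ ≤ M e^{α (s - t)}` for `s ≤ t`, where `φ(s,t) : R(Pu(t)) → R(Pu(s))` is the
inverse of `φ(t,s) : R(Pu(s)) → R(Pu(t))`. -/
structure IsExpDichotomy (φ : ℝ → ℝ → X →L[ℝ] X) (Pu : ℝ → X →L[ℝ] X) (M α : ℝ) : Prop where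
  proj : ∀ t, Pu t ∘L Pu t = Pu t
  comm : ∀ s t, s ≤ t → Pu t ∘L φ t s = φ t s ∘L Pu s
  bij : ∀ s t, s ≤ t → BijOn (φ t s) (range (Pu s)) (range (Pu t))
  stable : ∀ s t, s ≤ t →
    ‖φ t s ∘L (ContinuousLinearMap.id ℝ X - Pu s)‖ ≤ M * Real.exp (-α * (t - s))
  unstable : ∀ s t, s ≤ t → ∀ x ∈ range (Pu s), ∀ y, φ t s x = Pu t y →
    ‖x‖ ≤ M * Real.exp (α * (s - t)) * ‖y‖

/-- `φ` admits an exponential dichotomy with family of unstable projections `Pu`. -/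
def HasExpDichotomy (φ : ℝ → ℝ → X →L[ℝ] X) (Pu : ℝ → X →L[ℝ] X) : Prop :=
  ∃ M α : ℝ, 1 ≤ M ∧ 0 < α ∧ IsExpDichotomy φ Pu M α

/-- The graph `{P z + σ (P z) : ‖z‖ ≤ r}`. -/
def localGraph (P : X →L[ℝ] X) (σ : X → X) (r : ℝ) : Set X :=
  {y | ∃ z : X, ‖z‖ ≤ r ∧ y = P z + σ (P z)}

end Processes

end RandomPerturbation

/-! The problem is reduced to discrete time. By the dichotomy, for some `t₀` the operator `S = T t₀`
shrinks the stable component by `1/16`, and so does its inverse on the unstable range. For small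
`η`, the time-`t₀` maps along an orbit are, near the origin, perturbations of `S` with small
Lipschitz constant.

For every sequence `F` of such perturbations and every `p` there is exactly one bounded `z : ℤ → X`
with `z (n + 1) = F n (z n)`, except that `-p` is added in the step from `-1` to `0`
(`exists_isJump`, `IsJump.unique`). Then `p + z 0` ends a bounded backward orbit and `z 0` starts a
bounded forward orbit, so `p` is split into an unstable point minus a stable point. Two choices of
`F` give all the objects needed: with linear maps throughout, `p ↦ p + z 0` is the unstable
projection; with cut-off nonlinear maps for `n < 0` and linear maps for `n ≥ 0` (`mixSeq`), `z 0`
lies in the kernel of that projection and, for small `p`, `p + z 0` lies on the local unstable set,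
so `p ↦ z 0` is the graph map.

One estimate, `IsHypSplit.norm_le_of_bounded`, gives uniqueness, the Lipschitz bounds and the
dependence of projections and graphs on the equation (`IsJump.norm_sub_le`). Away from the jump,
bounded orbits decay like `2⁻ⁿ`; this yields the dichotomy (`IsNearEvolution.isExpDichotomy`) and
the convergence to `0` of solutions on the graph (`IsSmallEquation.exists_globalSolution`).

Continuous time enters through a Neumann series for the linear equation (`exists_linear_mild`) and a
comparison of mild solutions over one step (`IsMildSolution.compare`). All constants except `η₀` are
deterministic, and `η₀` depends only on suprema over whole orbits, hence is invariant. -/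

namespace RandomPerturbation

/-! ### Bounded orbits with a jump for perturbations of a hyperbolic operator. -/

section Discrete

variable {X : Type*} [NormedAddCommGroup X] [NormedSpace ℝ X]

/-- A strongly hyperbolic splitting of the operator `S`: `P` is the unstable projection, commuting
with `S`, and `V` is the inverse of `S` on the range of `P`, precomposed with `P`; `q` bounds the
norm of the stable projection. -/
structure IsHypSplit (S P V : X →L[ℝ] X) (q : ℝ) : Prop where
  proj : ∀ x, P (P x) = P x
  comm : ∀ x, P (S x) = S (P x)
  left_inv : ∀ x, V (S x) = P x
  right_inv : ∀ x, S (V x) = P x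
  proj_inv : ∀ x, P (V x) = V x
  stable : ∀ x, ‖S (x - P x)‖ ≤ ‖x‖ / 16
  unstable : ∀ x, ‖V x‖ ≤ ‖x‖ / 16
  one_le : 1 ≤ q
  norm_sub : ∀ x, ‖x - P x‖ ≤ q * ‖x‖

/-- Every `F n` is an `ε`-Lipschitz perturbation of `S` fixing the origin. -/
structure IsNear (S : X →L[ℝ] X) (ε : ℝ) (F : ℤ → X → X) : Prop where
  zero : ∀ n, F n 0 = 0
  lip : ∀ n x y, ‖(F n x - S x) - (F n y - S y)‖ ≤ ε * ‖x - y‖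

/-- `z` is a bounded orbit of `z (n + 1) = F n (z n)` which jumps by `-p` at time `0`. -/
structure IsJump (F : ℤ → X → X) (p : X) (z : ℤ → X) : Prop where
  bdd : ∃ C, ∀ n, ‖z n‖ ≤ C
  step : ∀ n, z (n + 1) = F n (z n) + if n = -1 then -p else 0

/-- The stable part of `d n` is computed from the past through `S`, the unstable part from the
future through `V`, so that both neighbours enter with small coefficients. -/
lemma IsHypSplit.recursion {S P V : X →L[ℝ] X} {q : ℝ} (hS : IsHypSplit S P V q)
    {d e : ℤ → X} (hd : ∀ n, d (n + 1) = S (d n) + e n) (n : ℤ) :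
    d n = S (d (n - 1) - P (d (n - 1))) + (e (n - 1) - P (e (n - 1))) + V (d (n + 1) - e n) := by
  have h1 : d n = S (d (n - 1)) + e (n - 1) := by simpa using hd (n - 1)
  have h2 : V (d (n + 1) - e n) = P (d n) := by rw [hd n]; simp [hS.left_inv]
  have h3 : P (d n) = S (P (d (n - 1))) + P (e (n - 1)) := by rw [h1]; simp [hS.comm]
  rw [h2, h3]
  nth_rw 1 [h1]
  simp only [map_sub]
  abel

lemma IsHypSplit.norm_le {S P V : X →L[ℝ] X} {q : ℝ} (hS : IsHypSplit S P V q)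
    {d e : ℤ → X} (hd : ∀ n, d (n + 1) = S (d n) + e n) (n : ℤ) :
    ‖d n‖ ≤ ‖d (n - 1)‖ / 16 + q * ‖e (n - 1)‖ + (‖d (n + 1)‖ + ‖e n‖) / 16 := by
  have h := hS.recursion hd n
  have h1 := hS.stable (d (n - 1))
  have h2 := hS.norm_sub (e (n - 1))
  have h3 := hS.unstable (d (n + 1) - e n)
  have h4 := norm_sub_le (d (n + 1)) (e n)
  have h5 := norm_add₃_le (a := S (d (n - 1) - P (d (n - 1))))
    (b := (e (n - 1) - P (e (n - 1)))) (c := V (d (n + 1) - e n))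
  rw [← h] at h5
  linarith

/-- A bounded solution of `d (n + 1) = S (d n) + e n` is controlled by the part of `e` that is not
linearly bounded by `d`. -/
lemma IsHypSplit.norm_le_of_bounded {S P V : X →L[ℝ] X} {q ε κ : ℝ} (hS : IsHypSplit S P V q)
    (hε : q * ε ≤ 1 / 16) (hε0 : 0 ≤ ε) (hκ : 0 ≤ κ)
    {d e : ℤ → X} (hd : ∀ n, d (n + 1) = S (d n) + e n) (hb : ∃ C, ∀ n, ‖d n‖ ≤ C)
    (he : ∀ n, ‖e n‖ ≤ ε * ‖d n‖ + κ) (n : ℤ) : ‖d n‖ ≤ 2 * q * κ := by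
  obtain ⟨C, hC⟩ := hb
  have hbdd : BddAbove (range fun n => ‖d n‖) := ⟨C, by rintro _ ⟨n, rfl⟩; exact hC n⟩
  set D := ⨆ n, ‖d n‖ with hD
  have hle : ∀ n, ‖d n‖ ≤ D := fun n => le_ciSup hbdd n
  have hD0 : 0 ≤ D := (norm_nonneg _).trans (hle 0)
  have hq := hS.one_le
  have hε1 : ε ≤ 1 / 16 := by nlinarith
  -- The supremum `D` is finite by hypothesis, so `D / 4` can be absorbed; `4/3 * (q + 1/16) ≤ 2 *
  -- q` because `q ≥ 1`.
  have key : D ≤ D / 4 + q * κ + κ / 16 := by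
    refine ciSup_le fun n => ?_
    have h := hS.norm_le hd n
    have a1 := hle (n - 1)
    have a2 := hle (n + 1)
    have e1 : q * ‖e (n - 1)‖ ≤ D / 16 + q * κ := by
      calc q * ‖e (n - 1)‖ ≤ q * (ε * D + κ) := by
            gcongr; exact (he _).trans (by have := hle (n - 1); gcongr)
        _ = (q * ε) * D + q * κ := by ring
        _ ≤ (1 / 16) * D + q * κ := by gcongr
        _ = _ := by ring
    have e2 : ‖e n‖ ≤ D + κ := (he n).trans (by
      have := hle n
      gcongr
      nlinarith [norm_nonneg (d n)])
    linarith
  have := hle n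
  nlinarith

/-- The averaging inequality makes the supremum over a tail at most half the supremum over the tail
starting one index earlier. Boundedness is what excludes growing sequences. -/
lemma le_geometric_of_le_average {a : ℕ → ℝ} {A : ℝ} (hA : ∀ n, a n ≤ A)
    (ha : ∀ n, a (n + 1) ≤ (a n + a (n + 2)) / 4) (n : ℕ) : a n ≤ A * (1 / 2) ^ n := by
  have key : ∀ m n : ℕ, m ≤ n → a n ≤ A * (1 / 2) ^ m := by
    intro m
    induction m with
    | zero => intro n _; simpa using hA n
    | succ m ih =>
      intro n hn
      obtain ⟨k, rfl⟩ : ∃ k, n = k + 1 := ⟨n - 1, by omega⟩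
      have h1 := ih k (by omega)
      have h2 := ih (k + 2) (by omega)
      have := ha k
      rw [pow_succ]
      linarith
  exact key n n le_rfl

section

variable {S P V : X →L[ℝ] X} {q ε : ℝ} {F : ℤ → X → X}

lemma IsNear.norm_sub_le (hF : IsNear S ε F) (n : ℤ) (x : X) : ‖F n x - S x‖ ≤ ε * ‖x‖ := by
  simpa [hF.zero] using hF.lip n x 0

/-- Dependence of jump orbits on the maps and on the jump. -/
lemma IsJump.norm_sub_le (hS : IsHypSplit S P V q) (hε : q * ε ≤ 1 / 16) (hε0 : 0 ≤ ε)
    (hF : IsNear S ε F) {G : ℤ → X → X} {p p' : X} {z z' : ℤ → X} (hz : IsJump F p z)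
    (hz' : IsJump G p' z') {κ : ℝ} (hκ : ∀ n, ‖F n (z' n) - G n (z' n)‖ ≤ κ) (n : ℤ) :
    ‖z n - z' n‖ ≤ 2 * q * (κ + ‖p - p'‖) := by
  have hκ0 : 0 ≤ κ := (norm_nonneg _).trans (hκ 0)
  obtain ⟨C, hC⟩ := hz.bdd
  obtain ⟨C', hC'⟩ := hz'.bdd
  -- Only `F` has to be Lipschitz: the maps `F` and `G` are compared along the single orbit `z'`,
  -- and the rest of the error is absorbed.
  refine hS.norm_le_of_bounded (d := fun n => z n - z' n) hε hε0 (by positivity)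
    (e := fun n => ((F n (z n) - S (z n)) - (F n (z' n) - S (z' n))) + (F n (z' n) - G n (z' n))
      + if n = -1 then -(p - p') else 0) ?_ ?_ ?_ n
  · intro n
    simp only [hz.step, hz'.step, map_sub]
    split_ifs <;> abel
  · exact ⟨C + C', fun n => (_root_.norm_sub_le _ _).trans (add_le_add (hC n) (hC' n))⟩
  · intro n
    refine (norm_add₃_le).trans ?_
    have h1 := hF.lip n (z n) (z' n)
    have h2 : ‖(if n = -1 then -(p - p') else 0 : X)‖ ≤ ‖p - p'‖ := by
      split_ifs
      · rw [norm_neg]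
      · simp
    have := hκ n
    linarith

lemma IsJump.norm_sub_le' (hS : IsHypSplit S P V q) (hε : q * ε ≤ 1 / 16) (hε0 : 0 ≤ ε)
    (hF : IsNear S ε F) {p p' : X} {z z' : ℤ → X} (hz : IsJump F p z)
    (hz' : IsJump F p' z') (n : ℤ) : ‖z n - z' n‖ ≤ 2 * q * ‖p - p'‖ := by
  simpa using hz.norm_sub_le hS hε hε0 hF hz' (κ := 0) (by simp) n

lemma IsNear.isJump_zero (hF : IsNear S ε F) : IsJump F 0 0 :=
  ⟨⟨0, by simp⟩, by simp [hF.zero]⟩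

lemma IsJump.norm_le (hS : IsHypSplit S P V q) (hε : q * ε ≤ 1 / 16) (hε0 : 0 ≤ ε)
    (hF : IsNear S ε F) {p : X} {z : ℤ → X} (hz : IsJump F p z) (n : ℤ) :
    ‖z n‖ ≤ 2 * q * ‖p‖ := by
  simpa using hz.norm_sub_le' hS hε hε0 hF hF.isJump_zero n

lemma IsJump.unique (hS : IsHypSplit S P V q) (hε : q * ε ≤ 1 / 16) (hε0 : 0 ≤ ε)
    (hF : IsNear S ε F) {p : X} {z z' : ℤ → X} (hz : IsJump F p z)
    (hz' : IsJump F p z') : z = z' := by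
  ext n
  have := hz.norm_sub_le' hS hε hε0 hF hz' n
  rw [sub_self, norm_zero, mul_zero] at this
  exact sub_eq_zero.1 (norm_le_zero_iff.1 this)

/-- The recursion at `n` involves the errors at `n - 1` and `n`; the jump sits at index `-1`, so
exactly `n = 0` and `n = -1` have to be avoided. -/
lemma IsJump.average (hS : IsHypSplit S P V q) (hε : q * ε ≤ 1 / 16) (hε0 : 0 ≤ ε)
    (hF : IsNear S ε F) {p : X} {z : ℤ → X} (hz : IsJump F p z) {n : ℤ} (h0 : n ≠ 0)
    (h1 : n ≠ -1) : ‖z n‖ ≤ (‖z (n - 1)‖ + ‖z (n + 1)‖) / 4 := by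
  have h := hS.norm_le (d := z)
    (e := fun n => F n (z n) - S (z n) + if n = -1 then -p else 0)
    (fun n => by rw [hz.step]; abel) n
  have h2 : n - 1 ≠ -1 := fun h => h0 (by omega)
  simp only [h1, h2, if_false, add_zero] at h
  have e1 := hF.norm_sub_le n (z n)
  have e2 := hF.norm_sub_le (n - 1) (z (n - 1))
  have hq := hS.one_le
  have hε1 : ε ≤ 1 / 16 := by nlinarith
  have e3 : q * ‖F (n - 1) (z (n - 1)) - S (z (n - 1))‖ ≤ ‖z (n - 1)‖ / 16 := by
    calc _ ≤ q * (ε * ‖z (n - 1)‖) := by gcongr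
      _ = q * ε * ‖z (n - 1)‖ := by ring
      _ ≤ 1 / 16 * ‖z (n - 1)‖ := by gcongr
      _ = _ := by ring
  have e4 : ε * ‖z n‖ ≤ 1 / 16 * ‖z n‖ := by gcongr
  have := norm_nonneg (z (n - 1))
  have := norm_nonneg (z (n + 1))
  linarith

lemma IsJump.forward_decay (hS : IsHypSplit S P V q) (hε : q * ε ≤ 1 / 16) (hε0 : 0 ≤ ε)
    (hF : IsNear S ε F) {p : X} {z : ℤ → X} (hz : IsJump F p z) (n : ℕ) :
    ‖z n‖ ≤ 2 * q * ‖p‖ * (1 / 2) ^ n := by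
  refine le_geometric_of_le_average (a := fun n : ℕ => ‖z n‖)
    (fun n => hz.norm_le hS hε hε0 hF n) (fun n => ?_) n
  have := hz.average hS hε hε0 hF (n := (n : ℤ) + 1) (by omega) (by omega)
  simp only [add_sub_cancel_right] at this
  push_cast
  rw [show (n : ℤ) + 2 = n + 1 + 1 by ring]
  exact this

lemma IsJump.backward_decay (hS : IsHypSplit S P V q) (hε : q * ε ≤ 1 / 16) (hε0 : 0 ≤ ε)
    (hF : IsNear S ε F) {p : X} {z : ℤ → X} (hz : IsJump F p z) (n : ℕ) :
    ‖z (-1 - n)‖ ≤ 2 * q * ‖p‖ * (1 / 2) ^ n := by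
  refine le_geometric_of_le_average (a := fun n : ℕ => ‖z (-1 - n)‖)
    (fun n => hz.norm_le hS hε hε0 hF _) (fun n => ?_) n
  have := hz.average hS hε hε0 hF (n := -1 - ((n : ℤ) + 1)) (by omega) (by omega)
  rw [add_comm ‖_‖] at this
  push_cast
  convert this using 5 <;> omega

/-- The right side of `IsHypSplit.recursion`, with perturbation and jump as error, is a
`1/2`-contraction on bounded sequences. Its fixed point is the orbit. -/
lemma exists_isJump [CompleteSpace X] (hS : IsHypSplit S P V q) (hε : q * ε ≤ 1 / 16)
    (hε0 : 0 ≤ ε) (hF : IsNear S ε F) (p : X) : ∃ z, IsJump F p z := by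
  set g : ℤ → X := fun n => if n = -1 then -p else 0 with hg
  have hgp : ∀ n, ‖g n‖ ≤ ‖p‖ := by
    intro n
    simp only [hg]
    split_ifs
    · rw [norm_neg]
    · simp
  have hq := hS.one_le
  have hε1 : ε ≤ 1 / 16 := by nlinarith
  set R : ℤ → X → X := fun n x => F n x - S x with hR
  set A : (ℤ → X) → ℤ → X := fun z n => S (z (n - 1) - P (z (n - 1))) +
    ((R (n - 1) (z (n - 1)) + g (n - 1)) - P (R (n - 1) (z (n - 1)) + g (n - 1))) +
    V (z (n + 1) - (R n (z n) + g n)) with hA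
  have hAlip : ∀ (z z' : ℤ → X) (D : ℝ), (∀ n, ‖z n - z' n‖ ≤ D) →
      ∀ n, ‖A z n - A z' n‖ ≤ 1 / 2 * D := by
    intro z z' D hD n
    have e : A z n - A z' n = S ((z (n - 1) - z' (n - 1)) - P (z (n - 1) - z' (n - 1))) +
      ((R (n - 1) (z (n - 1)) - R (n - 1) (z' (n - 1))) -
        P (R (n - 1) (z (n - 1)) - R (n - 1) (z' (n - 1)))) +
      V ((z (n + 1) - z' (n + 1)) - (R n (z n) - R n (z' n))) := by
      simp only [hA, map_sub, map_add]
      abel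
    rw [e]
    have h1 := hS.stable (z (n - 1) - z' (n - 1))
    have h2 := hS.norm_sub (R (n - 1) (z (n - 1)) - R (n - 1) (z' (n - 1)))
    have h3 := hS.unstable ((z (n + 1) - z' (n + 1)) - (R n (z n) - R n (z' n)))
    have h4 := norm_sub_le (z (n + 1) - z' (n + 1)) (R n (z n) - R n (z' n))
    have l1 : ‖R n (z n) - R n (z' n)‖ ≤ ε * ‖z n - z' n‖ := hF.lip n _ _
    have l2 : ‖R (n - 1) (z (n - 1)) - R (n - 1) (z' (n - 1))‖ ≤ ε * ‖z (n - 1) - z' (n - 1)‖ :=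
      hF.lip (n - 1) _ _
    have d1 := hD n
    have d2 := hD (n - 1)
    have d3 := hD (n + 1)
    have hD0 : 0 ≤ D := (norm_nonneg _).trans d1
    have l3 : q * ‖R (n - 1) (z (n - 1)) - R (n - 1) (z' (n - 1))‖ ≤ 1 / 16 * D := by
      calc _ ≤ q * (ε * D) := by gcongr; exact l2.trans (by gcongr)
        _ = q * ε * D := by ring
        _ ≤ _ := by gcongr
    have l4 : ε * ‖z n - z' n‖ ≤ 1 / 16 * D := by gcongr
    refine norm_add₃_le.trans ?_
    linarith
  have hAbdd : ∀ (z : ℤ → X) (D : ℝ), (∀ n, ‖z n‖ ≤ D) →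
      ∃ C, ∀ n, ‖A z n‖ ≤ C := by
    intro z D hD
    refine ⟨1 / 2 * D + (q * ‖p‖ + ‖p‖ / 16), fun n => ?_⟩
    have h1 := hAlip z 0 D (by simpa using hD) n
    have h2 : A 0 n = (g (n - 1) - P (g (n - 1))) + V (-g n) := by
      simp [hA, hR, hF.zero]
    have h3 : ‖A 0 n‖ ≤ q * ‖p‖ + ‖p‖ / 16 := by
      rw [h2]
      refine (norm_add_le _ _).trans (add_le_add ?_ ?_)
      · exact (hS.norm_sub _).trans (by gcongr; exact hgp _)
      · refine (hS.unstable _).trans ?_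
        rw [norm_neg]
        gcongr
        exact hgp _
    have := norm_add_le (A z n - A 0 n) (A 0 n)
    rw [sub_add_cancel] at this
    linarith
  let Λ : BoundedContinuousFunction ℤ X → BoundedContinuousFunction ℤ X := fun z =>
    BoundedContinuousFunction.ofNormedAddCommGroupDiscrete (A z)
      (hAbdd z ‖z‖ z.norm_coe_le_norm).choose (hAbdd z ‖z‖ z.norm_coe_le_norm).choose_spec
  have hΛ : ContractingWith (1 / 2 : ℝ≥0) Λ := by
    refine ⟨by rw [div_lt_one (by norm_num)]; norm_num, LipschitzWith.of_dist_le_mul fun z z' => ?_⟩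
    rw [BoundedContinuousFunction.dist_le (by positivity)]
    intro n
    rw [dist_eq_norm]
    have := hAlip z z' (dist z z')
      (fun n => by rw [← dist_eq_norm]; exact BoundedContinuousFunction.dist_coe_le_dist n) n
    simpa [Λ] using this
  obtain ⟨z, hz⟩ : ∃ z, Λ z = z := ⟨_, hΛ.fixedPoint_isFixedPt⟩
  have hz' : ∀ n, z n = A z n := fun n => by
    conv_lhs => rw [← hz]
    rfl
  refine ⟨z, ⟨‖z‖, z.norm_coe_le_norm⟩, fun n => ?_⟩
  -- Conversely, a fixed point of the two-sided recursion is an orbit: its components under `P` and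
  -- `1 - P` satisfy the one-step equation separately.
  have hP : ∀ n, P (z n) = V (z (n + 1) - (R n (z n) + g n)) := by
    intro n
    refine (congrArg P (hz' n)).trans ?_
    simp only [hA, map_sub, map_add, hS.proj, hS.comm, hS.proj_inv]
    abel
  have hQ : z (n + 1) - P (z (n + 1)) = S (z n - P (z n)) +
      ((R n (z n) + g n) - P (R n (z n) + g n)) := by
    rw [hP (n + 1), sub_eq_iff_eq_add]
    refine (hz' (n + 1)).trans ?_
    simp only [hA, add_sub_cancel_right]
  have hSP : S (P (z n)) = P (z (n + 1)) - P (R n (z n) + g n) := by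
    rw [hP n, hS.right_inv, map_sub]
  have : z (n + 1) = S (z n) + (R n (z n) + g n) := by
    rw [map_sub, hSP] at hQ
    have := congrArg (fun y => y + P (z (n + 1))) hQ
    simp only [sub_add_cancel] at this
    rw [this]
    abel
  rw [this]
  simp only [hR, hg]
  abel

open Classical in
/-- The bounded orbit with jump `-p` (junk if there is none). -/
noncomputable def jumpOrbit (F : ℤ → X → X) (p : X) : ℤ → X :=
  if h : ∃ z, IsJump F p z then h.choose else 0

lemma isJump_jumpOrbit [CompleteSpace X] (hS : IsHypSplit S P V q) (hε : q * ε ≤ 1 / 16)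
    (hε0 : 0 ≤ ε) (hF : IsNear S ε F) (p : X) : IsJump F p (jumpOrbit F p) := by
  have h := exists_isJump hS hε hε0 hF p
  rw [jumpOrbit, dif_pos h]
  exact h.choose_spec

lemma IsJump.eq_jumpOrbit [CompleteSpace X] (hS : IsHypSplit S P V q) (hε : q * ε ≤ 1 / 16)
    (hε0 : 0 ≤ ε) (hF : IsNear S ε F) {p : X} {z : ℤ → X} (hz : IsJump F p z) :
    jumpOrbit F p = z :=
  (isJump_jumpOrbit hS hε hε0 hF p).unique hS hε hε0 hF hz

/-- `u` is the endpoint of a bounded backward orbit. -/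
def HasBackwardOrbit (F : ℤ → X → X) (u : X) : Prop :=
  ∃ c : ℤ → X, c 0 = u ∧ (∃ C, ∀ n ≤ 0, ‖c n‖ ≤ C) ∧ ∀ n < 0, c (n + 1) = F n (c n)

/-- `v` is the starting point of a bounded forward orbit. -/
def HasForwardOrbit (F : ℤ → X → X) (v : X) : Prop :=
  ∃ c : ℤ → X, c 0 = v ∧ (∃ C, ∀ n, 0 ≤ n → ‖c n‖ ≤ C) ∧ ∀ n, 0 ≤ n → c (n + 1) = F n (c n)

/-- The projection along the bounded forward orbits onto the bounded backward orbits. -/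
noncomputable def jumpProj (F : ℤ → X → X) (x : X) : X := x + jumpOrbit F x 0

lemma jumpProj_eq [CompleteSpace X] (hS : IsHypSplit S P V q) (hε : q * ε ≤ 1 / 16)
    (hε0 : 0 ≤ ε) (hF : IsNear S ε F) (x : X) : jumpProj F x = F (-1) (jumpOrbit F x (-1)) := by
  have := (isJump_jumpOrbit hS hε hε0 hF x).step (-1)
  simp only [Int.reduceNeg, neg_add_cancel, if_true] at this
  rw [jumpProj, this]
  abel

lemma hasBackwardOrbit_jumpProj [CompleteSpace X] (hS : IsHypSplit S P V q)
    (hε : q * ε ≤ 1 / 16) (hε0 : 0 ≤ ε) (hF : IsNear S ε F) (x : X) :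
    HasBackwardOrbit F (jumpProj F x) := by
  have hz := isJump_jumpOrbit hS hε hε0 hF x
  obtain ⟨C, hC⟩ := hz.bdd
  -- The value at `0` is replaced by the value before the jump.
  refine ⟨fun n => if n = 0 then jumpProj F x else jumpOrbit F x n, by simp,
    ⟨max C ‖jumpProj F x‖, fun n _ => ?_⟩, fun n hn => ?_⟩
  · dsimp only
    split_ifs
    · exact le_max_right _ _
    · exact (hC n).trans (le_max_left _ _)
  · beta_reduce
    rw [if_neg hn.ne]
    split_ifs with h
    · obtain rfl : n = -1 := by omega
      exact jumpProj_eq hS hε hε0 hF x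
    · rw [hz.step, if_neg (by omega), add_zero]

/-- A point with a bounded backward orbit under `F` is in the graph of the jump of `F` over any
point from which it differs by a bounded forward orbit. -/
lemma HasBackwardOrbit.jumpOrbit_eq [CompleteSpace X] (hS : IsHypSplit S P V q)
    (hε : q * ε ≤ 1 / 16) (hε0 : 0 ≤ ε) (hF : IsNear S ε F) {u p : X}
    (hu : HasBackwardOrbit F u) (hp : HasForwardOrbit F (u - p)) :
    jumpOrbit F p 0 = u - p := by
  obtain ⟨c, hc0, ⟨C, hC⟩, hc⟩ := hu
  obtain ⟨d, hd0, ⟨D, hD⟩, hd⟩ := hp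
  -- Glued at `0`, the two half orbits form a bounded orbit with jump `-p`; uniqueness identifies
  -- it.
  have : IsJump F p (fun n => if n < 0 then c n else d n) := by
    refine ⟨⟨max C D, fun n => ?_⟩, fun n => ?_⟩
    · split_ifs with h
      · exact (hC n h.le).trans (le_max_left _ _)
      · exact (hD n (by omega)).trans (le_max_right _ _)
    · rcases lt_trichotomy n (-1) with h | rfl | h
      · rw [if_pos (by omega), if_pos (by omega), if_neg h.ne, add_zero, hc n (by omega)]
      · have := hc (-1) (by norm_num)
        simp only [Int.reduceNeg, neg_add_cancel] at this
        simp [hd0, ← this, hc0, sub_eq_add_neg]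
      · rw [if_neg (by omega), if_neg (by omega), if_neg h.ne', add_zero, hd n (by omega)]
  rw [this.eq_jumpOrbit hS hε hε0 hF]
  simp [hd0]

lemma HasForwardOrbit.zero (hF : IsNear S ε F) : HasForwardOrbit F (0 : X) :=
  ⟨0, rfl, ⟨0, by simp⟩, by simp [hF.zero]⟩

lemma HasBackwardOrbit.zero (hF : IsNear S ε F) : HasBackwardOrbit F (0 : X) :=
  ⟨0, rfl, ⟨0, by simp⟩, by simp [hF.zero]⟩

lemma HasBackwardOrbit.jumpProj_eq [CompleteSpace X] (hS : IsHypSplit S P V q)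
    (hε : q * ε ≤ 1 / 16) (hε0 : 0 ≤ ε) (hF : IsNear S ε F) {u : X}
    (hu : HasBackwardOrbit F u) : jumpProj F u = u := by
  rw [jumpProj, hu.jumpOrbit_eq hS hε hε0 hF (p := u)]
  · simp
  · rw [sub_self]
    exact .zero hF

lemma hasForwardOrbit_jumpOrbit [CompleteSpace X] (hS : IsHypSplit S P V q)
    (hε : q * ε ≤ 1 / 16) (hε0 : 0 ≤ ε) (hF : IsNear S ε F) (p : X) :
    HasForwardOrbit F (jumpOrbit F p 0) := by
  have hz := isJump_jumpOrbit hS hε hε0 hF p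
  obtain ⟨C, hC⟩ := hz.bdd
  exact ⟨_, rfl, ⟨C, fun n _ => hC n⟩, fun n hn => by
    rw [hz.step, if_neg (by omega), add_zero]⟩

lemma norm_jumpOrbit_sub_le [CompleteSpace X] (hS : IsHypSplit S P V q)
    (hε : q * ε ≤ 1 / 16) (hε0 : 0 ≤ ε) (hF : IsNear S ε F) (p p' : X) (n : ℤ) :
    ‖jumpOrbit F p n - jumpOrbit F p' n‖ ≤ 2 * q * ‖p - p'‖ :=
  (isJump_jumpOrbit hS hε hε0 hF p).norm_sub_le' hS hε hε0 hF (isJump_jumpOrbit hS hε hε0 hF p') n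

/-- The orbit with jump of the unperturbed operator starts at minus the stable part. -/
lemma IsHypSplit.jumpProj_eq [CompleteSpace X] (hS : IsHypSplit S P V q) (x : X) :
    jumpProj (fun _ => S) x = P x := by
  have hN : IsNear S 0 (fun _ => S) := ⟨by simp, by simp⟩
  -- For the unperturbed operator both half orbits are explicit: powers of `V` on `P x` in the past,
  -- powers of `S` on the stable part in the future.
  have key : ∀ n : ℕ, ‖(V ^ n) (P x)‖ ≤ ‖P x‖ := by
    intro n
    induction n with
    | zero => simp
    | succ n ih =>
      rw [pow_succ', mul_apply_eq_comp]
      have := hS.unstable ((V ^ n) (P x))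
      have := norm_nonneg ((V ^ n) (P x))
      linarith
  have keyP : ∀ n : ℕ, P ((V ^ n) (P x)) = (V ^ n) (P x) := by
    intro n
    cases n with
    | zero => simp [hS.proj]
    | succ n => rw [pow_succ', mul_apply_eq_comp, hS.proj_inv]
  have keyS : ∀ n : ℕ, ‖(S ^ n) (x - P x)‖ ≤ ‖x - P x‖ ∧ P ((S ^ n) (x - P x)) = 0 := by
    intro n
    induction n with
    | zero => simp [hS.proj]
    | succ n ih =>
      rw [pow_succ', mul_apply_eq_comp]
      have h := hS.stable ((S ^ n) (x - P x))
      rw [ih.2, sub_zero] at h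
      have := norm_nonneg ((S ^ n) (x - P x))
      exact ⟨by linarith [ih.1], by rw [hS.comm, ih.2, map_zero]⟩
  have hb : HasBackwardOrbit (fun _ => S) (P x) := by
    refine ⟨fun n => (V ^ n.natAbs) (P x), by simp, ⟨‖P x‖, fun n _ => key _⟩, fun n hn => ?_⟩
    obtain ⟨k, rfl⟩ : ∃ k : ℕ, n = -(k + 1 : ℤ) := ⟨(-n - 1).toNat, by omega⟩
    have h1 : (-(k + 1 : ℤ) + 1).natAbs = k := by omega
    have h2 : (-(k + 1 : ℤ)).natAbs = k + 1 := by omega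
    dsimp only
    rw [h1, h2, pow_succ', mul_apply_eq_comp, hS.right_inv, keyP]
  have hf : HasForwardOrbit (fun _ => S) (P x - x) := by
    refine ⟨fun n => -(S ^ n.toNat) (x - P x), by simp, ⟨‖x - P x‖, fun n _ => ?_⟩, fun n hn => ?_⟩
    · rw [norm_neg]; exact (keyS _).1
    · obtain ⟨k, rfl⟩ : ∃ k : ℕ, n = k := ⟨n.toNat, by omega⟩
      have h1 : ((k : ℤ) + 1).toNat = k + 1 := by omega
      dsimp only
      rw [h1, Int.toNat_natCast, pow_succ', mul_apply_eq_comp, map_neg]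
  rw [jumpProj, hb.jumpOrbit_eq hS (ε := 0) (by norm_num) le_rfl hN hf]
  abel

end

end Discrete

/-! ### The projection attached to a sequence of linear steps. -/

section LinearSteps

variable {X : Type*} [NormedAddCommGroup X] [NormedSpace ℝ X]
  {S P V : X →L[ℝ] X} {q ε : ℝ}

lemma HasForwardOrbit.neg {F : ℤ → X →L[ℝ] X} {v : X}
    (h : HasForwardOrbit (fun n => F n) v) : HasForwardOrbit (fun n => F n) (-v) := by
  obtain ⟨c, hc0, ⟨C, hC⟩, hc⟩ := h
  exact ⟨-c, by simp [hc0], ⟨C, by simpa using hC⟩, fun n hn => by simp [hc n hn]⟩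

/-- Sums and multiples of jump orbits of linear maps are jump orbits, so linearity follows from
uniqueness. -/
lemma exists_clm_jumpProj [CompleteSpace X] (hS : IsHypSplit S P V q) (hε : q * ε ≤ 1 / 16)
    (hε0 : 0 ≤ ε) {F : ℤ → X →L[ℝ] X} (hF : IsNear S ε (fun n => F n)) :
    ∃ Q : X →L[ℝ] X, ∀ x, Q x = jumpProj (fun n => F n) x := by
  have hj := isJump_jumpOrbit hS hε hε0 hF
  refine ⟨LinearMap.mkContinuous
    { toFun := jumpProj (fun n => F n)
      map_add' := fun x y => ?_
      map_smul' := fun a x => ?_ } (1 + 2 * q) fun x => ?_, fun x => rfl⟩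
  · have : IsJump (fun n => F n) (x + y)
        (jumpOrbit (fun n => F n) x + jumpOrbit (fun n => F n) y) := by
      obtain ⟨C, hC⟩ := (hj x).bdd
      obtain ⟨D, hD⟩ := (hj y).bdd
      refine ⟨⟨C + D, fun n => (norm_add_le _ _).trans (add_le_add (hC n) (hD n))⟩, fun n => ?_⟩
      simp only [Pi.add_apply, (hj x).step, (hj y).step, map_add]
      split_ifs <;> abel
    simp only [jumpProj]
    rw [this.eq_jumpOrbit hS hε hε0 hF, Pi.add_apply]
    abel
  · have : IsJump (fun n => F n) (a • x) (a • jumpOrbit (fun n => F n) x) := by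
      obtain ⟨C, hC⟩ := (hj x).bdd
      refine ⟨⟨‖a‖ * C, fun n => ?_⟩, fun n => ?_⟩
      · rw [Pi.smul_apply, norm_smul]
        gcongr
        exact hC n
      · simp only [Pi.smul_apply, (hj x).step, map_smul]
        split_ifs <;> simp
    simp only [jumpProj, RingHom.id_apply]
    rw [this.eq_jumpOrbit hS hε hε0 hF, Pi.smul_apply, smul_add]
  · have := (hj x).norm_le hS hε hε0 hF 0
    refine (norm_add_le _ _).trans ?_
    linarith

open Classical in
/-- `jumpProj F` as a bounded operator (junk if it is not one). -/
noncomputable def projOf (F : ℤ → X → X) : X →L[ℝ] X :=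
  if h : ∃ Q : X →L[ℝ] X, ∀ x, Q x = jumpProj F x then h.choose else 0

lemma projOf_apply [CompleteSpace X] (hS : IsHypSplit S P V q) (hε : q * ε ≤ 1 / 16)
    (hε0 : 0 ≤ ε) {F : ℤ → X →L[ℝ] X} (hF : IsNear S ε (fun n => F n)) (x : X) :
    projOf (fun n => F n) x = jumpProj (fun n => F n) x := by
  have h := exists_clm_jumpProj hS hε hε0 hF
  rw [projOf, dif_pos h]
  exact h.choose_spec x

section

variable [CompleteSpace X]

/-- This and the next lemmas identify the range of `projOf` with the endpoints of bounded backward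
orbits and its kernel with the starting points of bounded forward orbits. The invariance properties
of the dichotomy rest on this description. -/
lemma HasBackwardOrbit.projOf_eq (hS : IsHypSplit S P V q) (hε : q * ε ≤ 1 / 16)
    (hε0 : 0 ≤ ε) {F : ℤ → X →L[ℝ] X} (hF : IsNear S ε (fun n => F n)) {u : X}
    (hu : HasBackwardOrbit (fun n => F n) u) : projOf (fun n => F n) u = u := by
  rw [projOf_apply hS hε hε0 hF, hu.jumpProj_eq hS hε hε0 hF]

lemma HasForwardOrbit.projOf_eq (hS : IsHypSplit S P V q) (hε : q * ε ≤ 1 / 16)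
    (hε0 : 0 ≤ ε) {F : ℤ → X →L[ℝ] X} (hF : IsNear S ε (fun n => F n)) {v : X}
    (hv : HasForwardOrbit (fun n => F n) v) : projOf (fun n => F n) v = 0 := by
  rw [projOf_apply hS hε hε0 hF, jumpProj,
    (HasBackwardOrbit.zero hF).jumpOrbit_eq hS hε hε0 hF (p := v)]
  · simp
  · rw [zero_sub]
    exact hv.neg

lemma hasBackwardOrbit_projOf (hS : IsHypSplit S P V q) (hε : q * ε ≤ 1 / 16)
    (hε0 : 0 ≤ ε) {F : ℤ → X →L[ℝ] X} (hF : IsNear S ε (fun n => F n)) (x : X) :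
    HasBackwardOrbit (fun n => F n) (projOf (fun n => F n) x) := by
  rw [projOf_apply hS hε hε0 hF]
  exact hasBackwardOrbit_jumpProj hS hε hε0 hF x

lemma sub_projOf (hS : IsHypSplit S P V q) (hε : q * ε ≤ 1 / 16)
    (hε0 : 0 ≤ ε) {F : ℤ → X →L[ℝ] X} (hF : IsNear S ε (fun n => F n)) (x : X) :
    x - projOf (fun n => F n) x = -jumpOrbit (fun n => F n) x 0 := by
  rw [projOf_apply hS hε hε0 hF, jumpProj]
  abel

lemma hasForwardOrbit_sub_projOf (hS : IsHypSplit S P V q) (hε : q * ε ≤ 1 / 16)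
    (hε0 : 0 ≤ ε) {F : ℤ → X →L[ℝ] X} (hF : IsNear S ε (fun n => F n)) (x : X) :
    HasForwardOrbit (fun n => F n) (x - projOf (fun n => F n) x) := by
  rw [sub_projOf hS hε hε0 hF]
  exact (hasForwardOrbit_jumpOrbit hS hε hε0 hF x).neg

lemma IsHypSplit.projOf_eq (hS : IsHypSplit S P V q) : projOf (fun _ => S) = P := by
  have hN : IsNear S 0 (fun _ => S) := ⟨by simp, by simp⟩
  ext x
  rw [projOf_apply (F := fun _ => S) hS (ε := 0) (by norm_num) le_rfl hN, hS.jumpProj_eq]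

/-- Both projections come from jump orbits with the same jump `x`; the steps are compared along the
orbit of `S`, which is bounded by `2 * q * ‖x‖`. -/
lemma norm_projOf_sub_le (hS : IsHypSplit S P V q) (hε : q * ε ≤ 1 / 16)
    (hε0 : 0 ≤ ε) {F : ℤ → X →L[ℝ] X} (hF : IsNear S ε (fun n => F n)) {κ : ℝ} (hκ0 : 0 ≤ κ)
    (hκ : ∀ n x, ‖F n x - S x‖ ≤ κ * ‖x‖) : ‖projOf (fun n => F n) - P‖ ≤ 4 * q ^ 2 * κ := by
  have hN : IsNear S 0 (fun _ => S) := ⟨by simp, by simp⟩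
  have h0 : q * 0 ≤ 1 / 16 := by norm_num
  have hq := hS.one_le
  refine ContinuousLinearMap.opNorm_le_bound _ (by positivity) fun x => ?_
  have hz' := isJump_jumpOrbit hS h0 le_rfl hN x
  have h := (isJump_jumpOrbit hS hε hε0 hF x).norm_sub_le hS hε hε0 hF
    (κ := κ * (2 * q * ‖x‖)) hz' (fun n => (hκ n _).trans
      (by gcongr; exact hz'.norm_le hS h0 le_rfl hN n)) 0
  have e : (projOf (fun n => F n) - P) x =
      jumpOrbit (fun n => F n) x 0 - jumpOrbit (fun _ => S) x 0 := by
    rw [sub_apply, projOf_apply hS hε hε0 hF, ← hS.jumpProj_eq x,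
      jumpProj, jumpProj]
    abel
  rw [e]
  refine h.trans (le_of_eq ?_)
  rw [sub_self, norm_zero]
  ring

end

end LinearSteps

/-! ### From discrete steps to an exponential dichotomy in continuous time. -/

section Dichotomy

variable {X : Type*} [NormedAddCommGroup X] [NormedSpace ℝ X]
  {S P V : X →L[ℝ] X} {q ε : ℝ}

/-- The steps of length `t₀` of the process `φ` before and after time `s`. -/
def stepSeq (φ : ℝ → ℝ → X →L[ℝ] X) (t₀ s : ℝ) (n : ℤ) : X →L[ℝ] X :=
  φ (s + (n + 1) * t₀) (s + n * t₀)

/-- Over time `t₀ > 0` the linear process `φ` is `ε`-close to `S`, and it is bounded by `K` in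
between. -/
structure IsNearEvolution (S : X →L[ℝ] X) (ε t₀ K : ℝ) (φ : ℝ → ℝ → X →L[ℝ] X) : Prop where
  refl : ∀ t x, φ t t x = x
  comp : ∀ t s r, r ≤ s → s ≤ t → ∀ x, φ t s (φ s r x) = φ t r x
  pos : 0 < t₀
  one_le : 1 ≤ K
  near : ∀ s x, ‖φ (s + t₀) s x - S x‖ ≤ ε * ‖x‖
  bound : ∀ s t, s ≤ t → t ≤ s + t₀ → ∀ x, ‖φ t s x‖ ≤ K * ‖x‖

variable {t₀ K : ℝ} {φ : ℝ → ℝ → X →L[ℝ] X}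

lemma IsNearEvolution.norm_stepSeq_sub (h : IsNearEvolution S ε t₀ K φ) (s : ℝ) (n : ℤ) (x : X) :
    ‖stepSeq φ t₀ s n x - S x‖ ≤ ε * ‖x‖ := by
  have := h.near (s + n * t₀) x
  rwa [stepSeq, show s + (n + 1 : ℝ) * t₀ = s + n * t₀ + t₀ by ring]

lemma IsNearEvolution.isNear (h : IsNearEvolution S ε t₀ K φ) (s : ℝ) :
    IsNear S ε (fun n => stepSeq φ t₀ s n) := by
  refine ⟨by simp, fun n x y => ?_⟩
  have := h.norm_stepSeq_sub s n (x - y)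
  simpa only [map_sub, sub_sub_sub_comm] using this

lemma IsNearEvolution.growth (h : IsNearEvolution S ε t₀ K φ) (m : ℕ) {s t : ℝ} (hst : s ≤ t)
    (ht : t ≤ s + m * t₀) (x : X) : ‖φ t s x‖ ≤ K ^ m * ‖x‖ := by
  have hK := h.one_le
  induction m generalizing t with
  | zero =>
    obtain rfl : t = s := le_antisymm (by simpa using ht) hst
    simp [h.refl]
  | succ m ih =>
    rcases le_total t (s + m * t₀) with h1 | h1
    · refine (ih hst h1).trans ?_
      gcongr
      omega
    · have h2 : s ≤ s + m * t₀ := by have := h.pos; nlinarith [(Nat.cast_nonneg m : (0:ℝ) ≤ m)]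
      rw [← h.comp t _ s h2 h1]
      refine (h.bound _ _ h1 (by push_cast at ht; linarith) _).trans ?_
      rw [pow_succ', mul_assoc]
      gcongr
      exact ih h2 le_rfl

lemma IsNearEvolution.forward_orbit_eq (h : IsNearEvolution S ε t₀ K φ) {s : ℝ} {c : ℤ → X} {m : ℤ}
    (k : ℕ) (hc : ∀ n, m ≤ n → n < m + k → c (n + 1) = stepSeq φ t₀ s n (c n)) :
    c (m + k) = φ (s + (m + k) * t₀) (s + m * t₀) (c m) := by
  have ht := h.pos
  induction k with
  | zero => simp [h.refl]
  | succ k ih =>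
    have e := hc (m + k) (by omega) (by push_cast; omega)
    rw [ih (fun n h1 h2 => hc n h1 (by push_cast; omega)), stepSeq, Int.cast_add,
      Int.cast_natCast, h.comp] at e
    · push_cast
      rw [← add_assoc, ← add_assoc, e]
    · nlinarith [(Nat.cast_nonneg k : (0:ℝ) ≤ k)]
    · nlinarith

/-- Flowing each point by the fixed time `t - s` carries orbits on the grid through `s` to orbits on
the grid through `t`, and costs only a fixed power of `K`. -/
lemma IsNearEvolution.forward_of_le (h : IsNearEvolution S ε t₀ K φ) {s t : ℝ} (hst : s ≤ t) {x : X}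
    (hx : HasForwardOrbit (fun n => stepSeq φ t₀ s n) x) :
    HasForwardOrbit (fun n => stepSeq φ t₀ t n) (φ t s x) := by
  obtain ⟨c, hc0, ⟨C, hC⟩, hc⟩ := hx
  obtain ⟨m, hm⟩ := exists_nat_ge ((t - s) / t₀)
  rw [div_le_iff₀ h.pos] at hm
  have ht := h.pos
  have hK := h.one_le
  refine ⟨fun n => φ (t + n * t₀) (s + n * t₀) (c n), by simp [hc0], ⟨K ^ m * C, fun n hn => ?_⟩,
    fun n hn => ?_⟩
  · refine (h.growth m (by linarith) (by linarith) _).trans ?_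
    gcongr
    exact hC n hn
  · simp only [hc n hn, stepSeq]
    push_cast
    rw [h.comp _ _ _ (by nlinarith) (by linarith), h.comp _ _ _ (by linarith) (by nlinarith)]

lemma IsNearEvolution.backward_of_le (h : IsNearEvolution S ε t₀ K φ) {s t : ℝ} (hst : s ≤ t) {x : X}
    (hx : HasBackwardOrbit (fun n => stepSeq φ t₀ s n) x) :
    HasBackwardOrbit (fun n => stepSeq φ t₀ t n) (φ t s x) := by
  obtain ⟨c, hc0, ⟨C, hC⟩, hc⟩ := hx
  obtain ⟨m, hm⟩ := exists_nat_ge ((t - s) / t₀)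
  rw [div_le_iff₀ h.pos] at hm
  have ht := h.pos
  have hK := h.one_le
  refine ⟨fun n => φ (t + n * t₀) (s + n * t₀) (c n), by simp [hc0], ⟨K ^ m * C, fun n hn => ?_⟩,
    fun n hn => ?_⟩
  · refine (h.growth m (by linarith) (by linarith) _).trans ?_
    gcongr
    exact hC n hn
  · simp only [hc n hn, stepSeq]
    push_cast
    rw [h.comp _ _ _ (by nlinarith) (by linarith), h.comp _ _ _ (by linarith) (by nlinarith)]

/-- The orbit of such a point is eventually zero, hence bounded. It follows that the process is
injective on the unstable ranges. -/
lemma IsNearEvolution.forward_of_eq_zero (h : IsNearEvolution S ε t₀ K φ) {s t : ℝ} (hst : s ≤ t)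
    {x : X} (hx : φ t s x = 0) : HasForwardOrbit (fun n => stepSeq φ t₀ s n) x := by
  obtain ⟨m, hm⟩ := exists_nat_ge ((t - s) / t₀)
  rw [div_le_iff₀ h.pos] at hm
  have ht := h.pos
  have hK := h.one_le
  have hnn : ∀ n : ℤ, 0 ≤ n → s ≤ s + n * t₀ := fun n hn => by
    have : (0 : ℝ) ≤ n := by exact_mod_cast hn
    nlinarith
  refine ⟨fun n => φ (s + n * t₀) s x, by simp [h.refl], ⟨K ^ m * ‖x‖, fun n hn => ?_⟩,
    fun n hn => ?_⟩
  · rcases le_total (s + n * t₀) t with h1 | h1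
    · exact h.growth m (hnn n hn) (by linarith) _
    · beta_reduce
      rw [← h.comp _ t s hst h1, hx, map_zero, norm_zero]
      positivity
  · simp only [stepSeq]
    push_cast
    rw [h.comp _ _ _ (hnn n hn) (by nlinarith)]

/-- A bounded backward orbit ending at time `t` passes through any earlier time `s`. -/
lemma IsNearEvolution.exists_backward_preimage (h : IsNearEvolution S ε t₀ K φ) {s t : ℝ} (hst : s ≤ t)
    {c : ℤ → X} (hb : ∃ C, ∀ n ≤ 0, ‖c n‖ ≤ C)
    (hc : ∀ n < 0, c (n + 1) = stepSeq φ t₀ t n (c n)) :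
    ∃ x, HasBackwardOrbit (fun n => stepSeq φ t₀ s n) x ∧ φ t s x = c 0 ∧
      ‖x‖ ≤ K * ‖c (-1 - (⌊(t - s) / t₀⌋₊ : ℤ))‖ := by
  have ht := h.pos
  obtain ⟨C, hC⟩ := hb
  set k := ⌊(t - s) / t₀⌋₊ with hk
  have hk1 : k * t₀ ≤ t - s := by
    rw [← le_div_iff₀ ht]; exact Nat.floor_le (div_nonneg (by linarith) ht.le)
  have hk2 : t - s < (k + 1) * t₀ := by
    rw [← div_lt_iff₀ ht]; exact Nat.lt_floor_add_one _
  -- The grid time with `r < s ≤ r + t₀`: the preimage at time `s` is reached from the orbit point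
  -- at `r` in at most one step.
  set r := t + ((-1 - (k : ℤ) : ℤ) : ℝ) * t₀ with hr
  have hr' : r = t - (k + 1) * t₀ := by rw [hr]; push_cast; ring
  have hrs : r ≤ s := by linarith
  have hbk : HasBackwardOrbit (fun n => stepSeq φ t₀ r n) (c (-1 - (k : ℤ))) := by
    refine ⟨fun n => c (n + (-1 - (k : ℤ))), by simp, ⟨C, fun n hn => hC _ (by omega)⟩,
      fun n hn => ?_⟩
    have := hc (n + (-1 - (k : ℤ))) (by omega)
    dsimp only
    rw [add_right_comm, this, stepSeq, stepSeq, hr]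
    push_cast
    congr 2 <;> ring
  refine ⟨_, h.backward_of_le hrs hbk, ?_, h.bound _ _ hrs (by linarith) _⟩
  rw [h.comp _ _ _ hrs hst]
  have := h.forward_orbit_eq (s := t) (c := c) (m := -1 - (k : ℤ)) (k + 1)
    (fun n h1 h2 => hc n (by push_cast at h2; omega))
  rw [hr]
  push_cast at this ⊢
  rw [show (-1 - (k : ℤ) + (k + 1)) = 0 by ring, show (-1 - (k : ℝ) + (k + 1)) = 0 by ring,
    zero_mul, add_zero] at this
  exact this.symm

/-- The factor `2` pays for rounding `a / t₀` down to an integer. -/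
lemma half_pow_floor_le (a t₀ : ℝ) :
    (1 / 2 : ℝ) ^ ⌊a / t₀⌋₊ ≤ 2 * Real.exp (-(Real.log 2 / t₀) * a) := by
  have h2 : a / t₀ < ⌊a / t₀⌋₊ + 1 := Nat.lt_floor_add_one _
  have h3 : (1 / 2 : ℝ) ^ ⌊a / t₀⌋₊ = Real.exp (-(⌊a / t₀⌋₊ * Real.log 2)) := by
    rw [Real.exp_neg, Real.exp_nat_mul, Real.exp_log (by norm_num)]
    simp
  have h4 : (2 : ℝ) * Real.exp (-(Real.log 2 / t₀) * a) =
      Real.exp (Real.log 2 + -(Real.log 2 / t₀) * a) := by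
    rw [Real.exp_add, Real.exp_log (by norm_num)]
  rw [h3, h4]
  apply Real.exp_le_exp.2
  have hl : 0 < Real.log 2 := Real.log_pos (by norm_num)
  have h5 : Real.log 2 / t₀ * a = a / t₀ * Real.log 2 := by ring
  nlinarith

/-- Roughness of exponential dichotomies. -/
theorem IsNearEvolution.isExpDichotomy [CompleteSpace X] (hS : IsHypSplit S P V q)
    (hε : q * ε ≤ 1 / 16) (hε0 : 0 ≤ ε) (h : IsNearEvolution S ε t₀ K φ) :
    IsExpDichotomy φ (fun s => projOf (fun n => stepSeq φ t₀ s n)) (4 * q * K)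
      (Real.log 2 / t₀) := by
  have ht := h.pos
  have hK := h.one_le
  have hq := hS.one_le
  have hN := h.isNear
  have proj : ∀ t x, projOf (fun n => stepSeq φ t₀ t n) (projOf (fun n => stepSeq φ t₀ t n) x) =
      projOf (fun n => stepSeq φ t₀ t n) x := fun t x =>
    (hasBackwardOrbit_projOf hS hε hε0 (hN t) x).projOf_eq hS hε hε0 (hN t)
  -- The process carries bounded backward orbits to bounded backward orbits and bounded forward
  -- orbits to bounded forward orbits, so it respects the splitting.
  have comm : ∀ s t, s ≤ t → ∀ x, projOf (fun n => stepSeq φ t₀ t n) (φ t s x) =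
      φ t s (projOf (fun n => stepSeq φ t₀ s n) x) := by
    intro s t hst x
    have h1 := (h.backward_of_le hst (hasBackwardOrbit_projOf hS hε hε0 (hN s) x)).projOf_eq
      hS hε hε0 (hN t)
    have h2 := (h.forward_of_le hst (hasForwardOrbit_sub_projOf hS hε hε0 (hN s) x)).projOf_eq
      hS hε hε0 (hN t)
    rw [map_sub, map_sub, sub_eq_zero] at h2
    rw [h2, h1]
  have inj : ∀ s t, s ≤ t → InjOn (φ t s) (Set.range (projOf (fun n => stepSeq φ t₀ s n))) := by
    rintro s t hst _ ⟨x, rfl⟩ _ ⟨y, rfl⟩ hxy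
    have h1 : φ t s (projOf (fun n => stepSeq φ t₀ s n) (x - y)) = 0 := by
      rw [map_sub, map_sub, hxy, sub_self]
    have h2 := (h.forward_of_eq_zero hst h1).projOf_eq hS hε hε0 (hN s)
    rw [proj, map_sub, sub_eq_zero] at h2
    exact h2
  refine ⟨fun t => ContinuousLinearMap.ext (proj t),
    fun s t hst => ContinuousLinearMap.ext (comm s t hst), fun s t hst => ⟨?_, inj s t hst, ?_⟩,
    fun s t hst => ?_, ?_⟩
  · rintro _ ⟨x, rfl⟩
    exact ⟨_, comm s t hst x⟩
  · rintro _ ⟨y, rfl⟩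
    obtain ⟨c, hc0, hb, hc⟩ := hasBackwardOrbit_projOf hS hε hε0 (hN t) y
    obtain ⟨x, hx, hxc, -⟩ := h.exists_backward_preimage hst hb hc
    exact ⟨x, ⟨x, hx.projOf_eq hS hε hε0 (hN s)⟩, by rw [hxc, hc0]⟩
  · refine ContinuousLinearMap.opNorm_le_bound _ (by positivity) fun x => ?_
    set k := ⌊(t - s) / t₀⌋₊ with hk
    have hk1 : k * t₀ ≤ t - s := by
      rw [← le_div_iff₀ ht]; exact Nat.floor_le (div_nonneg (by linarith) ht.le)
    have hk2 : t - s < (k + 1) * t₀ := by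
      rw [← div_lt_iff₀ ht]; exact Nat.lt_floor_add_one _
    have hz := isJump_jumpOrbit hS hε hε0 (hN s) x
    have e1 := h.forward_orbit_eq (s := s) (m := 0) k (c := jumpOrbit _ x) (fun n h1 _ => by
      rw [hz.step, if_neg (by omega), add_zero])
    simp only [zero_add, Int.cast_zero, zero_mul, add_zero] at e1
    have e2 := hz.forward_decay hS hε hε0 (hN s) k
    have hks : s ≤ s + k * t₀ := by nlinarith [(Nat.cast_nonneg k : (0:ℝ) ≤ k)]
    -- The stable part of `x` is minus the jump orbit at `0`; it follows that orbit for `k` full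
    -- steps, and the remaining time costs a factor `K`.
    have e3 : (φ t s ∘L (ContinuousLinearMap.id ℝ X - projOf (fun n => stepSeq φ t₀ s n))) x =
        -φ t (s + k * t₀) (jumpOrbit (fun n => stepSeq φ t₀ s n) x k) := by
      rw [e1, h.comp _ _ _ hks (by linarith), ← map_neg, ← sub_projOf hS hε hε0 (hN s)]
      rfl
    rw [e3, norm_neg]
    refine (h.bound _ _ (by linarith) (by linarith) _).trans ?_
    calc K * ‖jumpOrbit (fun n => stepSeq φ t₀ s n) x k‖
        ≤ K * (2 * q * ‖x‖ * (2 * Real.exp (-(Real.log 2 / t₀) * (t - s)))) := by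
          gcongr
          refine e2.trans ?_
          gcongr
          exact half_pow_floor_le _ _
      _ = _ := by ring
  · rintro s t hst x ⟨x, rfl⟩ y hxy
    have hz := isJump_jumpOrbit hS hε hε0 (hN t) y
    obtain ⟨C, hC⟩ := hz.bdd
    set c : ℤ → X := fun n => if n = 0 then projOf (fun n => stepSeq φ t₀ t n) y else
      jumpOrbit (fun n => stepSeq φ t₀ t n) y n with hc
    have hp : projOf (fun n => stepSeq φ t₀ t n) y =
        stepSeq φ t₀ t (-1) (jumpOrbit (fun n => stepSeq φ t₀ t n) y (-1)) := by
      rw [projOf_apply hS hε hε0 (hN t)]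
      exact jumpProj_eq hS hε hε0 (hN t) y
    obtain ⟨x', hx', hxc, hle⟩ := h.exists_backward_preimage hst (c := c)
      ⟨max C ‖projOf (fun n => stepSeq φ t₀ t n) y‖, fun n _ => by
        simp only [hc]
        split_ifs
        · exact le_max_right _ _
        · exact (hC n).trans (le_max_left _ _)⟩
      (fun n hn => by
        simp only [hc]
        rw [if_neg hn.ne]
        split_ifs with h1
        · obtain rfl : n = -1 := by omega
          exact hp
        · rw [hz.step, if_neg (by omega), add_zero])
    have hcn : c (-1 - (⌊(t - s) / t₀⌋₊ : ℤ)) =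
        jumpOrbit (fun n => stepSeq φ t₀ t n) y (-1 - (⌊(t - s) / t₀⌋₊ : ℤ)) :=
      if_neg (by omega)
    -- By injectivity the given preimage is the one on the backward orbit, where the decay is known.
    have hxx : projOf (fun n => stepSeq φ t₀ s n) x = x' := by
      refine inj s t hst ⟨x, rfl⟩ ⟨x', hx'.projOf_eq hS hε hε0 (hN s)⟩ ?_
      rw [hxy, hxc]
      simp [hc]
    rw [hxx]
    have e2 := hz.backward_decay hS hε hε0 (hN t) ⌊(t - s) / t₀⌋₊
    rw [hcn] at hle
    refine hle.trans ?_
    calc K * ‖jumpOrbit (fun n => stepSeq φ t₀ t n) y (-1 - (⌊(t - s) / t₀⌋₊ : ℤ))‖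
        ≤ K * (2 * q * ‖y‖ * (2 * Real.exp (-(Real.log 2 / t₀) * (t - s)))) := by
          gcongr
          refine e2.trans ?_
          gcongr
          exact half_pow_floor_le _ _
      _ = _ := by
        rw [show -(Real.log 2 / t₀) * (t - s) = Real.log 2 / t₀ * (s - t) by ring]
        ring

end Dichotomy

/-! ### Bounds and joint continuity for the semigroup. -/

section Semigroup

variable {X : Type*} [NormedAddCommGroup X] [NormedSpace ℝ X] {T : ℝ → X →L[ℝ] X}

lemma IsC0Semigroup.exists_bound [CompleteSpace X] (hT : IsC0Semigroup T) (t₀ : ℝ) :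
    ∃ K : ℝ, 1 ≤ K ∧ ∀ t ∈ Icc 0 t₀, ‖T t‖ ≤ K := by
  obtain ⟨C, hC⟩ := banach_steinhaus (g := fun t : Icc (0 : ℝ) t₀ => T t) fun x => by
    have hc : ContinuousOn (fun t => T t x) (Icc 0 t₀) :=
      (hT.continuousOn x).mono Icc_subset_Ici_self
    obtain ⟨C, hC⟩ := isCompact_Icc.exists_bound_of_continuousOn hc
    exact ⟨C, fun t => hC t t.2⟩
  exact ⟨max 1 C, le_max_left _ _, fun t ht => (hC ⟨t, ht⟩).trans (le_max_right _ _)⟩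

lemma IsC0Semigroup.exists_exp_bound [CompleteSpace X] (hT : IsC0Semigroup T) :
    ∃ K c : ℝ, 1 ≤ K ∧ 0 ≤ c ∧ ∀ t, 0 ≤ t → ‖T t‖ ≤ K * Real.exp (c * t) := by
  obtain ⟨K, hK, hb⟩ := hT.exists_bound 1
  have hK0 : 0 < K := by linarith
  have key : ∀ n : ℕ, ∀ t : ℝ, 0 ≤ t → t ≤ n + 1 → ‖T t‖ ≤ K ^ (n + 1) := by
    intro n
    induction n with
    | zero => intro t h0 h1; simpa using hb t ⟨h0, by simpa using h1⟩
    | succ n ih =>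
      intro t h0 h1
      push_cast at h1
      rcases le_total t 1 with h | h
      · exact (hb t ⟨h0, h⟩).trans (le_self_pow₀ hK (by omega))
      · have e : T t = T 1 ∘L T (t - 1) := by
          rw [← hT.add 1 (t - 1) (by norm_num) (by linarith)]; congr 1; ring
        rw [e, pow_succ']
        refine (ContinuousLinearMap.opNorm_comp_le _ _).trans ?_
        gcongr
        · exact hb 1 ⟨by norm_num, le_rfl⟩
        · exact ih _ (by linarith) (by linarith)
  refine ⟨K, Real.log K, hK, Real.log_nonneg hK, fun t ht => ?_⟩
  refine (key ⌊t⌋₊ t ht (Nat.lt_floor_add_one t).le).trans ?_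
  rw [pow_succ']
  gcongr
  rw [← Real.rpow_def_of_pos hK0, ← Real.rpow_natCast]
  exact Real.rpow_le_rpow_of_exponent_le hK (Nat.floor_le ht)

/-- Joint continuity follows from strong continuity and local boundedness of the norms. The
truncation `max p.1 0` is needed because `T` is arbitrary at negative times. -/
lemma IsC0Semigroup.continuous_extend [CompleteSpace X] (hT : IsC0Semigroup T) :
    Continuous (fun p : ℝ × X => T (max p.1 0) p.2) := by
  refine continuous_iff_continuousAt.2 fun ⟨t, x⟩ => ?_
  obtain ⟨K, hK, hb⟩ := hT.exists_bound (max t 0 + 1)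
  have hc : Continuous fun t => T (max t 0) x :=
    (hT.continuousOn x).comp_continuous (by fun_prop) fun t => mem_Ici.2 (le_max_right _ _)
  rw [ContinuousAt, tendsto_iff_norm_sub_tendsto_zero]
  refine squeeze_zero' (g := fun p : ℝ × X => K * ‖p.2 - x‖ + ‖T (max p.1 0) x - T (max t 0) x‖)
    (Eventually.of_forall fun _ => norm_nonneg _) ?_ ?_
  · have : ∀ᶠ p : ℝ × X in 𝓝 (t, x), max p.1 0 < max t 0 + 1 := by
      have hcc : Continuous fun p : ℝ × X => max p.1 0 := by fun_prop
      exact hcc.continuousAt.eventually_lt_const (by simp)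
    filter_upwards [this] with p hp
    have e : T (max p.1 0) p.2 - T (max t 0) x =
        T (max p.1 0) (p.2 - x) + (T (max p.1 0) x - T (max t 0) x) := by
      rw [map_sub]; abel
    rw [e]
    refine (norm_add_le _ _).trans ?_
    gcongr
    exact (T _).le_of_opNorm_le (hb _ ⟨le_max_right _ _, hp.le⟩) _
  · have : Continuous fun p : ℝ × X =>
        K * ‖p.2 - x‖ + ‖T (max p.1 0) x - T (max t 0) x‖ := by
      exact ((continuous_snd.sub continuous_const).norm.const_mul K).add
        (((hc.comp continuous_fst).sub continuous_const).norm)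
    simpa using this.tendsto (t, x)

end Semigroup

/-! ### Convolution integrals with an operator kernel. -/

section Convolution

variable {X : Type*} [NormedAddCommGroup X] [NormedSpace ℝ X]

lemma intervalIntegrable_of_bounded {E : Type*} [NormedAddCommGroup E] {f : ℝ → E} (hf : StronglyMeasurable f) {s t C : ℝ}
    (hC : ∀ r ∈ uIoc s t, ‖f r‖ ≤ C) : IntervalIntegrable f volume s t := by
  rw [intervalIntegrable_iff]
  exact Measure.integrableOn_of_bounded (M := C) (by simp) hf.aestronglyMeasurable
    ((ae_restrict_iff' measurableSet_uIoc).2 (Eventually.of_forall hC))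

variable {W : ℝ → X →L[ℝ] X} {a : ℝ → X} {K A : ℝ}

lemma stronglyMeasurable_conv (hW : Continuous fun p : ℝ × X => W p.1 p.2)
    (ha : StronglyMeasurable a) (t : ℝ) : StronglyMeasurable fun r => W (t - r) (a r) :=
  hW.comp_stronglyMeasurable (f := fun r => (t - r, a r))
    ((by fun_prop : Continuous fun r : ℝ => t - r).stronglyMeasurable.prodMk ha)

/-- Written as an integral over the whole line of an indicator, the convolution has a fixed domain
and dominated convergence applies. -/
lemma continuous_conv (hW : Continuous fun p : ℝ × X => W p.1 p.2) (hK : ∀ t, ‖W t‖ ≤ K)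
    (ha : StronglyMeasurable a) (hA : ∀ t, ‖a t‖ ≤ A) :
    Continuous fun t => ∫ r in 0..(max t 0), W (max t 0 - r) (a r) := by
  have hK0 : 0 ≤ K := (norm_nonneg _).trans (hK 0)
  have hA0 : 0 ≤ A := (norm_nonneg _).trans (hA 0)
  set H : ℝ → X := fun t => ∫ r, (Ioc 0 t).indicator (fun r => W (t - r) (a r)) r with hH
  have key : Continuous H := by
    refine continuous_iff_continuousAt.2 fun t => ?_
    refine continuousAt_of_dominated
      (bound := (Ioc 0 (t + 1)).indicator fun _ => K * A) ?_ ?_ ?_ ?_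
    · exact Eventually.of_forall fun t =>
        ((stronglyMeasurable_conv hW ha t).indicator measurableSet_Ioc).aestronglyMeasurable
    · filter_upwards [Iio_mem_nhds (show t < t + 1 by linarith)] with t' ht'
      refine Eventually.of_forall fun r => ?_
      by_cases hr : r ∈ Ioc 0 t'
      · have hr' : r ∈ Ioc 0 (t + 1) := ⟨hr.1, hr.2.trans (le_of_lt ht')⟩
        rw [indicator_of_mem hr, indicator_of_mem hr']
        exact (W _).le_of_opNorm_le_of_le (hK _) (hA r)
      · rw [indicator_of_notMem hr, norm_zero]
        exact indicator_nonneg (fun _ _ => by positivity) _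
    · exact (integrable_indicator_iff measurableSet_Ioc).2
        (integrableOn_const (by simp) (by finiteness))
    -- The integrand is discontinuous in the upper limit only at `r = t`, a null set.
    · have hne : ∀ᵐ r : ℝ, r ≠ t := by simp [ae_iff]
      filter_upwards [hne] with r hr
      have hc : Continuous fun t => W (t - r) (a r) :=
        hW.comp (by fun_prop : Continuous fun t => (t - r, a r))
      rcases lt_or_gt_of_ne hr with h | h
      · by_cases h0 : 0 < r
        · refine hc.continuousAt.congr ?_
          filter_upwards [Ioi_mem_nhds h] with t' ht'
          exact (indicator_of_mem (s := Ioc 0 t') ⟨h0, le_of_lt ht'⟩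
            fun r => W (t' - r) (a r)).symm
        · refine (continuousAt_const (y := (0 : X))).congr ?_
          refine Eventually.of_forall fun t' => ?_
          exact (indicator_of_notMem (s := Ioc 0 t') (fun h' => h0 h'.1) _).symm
      · refine (continuousAt_const (y := (0 : X))).congr ?_
        filter_upwards [Iio_mem_nhds h] with t' ht'
        exact (indicator_of_notMem (s := Ioc 0 t') (fun h' => absurd h'.2 (not_le.2 ht')) _).symm
  have e : (fun t => ∫ r in 0..(max t 0), W (max t 0 - r) (a r)) = fun t => H (max t 0) := by
    ext t
    rw [hH, intervalIntegral.integral_of_le (le_max_right _ _)]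
    exact (integral_indicator measurableSet_Ioc).symm
  rw [e]
  exact key.comp (by fun_prop)

lemma integral_exp_neg_sub {μ t : ℝ} (hμ : 0 < μ) :
    ∫ r in 0..t, Real.exp (-μ * (t - r)) = (1 - Real.exp (-μ * t)) / μ := by
  have : ∀ r ∈ uIcc 0 t, HasDerivAt (fun r => Real.exp (-μ * (t - r)) / μ)
      (Real.exp (-μ * (t - r))) r := by
    intro r _
    have h1 : HasDerivAt (fun r => -μ * (t - r)) μ r := by
      simpa using ((hasDerivAt_id r).const_sub t).const_mul (-μ)
    have := h1.exp.div_const μ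
    rwa [mul_div_assoc, div_self hμ.ne', mul_one] at this
  rw [intervalIntegral.integral_eq_sub_of_hasDerivAt this
    (by apply Continuous.intervalIntegrable; fun_prop)]
  simp
  ring

/-- The gain `1 / μ` makes the convolution a contraction once the exponential weight is large. -/
lemma norm_conv_le {μ : ℝ} (hμ : 0 < μ) (hK : ∀ t, 0 ≤ t → ‖W t‖ ≤ K * Real.exp (-μ * t))
    (hA : ∀ t, ‖a t‖ ≤ A) {t : ℝ} (ht : 0 ≤ t) :
    ‖∫ r in 0..t, W (t - r) (a r)‖ ≤ K * A / μ := by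
  have hK0 : 0 ≤ K := by simpa using (norm_nonneg _).trans (hK 0 le_rfl)
  have hA0 : 0 ≤ A := (norm_nonneg _).trans (hA 0)
  refine (intervalIntegral.norm_integral_le_of_norm_le ht
    (g := fun r => K * A * Real.exp (-μ * (t - r))) (Eventually.of_forall fun r hr => ?_)
    (by apply Continuous.intervalIntegrable; fun_prop)).trans ?_
  · calc ‖W (t - r) (a r)‖ ≤ K * Real.exp (-μ * (t - r)) * A :=
        (W _).le_of_opNorm_le_of_le (hK _ (by linarith [hr.2])) (hA r)
      _ = _ := by ring
  · rw [intervalIntegral.integral_const_mul, integral_exp_neg_sub hμ, ← mul_div_assoc]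
    rw [div_le_div_iff_of_pos_right hμ]
    nlinarith [mul_nonneg hK0 hA0, Real.exp_pos (-μ * t)]

end Convolution

/-! ### Existence for the linear equation. -/

section Existence

variable {X : Type*} [NormedAddCommGroup X] [NormedSpace ℝ X]
  {T : ℝ → X →L[ℝ] X}

/-- A Carathéodory argument: continuity in `x`, measurability in `t` and separability of `X` give
joint measurability. -/
lemma stronglyMeasurable_apply [TopologicalSpace.SeparableSpace X] {b : ℝ → X →L[ℝ] X}
    (hb : ∀ x, StronglyMeasurable fun t => b t x) {v : ℝ → X} (hv : Continuous v) :
    StronglyMeasurable fun t => b t (v t) := by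
  have : SecondCountableTopology X := UniformSpace.secondCountable_of_separable X
  borelize X
  have := stronglyMeasurable_uncurry_of_continuous_of_stronglyMeasurable
    (u := fun (x : X) (t : ℝ) => b t x) (fun t => (b t).continuous) hb
  exact this.comp_measurable (hv.measurable.prodMk measurable_id)

/-- The linear equation with bounded strongly measurable perturbation has mild solutions. -/
theorem exists_linear_mild [CompleteSpace X] [TopologicalSpace.SeparableSpace X] (hT : IsC0Semigroup T)
    {b : ℝ → X →L[ℝ] X} (hb : ∀ x, StronglyMeasurable fun t => b t x) {β : ℝ}
    (hβ : ∀ t, ‖b t‖ ≤ β) :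
    ∃ U : ℝ → X →L[ℝ] X, U 0 = ContinuousLinearMap.id ℝ X ∧
      ∀ x, IsMildSolution T b (fun _ _ => 0) 0 (fun t => U t x) := by
  obtain ⟨K, c, hK, hc, hKc⟩ := hT.exists_exp_bound
  have hβ0 : 0 ≤ β := (norm_nonneg _).trans (hβ 0)
  -- The weight `μ` gives `K * β / μ ≤ 1 / 2`: for the rescaled kernel `W` the Volterra operator `N`
  -- has norm at most `1 / 2`, and bounded functions suffice.
  set μ : ℝ := 2 * K * β + 1 with hμ
  have hμ0 : 0 < μ := by positivity
  set W : ℝ → X →L[ℝ] X := fun t => Real.exp (-(c + μ) * max t 0) • T (max t 0) with hW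
  have hWc : Continuous fun p : ℝ × X => W p.1 p.2 := by
    have := hT.continuous_extend
    simp only [hW, smul_apply]
    exact (by fun_prop : Continuous fun p : ℝ × X => Real.exp (-(c + μ) * max p.1 0)).smul this
  have hWb : ∀ t, ‖W t‖ ≤ K * Real.exp (-μ * max t 0) := by
    intro t
    rw [hW, norm_smul, Real.norm_eq_abs, Real.abs_exp]
    calc _ ≤ Real.exp (-(c + μ) * max t 0) * (K * Real.exp (c * max t 0)) := by
          gcongr; exact hKc _ (le_max_right _ _)
      _ = K * (Real.exp (-(c + μ) * max t 0) * Real.exp (c * max t 0)) := by ring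
      _ = _ := by rw [← Real.exp_add]; congr 2; ring
  have hWK : ∀ t, ‖W t‖ ≤ K := fun t => (hWb t).trans (mul_le_of_le_one_right (by linarith)
    (Real.exp_le_one_iff.2 (by nlinarith [le_max_right t 0])))
  have hWp : ∀ t, 0 ≤ t → ‖W t‖ ≤ K * Real.exp (-μ * t) := fun t ht => by
    simpa [max_eq_left ht] using hWb t
  have ham : ∀ v : BoundedContinuousFunction ℝ X, StronglyMeasurable fun t => b t (v t) :=
    fun v => stronglyMeasurable_apply hb v.continuous
  have hab : ∀ (v : BoundedContinuousFunction ℝ X) t, ‖b t (v t)‖ ≤ β * ‖v‖ := fun v t =>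
    (b t).le_of_opNorm_le_of_le (hβ t) (v.norm_coe_le_norm t)
  have hii : ∀ (v : BoundedContinuousFunction ℝ X) t s s',
      IntervalIntegrable (fun r => W (t - r) (b r (v r))) volume s s' := fun v t s s' =>
    intervalIntegrable_of_bounded (stronglyMeasurable_conv hWc (ham v) t) (C := K * (β * ‖v‖))
      fun r _ => (W _).le_of_opNorm_le_of_le (hWK _) (hab v r)
  have hnb : ∀ (v : BoundedContinuousFunction ℝ X) t,
      ‖∫ r in 0..(max t 0), W (max t 0 - r) (b r (v r))‖ ≤ 1 / 2 * ‖v‖ := fun v t => by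
    refine (norm_conv_le hμ0 hWp (hab v) (le_max_right _ _)).trans ?_
    rw [div_le_iff₀ hμ0]
    nlinarith [norm_nonneg v]
  let N : BoundedContinuousFunction ℝ X →L[ℝ] BoundedContinuousFunction ℝ X :=
    LinearMap.mkContinuous
      { toFun := fun v => BoundedContinuousFunction.ofNormedAddCommGroup
          (fun t => ∫ r in 0..(max t 0), W (max t 0 - r) (b r (v r)))
          (continuous_conv hWc hWK (ham v) (hab v)) (1 / 2 * ‖v‖) (hnb v)
        map_add' := fun v v' => by
          ext t
          simp only [BoundedContinuousFunction.coe_ofNormedAddCommGroup,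
            BoundedContinuousFunction.coe_add, Pi.add_apply, map_add]
          exact intervalIntegral.integral_add (hii _ _ _ _) (hii _ _ _ _)
        map_smul' := fun α v => by
          ext t
          simp only [BoundedContinuousFunction.coe_ofNormedAddCommGroup,
            BoundedContinuousFunction.coe_smul, map_smul, RingHom.id_apply]
          exact intervalIntegral.integral_smul _ _ }
      (1 / 2) fun v => (BoundedContinuousFunction.norm_le (by positivity)).2 (hnb v)
  let I : X →L[ℝ] BoundedContinuousFunction ℝ X :=
    LinearMap.mkContinuous
      { toFun := fun x => BoundedContinuousFunction.ofNormedAddCommGroup (fun t => W t x)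
          (hWc.comp (by fun_prop : Continuous fun t : ℝ => (t, x))) (K * ‖x‖)
          fun t => (W t).le_of_opNorm_le (hWK t) x
        map_add' := fun x y => by ext t; simp
        map_smul' := fun α x => by ext t; simp }
      K fun x => (BoundedContinuousFunction.norm_le (by positivity)).2
        fun t => (W t).le_of_opNorm_le (hWK t) x
  have hN : ‖N‖ < 1 := (LinearMap.mkContinuous_norm_le _ (by norm_num) _).trans_lt (by norm_num)
  -- Inverting `1 - N` by the Neumann series makes the solution depend linearly and boundedly on the
  -- initial value at no extra cost.
  let Y : X →L[ℝ] BoundedContinuousFunction ℝ X := (↑(Units.oneSub N hN)⁻¹ : _ →L[ℝ] _) ∘L I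
  have hY : ∀ x t, Y x t = W t x + ∫ r in 0..(max t 0), W (max t 0 - r) (b r (Y x r)) := by
    intro x t
    have h1 : (1 - N) (Y x) = I x := by
      have := congrArg (fun M : BoundedContinuousFunction ℝ X →L[ℝ] _ => M (I x))
        (Units.mul_inv (Units.oneSub N hN))
      exact this
    have h2 : Y x = I x + N (Y x) := by
      rw [← h1]; simp
    conv_lhs => rw [h2]
    rfl
  let ev : ℝ → BoundedContinuousFunction ℝ X →L[ℝ] X := fun t =>
    BoundedContinuousFunction.evalCLM ℝ t
  refine ⟨fun t => Real.exp ((c + μ) * t) • (ev t ∘L Y), ?_, fun x => ?_⟩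
  · ext x
    have := hY x 0
    simp [hW, hT.zero] at this
    simpa [ev] using this
  have hUx : ∀ t, (Real.exp ((c + μ) * t) • (ev t ∘L Y)) x = Real.exp ((c + μ) * t) • Y x t :=
    fun t => rfl
  have hYc : Continuous fun t => Real.exp ((c + μ) * t) • Y x t := by
    have := (Y x).continuous
    fun_prop
  have hconv : ∀ t r, r ≤ t → T (t - r) (b r (Real.exp ((c + μ) * r) • Y x r)) =
      Real.exp ((c + μ) * t) • W (t - r) (b r (Y x r)) := by
    intro t r hr
    simp only [hW, max_eq_left (sub_nonneg.2 hr), smul_apply, map_smul, smul_smul,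
      ← Real.exp_add]
    congr 2
    ring
  simp only [hUx]
  refine ⟨hYc.continuousOn, fun t ht => ?_, fun t ht => ?_⟩
  · have := (hii (Y x) t 0 t).smul (Real.exp ((c + μ) * t))
    refine this.congr ?_
    intro r hr
    rw [uIoc_of_le ht] at hr
    simp only [Pi.smul_apply, add_zero]
    exact (hconv t r hr.2).symm
  · have e : ∫ r in 0..t, T (t - r) (b r (Real.exp ((c + μ) * r) • Y x r) + 0) =
        Real.exp ((c + μ) * t) • ∫ r in 0..t, W (t - r) (b r (Y x r)) := by
      rw [← intervalIntegral.integral_smul]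
      refine intervalIntegral.integral_congr fun r hr => ?_
      rw [uIcc_of_le ht] at hr
      simp only [add_zero]
      exact hconv t r hr.2
    have h0 : Y x 0 = x := by
      have := hY x 0
      simpa [hW, hT.zero] using this
    rw [e, hY x t, max_eq_left ht, smul_add]
    congr 1
    simp only [hW, max_eq_left ht, smul_apply, smul_smul, ← Real.exp_add, mul_zero, Real.exp_zero,
      one_smul, sub_zero, h0]
    rw [show (c + μ) * t + -(c + μ) * t = 0 by ring, Real.exp_zero, one_smul]

end Existence

/-! ### Comparison, confinement and restarting of mild solutions. -/

section Mild

variable {X : Type*} [NormedAddCommGroup X] [NormedSpace ℝ X]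
  {T : ℝ → X →L[ℝ] X} {b b' : ℝ → X →L[ℝ] X} {g g' : ℝ → X → X} {u v : ℝ → X}

lemma IsMildSolution.zero (T : ℝ → X →L[ℝ] X) (s : ℝ) :
    IsMildSolution T 0 (fun _ _ => 0) s (fun _ => 0) :=
  ⟨continuousOn_const, by simp, by simp⟩

/-- Comparison of mild solutions of two equations on a short time interval. -/
lemma IsMildSolution.compare {t₀ K ε κ : ℝ} (ht₀ : 0 ≤ t₀) (hK : 1 ≤ K)
    (hT : ∀ t ∈ Icc 0 t₀, ‖T t‖ ≤ K) (hε : K * t₀ * ε ≤ 1 / 2) (hε0 : 0 ≤ ε) (hκ : 0 ≤ κ)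
    (hu : IsMildSolution T b g 0 u) (hv : IsMildSolution T b' g' 0 v)
    (hd : ∀ r ∈ Icc 0 t₀,
      ‖(b r (u r) + g r (u r)) - (b' r (v r) + g' r (v r))‖ ≤ ε * ‖u r - v r‖ + κ)
    {t : ℝ} (ht : t ∈ Icc 0 t₀) :
    ‖u t - v t‖ ≤ 2 * K * (‖u 0 - v 0‖ + t₀ * κ) ∧
      ‖(u t - T t (u 0)) - (v t - T t (v 0))‖ ≤
        K * t₀ * (ε * (2 * K * (‖u 0 - v 0‖ + t₀ * κ)) + κ) := by
  have hc : ContinuousOn (fun t => ‖u t - v t‖) (Icc 0 t₀) :=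
    ((hu.continuousOn.sub hv.continuousOn).norm).mono Icc_subset_Ici_self
  have main : ∀ D, 0 ≤ D → (∀ r ∈ Icc 0 t₀, ‖u r - v r‖ ≤ D) → ∀ t ∈ Icc 0 t₀,
      ‖(u t - T t (u 0)) - (v t - T t (v 0))‖ ≤ K * t₀ * (ε * D + κ) := by
    intro D hD0 hD t ht
    have e : (u t - T t (u 0)) - (v t - T t (v 0)) = ∫ r in 0..t,
        (T (t - r) (b r (u r) + g r (u r)) - T (t - r) (b' r (v r) + g' r (v r))) := by
      rw [intervalIntegral.integral_sub (hu.integrable t ht.1) (hv.integrable t ht.1)]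
      have h1 := hu.eq t ht.1
      have h2 := hv.eq t ht.1
      rw [sub_zero] at h1 h2
      conv_lhs => rw [h1, h2]
      abel
    rw [e]
    have := intervalIntegral.norm_integral_le_of_norm_le_const (a := 0) (b := t)
      (C := K * (ε * D + κ)) (f := fun r =>
        T (t - r) (b r (u r) + g r (u r)) - T (t - r) (b' r (v r) + g' r (v r))) (fun r hr => by
        rw [uIoc_of_le ht.1] at hr
        rw [← map_sub]
        refine (T _).le_of_opNorm_le_of_le (hT _ ⟨by linarith [hr.2], by linarith [hr.1, ht.2]⟩) ?_
        refine (hd r ⟨hr.1.le, hr.2.trans ht.2⟩).trans ?_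
        gcongr
        exact hD r ⟨hr.1.le, hr.2.trans ht.2⟩)
    refine this.trans ?_
    rw [sub_zero, abs_of_nonneg ht.1]
    calc K * (ε * D + κ) * t ≤ K * (ε * D + κ) * t₀ := by gcongr; exact ht.2
      _ = _ := by ring
  have bound : ∀ t ∈ Icc 0 t₀, ‖u t - v t‖ ≤ 2 * K * (‖u 0 - v 0‖ + t₀ * κ) := by
    -- No Gronwall inequality is needed: at the maximum of the difference, `K * t₀ * ε ≤ 1 / 2`
    -- allows half of it to be absorbed.
    obtain ⟨t₁, ht₁, hmax⟩ := isCompact_Icc.exists_isMaxOn (nonempty_Icc.2 ht₀) hc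
    have h1 := main ‖u t₁ - v t₁‖ (norm_nonneg _) (fun r hr => hmax hr) t₁ ht₁
    have h2 : ‖T t₁ (u 0 - v 0)‖ ≤ K * ‖u 0 - v 0‖ := (T _).le_of_opNorm_le (hT _ ht₁) _
    have h3 : u t₁ - v t₁ = ((u t₁ - T t₁ (u 0)) - (v t₁ - T t₁ (v 0))) + T t₁ (u 0 - v 0) := by
      rw [map_sub]; abel
    have h4 := norm_add_le ((u t₁ - T t₁ (u 0)) - (v t₁ - T t₁ (v 0))) (T t₁ (u 0 - v 0))
    rw [← h3] at h4
    have h5 : K * t₀ * ε * ‖u t₁ - v t₁‖ ≤ 1 / 2 * ‖u t₁ - v t₁‖ := by gcongr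
    intro t ht
    have h6 : ‖u t - v t‖ ≤ ‖u t₁ - v t₁‖ := hmax ht
    linarith
  exact ⟨bound t ht, main _ (by positivity) bound t ht⟩

/-- A mild solution starting near the origin stays in a ball for a short time. -/
lemma IsMildSolution.norm_lt {t₀ K ε ρ : ℝ} (hK : 1 ≤ K)
    (hT : ∀ t ∈ Icc 0 t₀, ‖T t‖ ≤ K) (hε : K * t₀ * ε ≤ 1 / 2) (hε0 : 0 ≤ ε) (hρ : 0 < ρ)
    (hu : IsMildSolution T b g 0 u)
    (hd : ∀ r x, ‖x‖ ≤ ρ → ‖b r x + g r x‖ ≤ ε * ‖x‖) (h0 : K * ‖u 0‖ ≤ ρ / 4)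
    {t : ℝ} (ht : t ∈ Icc 0 t₀) : ‖u t‖ < ρ := by
  by_contra hcon
  have hc : ContinuousOn (fun t => ‖u t‖) (Icc 0 t₀) :=
    hu.continuousOn.norm.mono Icc_subset_Ici_self
  have hZ : IsCompact (Icc 0 t₀ ∩ (fun t => ‖u t‖) ⁻¹' Ici ρ) :=
    isCompact_Icc.of_isClosed_subset (hc.preimage_isClosed_of_isClosed isClosed_Icc isClosed_Ici)
      inter_subset_left
  -- At the first exit time `t₁` the norm is at least `ρ`, but the variation of constants formula
  -- bounds it by `ρ / 4 + ρ / 2`.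
  obtain ⟨t₁, ⟨ht₁, hρ₁⟩, hmin⟩ := hZ.exists_isLeast ⟨t, ht, not_lt.1 hcon⟩
  have hlt : ∀ r, 0 ≤ r → r < t₁ → ‖u r‖ < ρ := fun r h1 h2 => by
    by_contra h3
    exact absurd (hmin ⟨⟨h1, h2.le.trans ht₁.2⟩, not_lt.1 h3⟩) (not_le.2 h2)
  have h1 := hu.eq t₁ ht₁.1
  rw [sub_zero] at h1
  have h2 : ‖∫ r in 0..t₁, T (t₁ - r) (b r (u r) + g r (u r))‖ ≤ K * (ε * ρ) * |t₁ - 0| := by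
    refine intervalIntegral.norm_integral_le_of_norm_le_const_ae ?_
    -- The solution is known to be inside the ball only strictly before `t₁`.
    have hne : ∀ᵐ r : ℝ, r ≠ t₁ := by simp [ae_iff]
    filter_upwards [hne] with r hr hr'
    rw [uIoc_of_le ht₁.1] at hr'
    have h3 := hlt r hr'.1.le (lt_of_le_of_ne hr'.2 hr)
    refine (T _).le_of_opNorm_le_of_le (hT _ ⟨by linarith [hr'.2], by linarith [hr'.1, ht₁.2]⟩) ?_
    exact (hd r _ h3.le).trans (by gcongr)
  rw [sub_zero, abs_of_nonneg ht₁.1] at h2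
  have h3 : ‖T t₁ (u 0)‖ ≤ ρ / 4 := ((T _).le_of_opNorm_le (hT _ ht₁) _).trans h0
  have h4 := norm_add_le (T t₁ (u 0)) (∫ r in 0..t₁, T (t₁ - r) (b r (u r) + g r (u r)))
  rw [← h1] at h4
  have h5 : K * (ε * ρ) * t₁ ≤ 1 / 2 * ρ := by
    calc K * (ε * ρ) * t₁ ≤ K * (ε * ρ) * t₀ := by gcongr; exact ht₁.2
      _ = K * t₀ * ε * ρ := by ring
      _ ≤ _ := by gcongr
  have h6 : ρ ≤ ‖u t₁‖ := hρ₁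
  linarith

lemma IsMildSolution.shift {s : ℝ}
    (hu : IsMildSolution T (fun r => b (r + s)) (fun r => g (r + s)) 0 u) :
    IsMildSolution T b g s (fun t => u (t - s)) := by
  refine ⟨hu.continuousOn.comp (by fun_prop) fun t ht => ?_, fun t ht => ?_, fun t ht => ?_⟩
  · simpa using ht
  · have := (hu.integrable (t - s) (by linarith)).comp_sub_right s
    simpa using this
  · have := hu.eq (t - s) (by linarith)
    rw [this, sub_self, sub_zero]
    congr 1
    have := intervalIntegral.integral_comp_sub_right (a := s) (b := t)
      (fun r => T (t - s - r) (b (r + s) (u r) + g (r + s) (u r))) s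
    simpa using this.symm

lemma IsMildSolution.restart [CompleteSpace X] (hT : IsC0Semigroup T) {s : ℝ} (hs : 0 ≤ s)
    (hu : IsMildSolution T b g 0 u) :
    IsMildSolution T (fun r => b (r + s)) (fun r => g (r + s)) 0 (fun t => u (t + s)) := by
  have hint : ∀ t, 0 ≤ t → IntervalIntegrable
      (fun r => T (t + s - r) (b r (u r) + g r (u r))) volume s (t + s) := fun t ht =>
    (hu.integrable (t + s) (by linarith)).mono_set (by
      rw [uIcc_of_le (by linarith), uIcc_of_le (by linarith)]
      exact Icc_subset_Icc_left hs)
  refine ⟨hu.continuousOn.comp (by fun_prop) fun t ht => ?_, fun t ht => ?_, fun t ht => ?_⟩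
  · simp only [mem_Ici] at ht ⊢; linarith
  · have := (hint t ht).comp_add_right s
    simpa [add_sub_add_right_eq_sub] using this
  · have h1 := hu.eq (t + s) (by linarith)
    have h2 := hu.eq s hs
    have h3 : ∫ r in 0..s, T (t + s - r) (b r (u r) + g r (u r)) =
        T t (∫ r in 0..s, T (s - r) (b r (u r) + g r (u r))) := by
      rw [← ContinuousLinearMap.intervalIntegral_comp_comm _ (hu.integrable s hs)]
      refine intervalIntegral.integral_congr fun r hr => ?_
      rw [uIcc_of_le hs] at hr
      rw [show t + s - r = t + (s - r) by ring, hT.add t (s - r) ht (by linarith [hr.2])]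
      rfl
    have h4 := intervalIntegral.integral_add_adjacent_intervals
      ((hu.integrable (t + s) (by linarith)).mono_set (d := s) (c := 0) (by
        rw [uIcc_of_le (by linarith), uIcc_of_le (by linarith)]
        exact Icc_subset_Icc_right (by linarith))) (hint t ht)
    have h5 := intervalIntegral.integral_comp_add_right (a := 0) (b := t)
      (fun r => T (t + s - r) (b r (u r) + g r (u r))) s
    simp only [add_sub_add_right_eq_sub, zero_add] at h5
    simp only [sub_zero, zero_add] at h1 h2 ⊢
    rw [h1, ← h4, h3, h5, h2, map_add, hT.add t s ht hs, ContinuousLinearMap.comp_apply]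
    abel

/-- Uniqueness for the linear equation. -/
lemma IsMildSolution.unique_linear [CompleteSpace X] (hT : IsC0Semigroup T) {t₀ K ε : ℝ}
    (ht₀ : 0 < t₀) (hK : 1 ≤ K) (hTK : ∀ t ∈ Icc 0 t₀, ‖T t‖ ≤ K) (hε : K * t₀ * ε ≤ 1 / 2)
    (hb : ∀ t, ‖b t‖ ≤ ε)
    (hu : IsMildSolution T b (fun _ _ => 0) 0 u) (hv : IsMildSolution T b (fun _ _ => 0) 0 v)
    (h0 : u 0 = v 0) {t : ℝ} (ht : 0 ≤ t) : u t = v t := by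
  have hε0 : 0 ≤ ε := (norm_nonneg _).trans (hb 0)
  -- The equation and both solutions are quantified inside the induction, since restarting after one
  -- step changes all three.
  have key : ∀ (n : ℕ) (b : ℝ → X →L[ℝ] X) (u v : ℝ → X), (∀ t, ‖b t‖ ≤ ε) →
      IsMildSolution T b (fun _ _ => 0) 0 u → IsMildSolution T b (fun _ _ => 0) 0 v →
      u 0 = v 0 → ∀ t, 0 ≤ t → t ≤ (n + 1) * t₀ → u t = v t := by
    intro n
    have base : ∀ (b : ℝ → X →L[ℝ] X) (u v : ℝ → X), (∀ t, ‖b t‖ ≤ ε) →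
        IsMildSolution T b (fun _ _ => 0) 0 u → IsMildSolution T b (fun _ _ => 0) 0 v →
        u 0 = v 0 → ∀ t ∈ Icc 0 t₀, u t = v t := by
      intro b u v hb hu hv h0 t ht
      have := (hu.compare ht₀.le hK hTK hε hε0 (κ := 0) le_rfl hv (fun r _ => by
        simp only [add_zero]
        rw [← map_sub]
        exact (b r).le_of_opNorm_le (hb r) _) ht).1
      rw [h0, sub_self, norm_zero, mul_zero, add_zero, mul_zero] at this
      exact sub_eq_zero.1 (norm_le_zero_iff.1 this)
    induction n with
    | zero => intro b u v hb hu hv h0 t h1 h2; exact base b u v hb hu hv h0 t ⟨h1, by simpa using h2⟩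
    | succ n ih =>
      intro b u v hb hu hv h0 t h1 h2
      rcases le_total t t₀ with h | h
      · exact base b u v hb hu hv h0 t ⟨h1, h⟩
      · have := ih (fun r => b (r + t₀)) (fun r => u (r + t₀)) (fun r => v (r + t₀))
          (fun t => hb _) (hu.restart hT ht₀.le) (hv.restart hT ht₀.le)
          (by simpa using base b u v hb hu hv h0 t₀ ⟨ht₀.le, le_rfl⟩) (t - t₀) (by linarith)
          (by push_cast at h2; linarith)
        simpa using this
  obtain ⟨n, hn⟩ := exists_nat_ge (t / t₀)
  rw [div_le_iff₀ ht₀] at hn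
  exact key n b u v hb hu hv h0 t ht (by linarith)

end Mild

/-! ### The linear evolution process and its continuity. -/

section LinearEvolution

variable {X : Type*} [NormedAddCommGroup X] [NormedSpace ℝ X]
  {T : ℝ → X →L[ℝ] X} {b : ℝ → X →L[ℝ] X}

open Classical in
/-- The solution operator of `z' = (A + b(t)) z` with initial time `0` (junk if there is none). -/
noncomputable def linSol (T : ℝ → X →L[ℝ] X) (b : ℝ → X →L[ℝ] X) : ℝ → X →L[ℝ] X :=
  if h : ∃ U : ℝ → X →L[ℝ] X, U 0 = ContinuousLinearMap.id ℝ X ∧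
      ∀ x, IsMildSolution T b (fun _ _ => 0) 0 (fun t => U t x) then h.choose else 0

/-- The linear process generated by `z' = (A + b(t)) z`. -/
noncomputable def linEvolution (T : ℝ → X →L[ℝ] X) (b : ℝ → X →L[ℝ] X) (t s : ℝ) : X →L[ℝ] X :=
  linSol T (fun r => b (r + s)) (t - s)

/-- Standing assumptions on the linear equation `z' = (A + b(t)) z`: the perturbation `b` is
strongly measurable and uniformly so small that a time step `t₀` can be controlled. -/
structure IsSmallLinear (T : ℝ → X →L[ℝ] X) (t₀ K β : ℝ) (b : ℝ → X →L[ℝ] X) : Prop where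
  semigroup : IsC0Semigroup T
  pos : 0 < t₀
  one_le : 1 ≤ K
  bound : ∀ t ∈ Icc 0 t₀, ‖T t‖ ≤ K
  small : K * t₀ * β ≤ 1 / 2
  measurable : ∀ x, StronglyMeasurable fun t => b t x
  norm_le : ∀ t, ‖b t‖ ≤ β

namespace IsSmallLinear

variable {t₀ K β : ℝ}

lemma shift (h : IsSmallLinear T t₀ K β b) (s : ℝ) :
    IsSmallLinear T t₀ K β (fun r => b (r + s)) where
  semigroup := h.semigroup
  pos := h.pos
  one_le := h.one_le
  bound := h.bound
  small := h.small
  measurable x := (h.measurable x).comp_measurable (measurable_id.add_const s)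
  norm_le _ := h.norm_le _

lemma nonneg (h : IsSmallLinear T t₀ K β b) : 0 ≤ β := (norm_nonneg _).trans (h.norm_le 0)

variable [CompleteSpace X] [TopologicalSpace.SeparableSpace X]

lemma linSol_spec (h : IsSmallLinear T t₀ K β b) : linSol T b 0 = ContinuousLinearMap.id ℝ X ∧
    ∀ x, IsMildSolution T b (fun _ _ => 0) 0 (fun t => linSol T b t x) := by
  have h := exists_linear_mild h.semigroup h.measurable h.norm_le
  rw [linSol, dif_pos h]
  exact h.choose_spec

lemma linSol_zero (h : IsSmallLinear T t₀ K β b) (x : X) : linSol T b 0 x = x := by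
  rw [h.linSol_spec.1]; rfl

lemma eq_linSol (h : IsSmallLinear T t₀ K β b) {u : ℝ → X}
    (hu : IsMildSolution T b (fun _ _ => 0) 0 u) {t : ℝ} (ht : 0 ≤ t) :
    u t = linSol T b t (u 0) :=
  hu.unique_linear h.semigroup h.pos h.one_le h.bound h.small h.norm_le
    (h.linSol_spec.2 (u 0)) (h.linSol_zero _).symm ht

lemma linSol_add (h : IsSmallLinear T t₀ K β b) {t s : ℝ} (ht : 0 ≤ t) (hs : 0 ≤ s) (x : X) :
    linSol T b (t + s) x = linSol T (fun r => b (r + s)) t (linSol T b s x) := by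
  have h1 := (h.linSol_spec.2 x).restart h.semigroup hs
  simpa using (h.shift s).eq_linSol h1 ht

/-- Comparison with the zero solution. The second bound, of order `β`, is what makes the time-`t₀`
maps close to `T t₀`. -/
lemma linSol_estimate (h : IsSmallLinear T t₀ K β b) {t : ℝ} (ht : t ∈ Icc 0 t₀) (x : X) :
    ‖linSol T b t x‖ ≤ 2 * K * ‖x‖ ∧ ‖linSol T b t x - T t x‖ ≤ 2 * K ^ 2 * t₀ * β * ‖x‖ := by
  have := (h.linSol_spec.2 x).compare h.pos.le h.one_le h.bound h.small h.nonneg (κ := 0) le_rfl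
    (.zero T 0) (fun r _ => by simpa using (b r).le_of_opNorm_le (h.norm_le r) _) ht
  simp only [h.linSol_zero, map_zero, sub_zero, mul_zero, add_zero] at this
  exact ⟨this.1, this.2.trans (le_of_eq (by ring))⟩

lemma linEvolution_refl (h : IsSmallLinear T t₀ K β b) (t : ℝ) (x : X) :
    linEvolution T b t t x = x := by
  rw [linEvolution, sub_self, (h.shift t).linSol_zero]

lemma linEvolution_comp (h : IsSmallLinear T t₀ K β b) {t s r : ℝ} (hrs : r ≤ s) (hst : s ≤ t)
    (x : X) : linEvolution T b t s (linEvolution T b s r x) = linEvolution T b t r x := by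
  have := (h.shift r).linSol_add (sub_nonneg.2 hst) (sub_nonneg.2 hrs) x
  simp only [linEvolution]
  rw [show t - r = t - s + (s - r) by ring, this]
  simp only [add_assoc, sub_add_cancel]

lemma linEvolution_estimate (h : IsSmallLinear T t₀ K β b) {s t : ℝ} (hst : s ≤ t)
    (ht : t ≤ s + t₀) (x : X) : ‖linEvolution T b t s x‖ ≤ 2 * K * ‖x‖ :=
  ((h.shift s).linSol_estimate ⟨sub_nonneg.2 hst, by linarith⟩ x).1

lemma linEvolution_step (h : IsSmallLinear T t₀ K β b) (s : ℝ) (x : X) :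
    ‖linEvolution T b (s + t₀) s x - T t₀ x‖ ≤ 2 * K ^ 2 * t₀ * β * ‖x‖ := by
  have := ((h.shift s).linSol_estimate ⟨h.pos.le, le_rfl⟩ x).2
  rwa [linEvolution, add_sub_cancel_left]

lemma isNearEvolution (h : IsSmallLinear T t₀ K β b) :
    IsNearEvolution (T t₀) (2 * K ^ 2 * t₀ * β) t₀ (2 * K) (linEvolution T b) where
  refl := h.linEvolution_refl
  comp _ _ _ hrs hst := h.linEvolution_comp hrs hst
  pos := h.pos
  one_le := by linarith [h.one_le]
  near := h.linEvolution_step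
  bound _ _ := h.linEvolution_estimate

lemma isMildSolution_linEvolution (h : IsSmallLinear T t₀ K β b) (s : ℝ) (x : X) :
    IsMildSolution T b (fun _ _ => 0) s (fun t => linEvolution T b t s x) :=
  IsMildSolution.shift (g := fun _ _ => 0) ((h.shift s).linSol_spec.2 x)

/-- The bound depends on the times only through `t - s`, which is the uniformity that continuity in
the initial time requires. -/
lemma norm_linEvolution_sub_le (h : IsSmallLinear T t₀ K β b) {s t : ℝ} (hst : s ≤ t)
    (ht : t ≤ s + t₀) (x : X) :
    ‖linEvolution T b t s x - x‖ ≤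
      2 * K ^ 2 * β * (t - s) * ‖x‖ + ‖T (max (t - s) 0) x - x‖ := by
  have hts : 0 ≤ t - s := sub_nonneg.2 hst
  have h0 := h.nonneg
  have hK := h.one_le
  rcases hts.eq_or_lt with h0 | h0
  · obtain rfl : t = s := by linarith
    rw [h.linEvolution_refl, sub_self, norm_zero]
    positivity
  -- The one-step estimate is applied with `t - s` as step length, so that its error tends to zero
  -- with `t - s`.
  have h' : IsSmallLinear T (t - s) K β (fun r => b (r + s)) :=
    { h.shift s with
      pos := h0
      bound := fun r hr => h.bound r ⟨hr.1, by linarith [hr.2]⟩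
      small := le_trans (by gcongr; linarith) h.small }
  have h1 := (h'.linSol_estimate ⟨hts, le_rfl⟩ x).2
  rw [max_eq_left hts]
  have e : linEvolution T b t s x - x = (linEvolution T b t s x - T (t - s) x) + (T (t - s) x - x) := by
    abel
  rw [e]
  refine (norm_add_le _ _).trans (add_le_add_left (h1.trans (le_of_eq (by ring))) _)

lemma isEvolution (h : IsSmallLinear T t₀ K β b) :
    IsEvolutionProcess (fun t s x => linEvolution T b t s x) := by
  refine ⟨h.linEvolution_refl, fun t s r hrs hst x => h.linEvolution_comp hrs hst x, ?_⟩
  rintro ⟨⟨t, s⟩, x⟩ ⟨hst, -⟩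
  simp only [mem_ofPred_eq] at hst
  have hK := h.one_le
  have h0 := h.nonneg
  have ht₀ := h.pos
  obtain ⟨m, hm⟩ := exists_nat_ge ((t - s + 2) / t₀)
  rw [div_le_iff₀ h.pos] at hm
  set C := (2 * K) ^ m with hC
  have hC0 : 0 ≤ C := by positivity
  set ω : ℝ → ℝ := fun r => 2 * K ^ 2 * β * r * ‖x‖ + ‖T (max r 0) x - x‖ with hω
  have hωc : Continuous ω := by
    have h1 : Continuous fun r : ℝ => T (max r 0) x :=
      h.semigroup.continuous_extend.comp (by fun_prop : Continuous fun r : ℝ => (r, x))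
    exact (by fun_prop : Continuous fun r : ℝ => 2 * K ^ 2 * β * r * ‖x‖).add
      (h1.sub continuous_const).norm
  have hω0 : ω 0 = 0 := by simp [hω, h.semigroup.zero]
  set F := 𝓝[{q : ℝ × ℝ | q.2 ≤ q.1} ×ˢ (univ : Set X)] ((t, s), x) with hF
  have hF' : F ≤ 𝓝 ((t, s), x) := nhdsWithin_le_nhds
  have hmem : ∀ᶠ p : (ℝ × ℝ) × X in F, p.1.2 ≤ p.1.1 := by
    filter_upwards [self_mem_nhdsWithin] with p hp using hp.1
  have hev : ∀ {f : (ℝ × ℝ) × X → ℝ} {c : ℝ}, Continuous f → f ((t, s), x) < c →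
      ∀ᶠ p in F, f p < c := fun hf hlt => hF' (hf.continuousAt.eventually_lt_const hlt)
  have hgrow : ∀ᶠ p : (ℝ × ℝ) × X in F, p.1.1 - p.1.2 ≤ m * t₀ := by
    filter_upwards [hev (f := fun p => p.1.1 - p.1.2) (by fun_prop)
      (show t - s < t - s + 2 by linarith)] with p hp
    linarith
  rw [ContinuousWithinAt, tendsto_iff_norm_sub_tendsto_zero]
  -- Operator norms are bounded by `C` for all nearby times, so the state may be frozen at `x`.
  have hx : ∀ (f : (ℝ × ℝ) × X → ℝ), Tendsto f F (𝓝 0) →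
      (∀ᶠ p in F, ‖linEvolution T b p.1.1 p.1.2 x - linEvolution T b t s x‖ ≤ f p) →
      Tendsto (fun p : (ℝ × ℝ) × X =>
        ‖linEvolution T b p.1.1 p.1.2 p.2 - linEvolution T b t s x‖) F (𝓝 0) := by
    intro f hf hle
    refine squeeze_zero' (g := fun p => C * ‖p.2 - x‖ + f p)
      (Eventually.of_forall fun _ => norm_nonneg _) ?_ ?_
    · filter_upwards [hle, hmem, hgrow] with p h1 h2 h3
      have e : linEvolution T b p.1.1 p.1.2 p.2 - linEvolution T b t s x =
          linEvolution T b p.1.1 p.1.2 (p.2 - x) +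
            (linEvolution T b p.1.1 p.1.2 x - linEvolution T b t s x) := by
        rw [map_sub]; abel
      rw [e]
      exact (norm_add_le _ _).trans (add_le_add
        (h.isNearEvolution.growth m h2 (by linarith) _) h1)
    · have : Continuous fun p : (ℝ × ℝ) × X => C * ‖p.2 - x‖ := by fun_prop
      have := (this.tendsto ((t, s), x)).mono_left hF'
      simpa using this.add hf
  -- On the diagonal both operators are close to the identity. Off it, the initial time is moved
  -- first and the final time afterwards, along a mild solution.
  rcases hst.eq_or_lt with rfl | hlt
  · refine hx (fun p => ω (p.1.1 - p.1.2)) ?_ ?_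
    · have : Continuous fun p : (ℝ × ℝ) × X => ω (p.1.1 - p.1.2) := by fun_prop
      simpa [hω0] using (this.tendsto ((s, s), x)).mono_left hF'
    · filter_upwards [hmem, hev (f := fun p => p.1.1 - p.1.2) (by fun_prop)
        (show s - s < t₀ by simpa using ht₀)] with p h1 h2
      rw [h.linEvolution_refl]
      exact h.norm_linEvolution_sub_le h1 (by linarith) x
  · refine hx (fun p => C * ω |p.1.2 - s| + ‖linEvolution T b p.1.1 s x - linEvolution T b t s x‖)
      ?_ ?_
    · have h1 : Continuous fun p : (ℝ × ℝ) × X => C * ω |p.1.2 - s| := by fun_prop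
      have h1' := (h1.tendsto ((t, s), x)).mono_left hF'
      have h2 : ContinuousAt (fun t => linEvolution T b t s x) t :=
        (h.isMildSolution_linEvolution s x).continuousOn.continuousAt (Ici_mem_nhds hlt)
      have h3 : Tendsto (fun p : (ℝ × ℝ) × X => p.1.1) F (𝓝 t) :=
        ((by fun_prop : Continuous fun p : (ℝ × ℝ) × X => p.1.1).tendsto _).mono_left hF'
      have h4 := tendsto_iff_norm_sub_tendsto_zero.1 (h2.tendsto.comp h3)
      simpa [hω0] using h1'.add h4
    · filter_upwards [hmem, hgrow, hev (f := fun p => s - p.1.1) (by fun_prop)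
        (show s - t < 0 by linarith), hev (f := fun p => p.1.1 - s) (by fun_prop)
        (show t - s < t - s + 2 by linarith), hev (f := fun p => |p.1.2 - s|) (by fun_prop)
        (show |s - s| < t₀ by simpa using ht₀)] with p h1 h2 h3 h4 h5
      -- The cocycle identity at the later of the two initial times reduces the difference to a
      -- short evolution of `x` near the identity.
      have key : ‖linEvolution T b p.1.1 p.1.2 x - linEvolution T b p.1.1 s x‖ ≤
          C * ω |p.1.2 - s| := by
        rcases le_total s p.1.2 with h6 | h6
        · rw [abs_of_nonneg (by linarith)] at h5 ⊢
          rw [← h.linEvolution_comp h6 h1, ← map_sub]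
          refine (h.isNearEvolution.growth m h1 (by linarith) _).trans ?_
          gcongr
          rw [norm_sub_rev]
          exact h.norm_linEvolution_sub_le h6 (by linarith) x
        · rw [abs_of_nonpos (by linarith), neg_sub] at h5 ⊢
          rw [← h.linEvolution_comp h6 (by linarith), ← map_sub]
          refine (h.isNearEvolution.growth m (by linarith) (by linarith) _).trans ?_
          gcongr
          exact h.norm_linEvolution_sub_le h6 (by linarith) x
      have e : linEvolution T b p.1.1 p.1.2 x - linEvolution T b t s x =
          (linEvolution T b p.1.1 p.1.2 x - linEvolution T b p.1.1 s x) +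
            (linEvolution T b p.1.1 s x - linEvolution T b t s x) := by abel
      rw [e]
      exact (norm_add_le _ _).trans (add_le_add_left key _)

theorem isLinearEvolution (h : IsSmallLinear T t₀ K β b) :
    IsLinearProcess T b (linEvolution T b) :=
  ⟨h.isEvolution, h.isMildSolution_linEvolution⟩

end IsSmallLinear

end LinearEvolution

/-! ### Cutting off the nonlinear steps. -/

section Cut

variable {X : Type*} [NormedAddCommGroup X] [NormedSpace ℝ X]

/-- The radial retraction onto the closed ball of radius `r`. -/
noncomputable def retr (r : ℝ) (x : X) : X := (r / max r ‖x‖) • x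

lemma retr_of_norm_le {r : ℝ} (hr : 0 < r) {x : X} (hx : ‖x‖ ≤ r) : retr r x = x := by
  rw [retr, max_eq_left hx, div_self hr.ne', one_smul]

lemma norm_retr_le {r : ℝ} (hr : 0 < r) (x : X) : ‖retr r x‖ ≤ r := by
  have h : 0 < max r ‖x‖ := lt_max_of_lt_left hr
  rw [retr, norm_smul, Real.norm_of_nonneg (by positivity), div_mul_eq_mul_div, div_le_iff₀ h]
  gcongr
  exact le_max_right _ _

/-- The constant `2` holds in every normed space; it doubles the Lipschitz constant of the steps in
`cut_lipschitz`. -/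
lemma norm_retr_sub_le {r : ℝ} (hr : 0 < r) (x y : X) :
    ‖retr r x - retr r y‖ ≤ 2 * ‖x - y‖ := by
  have ha : 0 < max r ‖x‖ := lt_max_of_lt_left hr
  have hc : 0 < max r ‖y‖ := lt_max_of_lt_left hr
  have e : retr r x - retr r y = (r / max r ‖x‖) • (x - y) +
      ((r / max r ‖x‖) * ((max r ‖y‖ - max r ‖x‖) / max r ‖y‖)) • y := by
    have : (r / max r ‖x‖) * ((max r ‖y‖ - max r ‖x‖) / max r ‖y‖) =
        r / max r ‖x‖ - r / max r ‖y‖ := by field_simp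
    rw [this, retr, retr, smul_sub, sub_smul]
    abel
  have h1 : r / max r ‖x‖ ≤ 1 := (div_le_one ha).2 (le_max_left _ _)
  have h1' : 0 ≤ r / max r ‖x‖ := by positivity
  have h2 : |max r ‖y‖ - max r ‖x‖| ≤ ‖x - y‖ := by
    refine (abs_max_sub_max_le_max _ _ _ _).trans ?_
    rw [sub_self, abs_zero, norm_sub_rev]
    exact max_le (norm_nonneg _) (abs_norm_sub_norm_le _ _)
  rw [e]
  refine (norm_add_le _ _).trans ?_
  rw [norm_smul, norm_smul, Real.norm_of_nonneg h1', norm_mul, Real.norm_of_nonneg h1', norm_div,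
    Real.norm_eq_abs, Real.norm_of_nonneg hc.le]
  have h3 : |max r ‖y‖ - max r ‖x‖| / max r ‖y‖ * ‖y‖ ≤ ‖x - y‖ := by
    rw [div_mul_eq_mul_div, div_le_iff₀ hc]
    gcongr
    exact le_max_right _ _
  have h4 : 0 ≤ |max r ‖y‖ - max r ‖x‖| / max r ‖y‖ * ‖y‖ := by positivity
  rw [mul_assoc]
  nlinarith [norm_nonneg (x - y)]

/-- The map `f`, modified outside the ball of radius `r` to a perturbation of `S`. -/
noncomputable def cutStep (S : X →L[ℝ] X) (r : ℝ) (f : X → X) (x : X) : X :=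
  S x + (f (retr r x) - S (retr r x))

lemma cutStep_of_norm_le {S : X →L[ℝ] X} {r : ℝ} (hr : 0 < r) {f : X → X} {x : X}
    (hx : ‖x‖ ≤ r) : cutStep S r f x = f x := by
  rw [cutStep, retr_of_norm_le hr hx]
  abel

/-- The step maps of the nonlinear process `Ψ`, cut off, before time `s` and those of the linear
process `Φ` after time `s`. -/
noncomputable def mixSeq (S : X →L[ℝ] X) (r₀ t₀ : ℝ) (Ψ : ℝ → ℝ → X → X)
    (Φ : ℝ → ℝ → X →L[ℝ] X) (s : ℝ) (n : ℤ) : X → X :=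
  if n < 0 then cutStep S r₀ (Ψ (s + (n + 1) * t₀) (s + n * t₀)) else stepSeq Φ t₀ s n

end Cut

/-! ### The local unstable set as a graph. -/

section Nonlinear

variable {X : Type*} [NormedAddCommGroup X] [NormedSpace ℝ X]
  {T : ℝ → X →L[ℝ] X} {b b' : ℝ → X →L[ℝ] X} {g g' : ℝ → X → X} {Ψ Ψ' : ℝ → ℝ → X → X}

/-- Standing assumptions on the nonlinear equation `z' = (A + b(t)) z + g(t, z)`: its solution
process is `Ψ`, and near the origin `b(t) + g(t, ·)` has small Lipschitz constant `ε`. -/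
structure IsSmallEquation (T : ℝ → X →L[ℝ] X) (t₀ K ε ρ : ℝ) (b : ℝ → X →L[ℝ] X)
    (g : ℝ → X → X) (Ψ : ℝ → ℝ → X → X) : Prop where
  pos : 0 < t₀
  one_le : 1 ≤ K
  bound : ∀ t ∈ Icc 0 t₀, ‖T t‖ ≤ K
  small : K * t₀ * ε ≤ 1 / 2
  nonneg : 0 ≤ ε
  radius_pos : 0 < ρ
  lip : ∀ r x y, ‖x‖ ≤ ρ → ‖y‖ ≤ ρ → ‖(b r x + g r x) - (b r y + g r y)‖ ≤ ε * ‖x - y‖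
  zero : ∀ r, g r 0 = 0
  refl : ∀ t x, Ψ t t x = x
  comp : ∀ t s r, r ≤ s → s ≤ t → ∀ x, Ψ t s (Ψ s r x) = Ψ t r x
  mild : ∀ s x,
    IsMildSolution T (fun r => b (r + s)) (fun r => g (r + s)) 0 (fun t => Ψ (t + s) s x)

namespace IsSmallEquation

variable {t₀ K ε ρ : ℝ}

lemma norm_lt (h : IsSmallEquation T t₀ K ε ρ b g Ψ) (s : ℝ) {x : X}
    (hx : K * ‖x‖ ≤ ρ / 4) {t : ℝ} (ht : t ∈ Icc 0 t₀) : ‖Ψ (t + s) s x‖ < ρ := by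
  refine (h.mild s x).norm_lt h.one_le h.bound h.small h.nonneg h.radius_pos (fun r y hy => ?_) ?_ ht
  · simpa [h.zero] using h.lip (r + s) y 0 hy (by simpa using h.radius_pos.le)
  · simpa [h.refl] using hx

/-- Comparison of two processes over a short time, starting near the origin. -/
lemma compare (h : IsSmallEquation T t₀ K ε ρ b g Ψ) (h' : IsSmallEquation T t₀ K ε ρ b' g' Ψ')
    {κ : ℝ} (hκ0 : 0 ≤ κ) (s s' : ℝ)
    (hκ : ∀ r x, ‖x‖ ≤ ρ → ‖(b (r + s) x + g (r + s) x) - (b' (r + s') x + g' (r + s') x)‖ ≤ κ)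
    {x y : X} (hx : K * ‖x‖ ≤ ρ / 4) (hy : K * ‖y‖ ≤ ρ / 4) {t : ℝ} (ht : t ∈ Icc 0 t₀) :
    ‖Ψ (t + s) s x - Ψ' (t + s') s' y‖ ≤ 2 * K * (‖x - y‖ + t₀ * κ) ∧
      ‖(Ψ (t + s) s x - T t x) - (Ψ' (t + s') s' y - T t y)‖ ≤
        K * t₀ * (ε * (2 * K * (‖x - y‖ + t₀ * κ)) + κ) := by
  have := (h.mild s x).compare h.pos.le h.one_le h.bound h.small h.nonneg hκ0 (h'.mild s' y)
    (fun r hr => by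
      have h1 := h.lip (r + s) _ _ (h.norm_lt s hx hr).le (h'.norm_lt s' hy hr).le
      have h2 := hκ r _ (h'.norm_lt s' hy hr).le
      refine le_trans ?_ (add_le_add h1 h2)
      refine le_trans (le_of_eq ?_) (norm_add_le _ _)
      congr 1
      abel) ht
  simpa only [zero_add, h.refl, h'.refl] using this

lemma lipschitz (h : IsSmallEquation T t₀ K ε ρ b g Ψ) (s : ℝ)
    {x y : X} (hx : K * ‖x‖ ≤ ρ / 4) (hy : K * ‖y‖ ≤ ρ / 4) :
    ‖(Ψ (s + t₀) s x - T t₀ x) - (Ψ (s + t₀) s y - T t₀ y)‖ ≤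
      2 * K ^ 2 * t₀ * ε * ‖x - y‖ := by
  have := (h.compare h (κ := 0) le_rfl s s (by simp) hx hy ⟨h.pos.le, le_rfl⟩).2
  rw [add_comm t₀ s] at this
  exact this.trans (le_of_eq (by ring))

/-- The process is only assumed to give mild solutions; that it fixes the origin is uniqueness,
obtained by comparison with the zero solution. -/
lemma apply_zero_of_le (h : IsSmallEquation T t₀ K ε ρ b g Ψ) {s t : ℝ} (hst : s ≤ t)
    (ht : t ≤ s + t₀) : Ψ t s 0 = 0 := by
  have hzero : IsMildSolution T 0 (fun _ _ => 0) 0 (fun _ => (0 : X)) := .zero T 0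
  have hr : K * ‖(0 : X)‖ ≤ ρ / 4 := by simpa using (div_pos h.radius_pos (by norm_num)).le
  have := ((h.mild s 0).compare h.pos.le h.one_le h.bound h.small h.nonneg (κ := 0) le_rfl hzero
    (fun r hr' => by
      have := h.lip (r + s) _ 0 (h.norm_lt s hr hr').le (by simpa using h.radius_pos.le)
      simpa [h.zero] using this) (t := t - s) ⟨by linarith, by linarith⟩).1
  simpa [h.refl] using this

lemma norm_le (h : IsSmallEquation T t₀ K ε ρ b g Ψ) {s t : ℝ} (hst : s ≤ t)
    (ht : t ≤ s + t₀) {x : X} (hx : K * ‖x‖ ≤ ρ / 4) : ‖Ψ t s x‖ ≤ 2 * K * ‖x‖ := by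
  have hr : K * ‖(0 : X)‖ ≤ ρ / 4 := by simpa using (div_pos h.radius_pos (by norm_num)).le
  have := (h.compare h (κ := 0) le_rfl s s (by simp) hx hr (t := t - s)
    ⟨by linarith, by linarith⟩).1
  simpa [h.apply_zero_of_le hst ht] using this

lemma apply_zero (h : IsSmallEquation T t₀ K ε ρ b g Ψ) {s t : ℝ} (hst : s ≤ t) :
    Ψ t s 0 = 0 := by
  have key : ∀ (n : ℕ) (t : ℝ), s ≤ t → t ≤ s + n * t₀ → Ψ t s 0 = 0 := by
    intro n
    induction n with
    | zero => intro t h1 h2; exact h.apply_zero_of_le h1 (by have := h.pos; simp at h2; linarith)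
    | succ n ih =>
      intro t h1 h2
      push_cast at h2
      rcases le_total t (s + t₀) with h3 | h3
      · exact h.apply_zero_of_le h1 h3
      · have hp := h.pos
        have h4 : s ≤ t - t₀ := by linarith
        rw [← h.comp t (t - t₀) s h4 (by linarith), ih (t - t₀) h4 (by linarith)]
        exact h.apply_zero_of_le (by linarith) (by linarith)
  obtain ⟨n, hn⟩ := exists_nat_ge ((t - s) / t₀)
  rw [div_le_iff₀ h.pos] at hn
  exact key n t hst (by linarith)

variable {Φ Φ' : ℝ → ℝ → X →L[ℝ] X} {r₀ q K' : ℝ} {P V : X →L[ℝ] X}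

lemma cut_lipschitz (h : IsSmallEquation T t₀ K ε ρ b g Ψ) (hr₀ : 0 < r₀)
    (hr : K * r₀ ≤ ρ / 4) (s : ℝ) (x y : X) :
    ‖(cutStep (T t₀) r₀ (Ψ (s + t₀) s) x - T t₀ x) - (cutStep (T t₀) r₀ (Ψ (s + t₀) s) y - T t₀ y)‖
      ≤ 4 * K ^ 2 * t₀ * ε * ‖x - y‖ := by
  have hK := h.one_le
  have hx : ∀ x : X, K * ‖retr r₀ x‖ ≤ ρ / 4 := fun x => le_trans (by
    gcongr; exact norm_retr_le hr₀ x) hr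
  have := h.lipschitz s (hx x) (hx y)
  simp only [cutStep, add_sub_cancel_left]
  refine this.trans ?_
  have hp := h.pos
  have h0 := h.nonneg
  calc _ ≤ 2 * K ^ 2 * t₀ * ε * (2 * ‖x - y‖) := by
        gcongr; exact norm_retr_sub_le hr₀ x y
    _ = _ := by ring

lemma step_eq {t₀ s : ℝ} {n : ℤ} : s + ((n : ℝ) + 1) * t₀ = s + n * t₀ + t₀ := by ring

lemma mixSeq_isNear (h : IsSmallEquation T t₀ K ε ρ b g Ψ) (hr₀ : 0 < r₀)
    (hr : K * r₀ ≤ ρ / 4) (hΦ : IsNearEvolution (T t₀) (4 * K ^ 2 * t₀ * ε) t₀ K' Φ) (s : ℝ) :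
    IsNear (T t₀) (4 * K ^ 2 * t₀ * ε) (mixSeq (T t₀) r₀ t₀ Ψ Φ s) := by
  refine ⟨fun n => ?_, fun n x y => ?_⟩
  · rw [mixSeq]
    split_ifs
    · rw [cutStep_of_norm_le hr₀ (by simpa using hr₀.le), step_eq]
      exact h.apply_zero (by linarith [h.pos])
    · simp
  · rw [mixSeq]
    split_ifs
    · rw [step_eq]
      exact h.cut_lipschitz hr₀ hr _ x y
    · exact (hΦ.isNear s).lip n x y

/-- The future of the mixed sequence is purely linear. This places the values of the graph map in
the kernel of the linear projection. -/
lemma hasForwardOrbit_mixSeq_iff {S : X →L[ℝ] X} {s : ℝ} {v : X} :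
    HasForwardOrbit (mixSeq S r₀ t₀ Ψ Φ s) v ↔ HasForwardOrbit (fun n => stepSeq Φ t₀ s n) v := by
  refine exists_congr fun c => and_congr_right fun _ => and_congr_right fun _ =>
    forall_congr' fun n => forall_congr' fun hn => ?_
  rw [mixSeq, if_neg (by omega)]

/-- The values of the graph map are in the kernel of the projection. -/
lemma projOf_jumpOrbit [CompleteSpace X] (h : IsSmallEquation T t₀ K ε ρ b g Ψ) (hS : IsHypSplit (T t₀) P V q)
    (hε : q * (4 * K ^ 2 * t₀ * ε) ≤ 1 / 16) (hr₀ : 0 < r₀)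
    (hr : K * r₀ ≤ ρ / 4) (hΦ : IsNearEvolution (T t₀) (4 * K ^ 2 * t₀ * ε) t₀ K' Φ)
    (s : ℝ) (p : X) :
    projOf (fun n => stepSeq Φ t₀ s n) (jumpOrbit (mixSeq (T t₀) r₀ t₀ Ψ Φ s) p 0) = 0 := by
  have hε0 : 0 ≤ 4 * K ^ 2 * t₀ * ε := by have := h.pos; have := h.nonneg; positivity
  exact (hasForwardOrbit_mixSeq_iff.1 (hasForwardOrbit_jumpOrbit hS hε hε0
    (h.mixSeq_isNear hr₀ hr hΦ s) p)).projOf_eq hS hε hε0 (hΦ.isNear s)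

/-- Small global solutions are on the graph. -/
lemma eq_of_globalSolution [CompleteSpace X] (h : IsSmallEquation T t₀ K ε ρ b g Ψ) (hS : IsHypSplit (T t₀) P V q)
    (hε : q * (4 * K ^ 2 * t₀ * ε) ≤ 1 / 16) (hr₀ : 0 < r₀)
    (hr : K * r₀ ≤ ρ / 4) (hΦ : IsNearEvolution (T t₀) (4 * K ^ 2 * t₀ * ε) t₀ K' Φ)
    {s : ℝ} {ζ : ℝ → X} (hζ : IsGlobalSolution Ψ ζ) (hb : ∀ t ≤ s, ‖ζ t‖ ≤ r₀) :
    ζ s = projOf (fun n => stepSeq Φ t₀ s n) (ζ s) +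
      jumpOrbit (mixSeq (T t₀) r₀ t₀ Ψ Φ s) (projOf (fun n => stepSeq Φ t₀ s n) (ζ s)) 0 := by
  have hε0 : 0 ≤ 4 * K ^ 2 * t₀ * ε := by have := h.pos; have := h.nonneg; positivity
  have hp := h.pos
  have hle : ∀ n : ℤ, n ≤ 0 → s + n * t₀ ≤ s := fun n hn => by
    have : (n : ℝ) ≤ 0 := by exact_mod_cast hn
    nlinarith
  -- Sampled on the grid, a solution staying in the ball of radius `r₀` does not see the cut-off.
  have hback : HasBackwardOrbit (mixSeq (T t₀) r₀ t₀ Ψ Φ s) (ζ s) := by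
    refine ⟨fun n => ζ (s + n * t₀), by simp, ⟨r₀, fun n hn => hb _ (hle n hn)⟩, fun n hn => ?_⟩
    rw [mixSeq, if_pos hn, cutStep_of_norm_le hr₀ (hb _ (hle n hn.le)), hζ _ _ (by linarith)]
    push_cast
    rfl
  rw [hback.jumpOrbit_eq hS hε hε0 (h.mixSeq_isNear hr₀ hr hΦ s)
    (hasForwardOrbit_mixSeq_iff.2 (hasForwardOrbit_sub_projOf hS hε hε0 (hΦ.isNear s) _))]
  abel

/-- Discrete backward orbits extend to global solutions. -/
lemma exists_globalSolution_of_orbit (h : IsSmallEquation T t₀ K ε ρ b g Ψ) {s : ℝ} {c : ℤ → X}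
    (hc : ∀ n < 0, c (n + 1) = Ψ (s + (n + 1) * t₀) (s + n * t₀) (c n)) :
    ∃ ζ, IsGlobalSolution Ψ ζ ∧ ζ s = c 0 ∧ ∀ t ≤ s, ∃ r ≤ t, t ≤ r + t₀ ∧
      ζ t = Ψ t r (c (-1 - (⌊(s - t) / t₀⌋₊ : ℤ))) := by
  have hp := h.pos
  -- Any grid point in the past leads to the same value, so `ζ t` below does not depend on where the
  -- evolution is started.
  have hmono : ∀ n k : ℕ, c (-n) = Ψ (s - n * t₀) (s - (n + k) * t₀) (c (-(n + k))) := by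
    intro n k
    induction k with
    | zero => simp [h.refl]
    | succ k ih =>
      have h1 := hc (-(n + k) - 1) (by omega)
      rw [sub_add_cancel] at h1
      push_cast at h1
      rw [show s + (-((n : ℝ) + k) - 1 + 1) * t₀ = s - (n + k) * t₀ by ring,
        show s + (-((n : ℝ) + k) - 1) * t₀ = s - (n + (k + 1)) * t₀ by ring] at h1
      rw [ih, h1, h.comp _ _ _ (by linarith) (by nlinarith [(Nat.cast_nonneg k : (0:ℝ) ≤ k)])]
      push_cast
      rw [show -((n : ℤ) + k) - 1 = -(n + (k + 1)) by ring]
  -- For `t ≤ s` the grid time `s - N t * t₀` precedes `t` by at most one step; for later `t` the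
  -- floor is zero and `N t = 1` still serves.
  set N : ℝ → ℕ := fun t => ⌊(s - t) / t₀⌋₊ + 1 with hN
  have hNt : ∀ t, s - N t * t₀ ≤ t := fun t => by
    have : (s - t) / t₀ < N t := by simpa [hN] using Nat.lt_floor_add_one ((s - t) / t₀)
    rw [div_lt_iff₀ hp] at this
    linarith
  set ζ : ℝ → X := fun t => Ψ t (s - N t * t₀) (c (-N t)) with hζ
  have key : ∀ (t : ℝ) (n : ℕ), s - n * t₀ ≤ t → ζ t = Ψ t (s - n * t₀) (c (-n)) := by
    intro t n hn
    simp only [hζ]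
    rcases le_total n (N t) with h1 | h1
    · obtain ⟨k, hk⟩ := Nat.exists_eq_add_of_le h1
      rw [hmono n k, h.comp _ _ _ _ hn, hk]
      · push_cast; rfl
      · nlinarith [(Nat.cast_nonneg k : (0:ℝ) ≤ k)]
    · obtain ⟨k, hk⟩ := Nat.exists_eq_add_of_le h1
      rw [hmono (N t) k, h.comp _ _ _ _ (hNt t), hk]
      · push_cast; rfl
      · nlinarith [(Nat.cast_nonneg k : (0:ℝ) ≤ k)]
  refine ⟨ζ, fun r t hrt => ?_, ?_, fun t ht => ⟨s - N t * t₀, hNt t, ?_, ?_⟩⟩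
  · rw [key t (N r) ((hNt r).trans hrt), key r (N r) (hNt r), h.comp _ _ _ (hNt r) hrt]
  · rw [key s 0 (by simp)]
    simp [h.refl]
  · have : (⌊(s - t) / t₀⌋₊ : ℝ) ≤ (s - t) / t₀ := Nat.floor_le (div_nonneg (by linarith) hp.le)
    rw [le_div_iff₀ hp] at this
    simp only [hN]
    push_cast
    linarith
  · have e : (-(N t : ℤ)) = -1 - (⌊(s - t) / t₀⌋₊ : ℤ) := by simp only [hN]; push_cast; ring
    rw [← e]

/-- Points of the graph are on global solutions that are small in the past. -/
lemma exists_globalSolution [CompleteSpace X] (h : IsSmallEquation T t₀ K ε ρ b g Ψ) (hS : IsHypSplit (T t₀) P V q)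
    (hε : q * (4 * K ^ 2 * t₀ * ε) ≤ 1 / 16) (hr₀ : 0 < r₀)
    (hr : K * r₀ ≤ ρ / 4) (hΦ : IsNearEvolution (T t₀) (4 * K ^ 2 * t₀ * ε) t₀ K' Φ)
    {s : ℝ} {p : X} (hp : 2 * q * ‖p‖ ≤ r₀) :
    ∃ ζ, IsGlobalSolution Ψ ζ ∧ ζ s = p + jumpOrbit (mixSeq (T t₀) r₀ t₀ Ψ Φ s) p 0 ∧
      (∀ t ≤ s, ‖ζ t‖ ≤ 4 * K * q * ‖p‖) ∧ Tendsto ζ atBot (𝓝 0) := by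
  have hε0 : 0 ≤ 4 * K ^ 2 * t₀ * ε := by have := h.pos; have := h.nonneg; positivity
  have hF := h.mixSeq_isNear hr₀ hr hΦ s
  have hz := isJump_jumpOrbit hS hε hε0 hF p
  set F := mixSeq (T t₀) r₀ t₀ Ψ Φ s with hFdef
  have hq := hS.one_le
  have hK := h.one_le
  have ht₀ := h.pos
  -- The smallness of `p` keeps the whole jump orbit where the cut-off is inactive, so its past is a
  -- true orbit of `Ψ`.
  have hzr : ∀ n, ‖jumpOrbit F p n‖ ≤ r₀ := fun n => (hz.norm_le hS hε hε0 hF n).trans hp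
  have hstep : ∀ n < 0, F n (jumpOrbit F p n) =
      Ψ (s + (n + 1) * t₀) (s + n * t₀) (jumpOrbit F p n) := fun n hn => by
    rw [hFdef, mixSeq, if_pos hn, cutStep_of_norm_le hr₀ (hzr n)]
  obtain ⟨ζ, hζ, hζs, hζt⟩ := h.exists_globalSolution_of_orbit (s := s)
    (c := fun n => if n = 0 then p + jumpOrbit F p 0 else jumpOrbit F p n) (fun n hn => by
      simp only [hn.ne, if_false]
      rw [← hstep n hn]
      split_ifs with h1
      · obtain rfl : n = -1 := by omega
        have := hz.step (-1)
        simp only [Int.reduceNeg, neg_add_cancel, if_true] at this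
        rw [this]
        abel
      · rw [hz.step, if_neg (by omega), add_zero])
  have hbound : ∀ t ≤ s, ‖ζ t‖ ≤ 4 * K * q * ‖p‖ * (1 / 2) ^ ⌊(s - t) / t₀⌋₊ := by
    intro t ht
    obtain ⟨r, hr1, hr2, e⟩ := hζt t ht
    rw [if_neg (by omega)] at e
    rw [e]
    refine (h.norm_le hr1 hr2 (le_trans (by gcongr; exact hzr _) hr)).trans ?_
    calc _ ≤ 2 * K * (2 * q * ‖p‖ * (1 / 2) ^ ⌊(s - t) / t₀⌋₊) := by
          gcongr
          exact hz.backward_decay hS hε hε0 hF _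
      _ = _ := by ring
  refine ⟨ζ, hζ, by simpa using hζs, fun t ht => (hbound t ht).trans ?_, ?_⟩
  · exact mul_le_of_le_one_right (by positivity) (pow_le_one₀ (by norm_num) (by norm_num))
  · rw [tendsto_zero_iff_norm_tendsto_zero]
    refine squeeze_zero' (Eventually.of_forall fun _ => norm_nonneg _)
      (by filter_upwards [eventually_le_atBot s] with t ht using hbound t ht) ?_
    have h1 : Tendsto (fun t => ⌊(s - t) / t₀⌋₊) atBot atTop := by
      refine tendsto_nat_floor_atTop.comp (Tendsto.atTop_div_const ht₀ ?_)
      exact tendsto_atTop_add_const_left _ s tendsto_neg_atBot_atTop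
    have h2 := (tendsto_pow_atTop_nhds_zero_of_lt_one (r := (1 / 2 : ℝ)) (by norm_num)
      (by norm_num)).comp h1
    simpa using h2.const_mul (4 * K * q * ‖p‖)

/-- Dependence of the graph maps on the equation. -/
lemma norm_jumpOrbit_sub_le [CompleteSpace X] (h : IsSmallEquation T t₀ K ε ρ b g Ψ)
    (h' : IsSmallEquation T t₀ K ε ρ b' g' Ψ') (hS : IsHypSplit (T t₀) P V q)
    (hε : q * (4 * K ^ 2 * t₀ * ε) ≤ 1 / 16) (hr₀ : 0 < r₀)
    (hr : K * r₀ ≤ ρ / 4) (hΦ : IsNearEvolution (T t₀) (4 * K ^ 2 * t₀ * ε) t₀ K' Φ)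
    (hΦ' : IsNearEvolution (T t₀) (4 * K ^ 2 * t₀ * ε) t₀ K' Φ') {κ β : ℝ} (hκ0 : 0 ≤ κ)
    (hβ0 : 0 ≤ β) {s s' : ℝ}
    (hκ : ∀ r r' x, ‖x‖ ≤ ρ → ‖(b r x + g r x) - (b' r' x + g' r' x)‖ ≤ κ)
    (hβ : ∀ n x, ‖stepSeq Φ t₀ s n x - stepSeq Φ' t₀ s' n x‖ ≤ β * ‖x‖) (p p' : X) :
    ‖jumpOrbit (mixSeq (T t₀) r₀ t₀ Ψ Φ s) p 0 - jumpOrbit (mixSeq (T t₀) r₀ t₀ Ψ' Φ' s') p' 0‖ ≤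
      2 * q * (2 * K * t₀ * κ + β * (2 * q * ‖p'‖) + ‖p - p'‖) := by
  have hε0 : 0 ≤ 4 * K ^ 2 * t₀ * ε := by have := h.pos; have := h.nonneg; positivity
  have hF := h.mixSeq_isNear hr₀ hr hΦ s
  have hF' := h'.mixSeq_isNear hr₀ hr hΦ' s'
  have hz := isJump_jumpOrbit hS hε hε0 hF p
  have hz' := isJump_jumpOrbit hS hε hε0 hF' p'
  have hq := hS.one_le
  have hK := h.one_le
  have ht₀ := h.pos
  refine hz.norm_sub_le hS hε hε0 hF hz' (fun n => ?_) 0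
  simp only [mixSeq]
  split_ifs with hn
  · have hx : ∀ x : X, K * ‖retr r₀ x‖ ≤ ρ / 4 := fun x => le_trans (by
      gcongr; exact norm_retr_le hr₀ x) hr
    -- The terms with `T t₀` cancel, and the two processes are compared at the same retracted point,
    -- where `κ` is available.
    simp only [cutStep, step_eq, add_sub_add_left_eq_sub, sub_sub_sub_cancel_right]
    have := (h.compare h' hκ0 (s + n * t₀) (s' + n * t₀) (fun r x hx => hκ _ _ x hx)
      (hx (jumpOrbit (mixSeq (T t₀) r₀ t₀ Ψ' Φ' s') p' n))
      (hx (jumpOrbit (mixSeq (T t₀) r₀ t₀ Ψ' Φ' s') p' n)) (t := t₀) ⟨ht₀.le, le_rfl⟩).1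
    rw [sub_self, norm_zero, zero_add, add_comm t₀, add_comm t₀] at this
    refine this.trans ?_
    have : 0 ≤ β * (2 * q * ‖p'‖) := by positivity
    linarith
  · refine (hβ n _).trans ?_
    have h1 : β * ‖jumpOrbit (mixSeq (T t₀) r₀ t₀ Ψ' Φ' s') p' n‖ ≤ β * (2 * q * ‖p'‖) := by
      gcongr
      exact hz'.norm_le hS hε hε0 hF' n
    have h2 : 0 ≤ 2 * K * t₀ * κ := by positivity
    exact h1.trans (by linarith)

end IsSmallEquation

end Nonlinear

/-! ### Hyperbolicity of one long step. -/

section Preparation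

variable {X : Type*} [NormedAddCommGroup X] [NormedSpace ℝ X]
  {S P V : X →L[ℝ] X} {q ε : ℝ}

lemma norm_projOf_le [CompleteSpace X] (hS : IsHypSplit S P V q) (hε : q * ε ≤ 1 / 16)
    (hε0 : 0 ≤ ε) {F : ℤ → X →L[ℝ] X} (hF : IsNear S ε (fun n => F n)) (x : X) :
    ‖projOf (fun n => F n) x‖ ≤ 3 * q * ‖x‖ := by
  have h1 := (isJump_jumpOrbit hS hε hε0 hF x).norm_le hS hε hε0 hF 0
  rw [projOf_apply hS hε hε0 hF, jumpProj]
  have h2 := norm_add_le x (jumpOrbit (fun n => F n) x 0)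
  nlinarith [norm_nonneg x, hS.one_le]

lemma IsNearEvolution.mono {t₀ K ε' : ℝ} {φ : ℝ → ℝ → X →L[ℝ] X} (h : IsNearEvolution S ε t₀ K φ)
    (hε : ε ≤ ε') : IsNearEvolution S ε' t₀ K φ where
  refl := h.refl
  comp := h.comp
  pos := h.pos
  one_le := h.one_le
  near s x := (h.near s x).trans (by gcongr)
  bound := h.bound

/-- A semigroup with exponential dichotomy is strongly hyperbolic after a long time. -/
lemma exists_isHypSplit {T : ℝ → X →L[ℝ] X} (h : HasExpDichotomy (fun t s => T (t - s)) (fun _ => P)) :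
    ∃ t₀ : ℝ, 0 < t₀ ∧ ∃ (V : X →L[ℝ] X) (q : ℝ), IsHypSplit (T t₀) P V q := by
  obtain ⟨M, α, hM, hα, h⟩ := h
  obtain ⟨t₀, ht₀, hs⟩ : ∃ t₀ : ℝ, 0 < t₀ ∧ M * Real.exp (-α * t₀) ≤ 1 / 16 := by
    have h1 : Tendsto (fun t : ℝ => M * Real.exp (-α * t)) atTop (𝓝 (M * 0)) := by
      refine (Real.tendsto_exp_atBot.comp ?_).const_mul M
      exact tendsto_id.const_mul_atTop_of_neg (neg_lt_zero.2 hα)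
    rw [mul_zero] at h1
    obtain ⟨t, h2, h3⟩ := ((h1.eventually_le_const (by norm_num : (0 : ℝ) < 1 / 16)).and
      (eventually_gt_atTop 0)).exists
    exact ⟨t, h3, h2⟩
  have hproj : ∀ x, P (P x) = P x := fun x => congrArg (fun L : X →L[ℝ] X => L x) (h.proj 0)
  have hcomm : ∀ x, P (T t₀ x) = T t₀ (P x) := fun x => by
    have := congrArg (fun L : X →L[ℝ] X => L x) (h.comm 0 t₀ ht₀.le)
    simpa using this
  have hbij := h.bij 0 t₀ ht₀.le
  rw [sub_zero] at hbij
  have hun : ∀ x y, P x = x → T t₀ x = P y → ‖x‖ ≤ ‖y‖ / 16 := fun x y hx hxy => by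
    refine (h.unstable 0 t₀ ht₀.le x ⟨x, hx⟩ y (by simpa using hxy)).trans ?_
    rw [show α * (0 - t₀) = -α * t₀ by ring]
    have := mul_le_mul_of_nonneg_right hs (norm_nonneg y)
    linarith
  -- The inverse `V` is chosen pointwise; uniqueness of preimages in the range of `P` makes it
  -- linear.
  have hex : ∀ y, ∃ x, P x = x ∧ T t₀ x = P y := fun y => by
    obtain ⟨_, ⟨x, rfl⟩, hx⟩ := hbij.surjOn ⟨y, rfl⟩
    exact ⟨P x, hproj x, hx⟩
  choose V hVP hTV using hex
  have huniq : ∀ x y, P x = x → T t₀ x = P y → x = V y := fun x y hx hxy =>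
    hbij.injOn ⟨x, hx⟩ ⟨V y, hVP y⟩ (hxy.trans (hTV y).symm)
  refine ⟨t₀, ht₀, LinearMap.mkContinuous
    { toFun := V
      map_add' := fun x y => (huniq _ _ (by rw [map_add, hVP, hVP])
        (by rw [map_add, hTV, hTV, map_add])).symm
      map_smul' := fun a x => (huniq _ _ (by simp [hVP]) (by simp [hTV])).symm }
    (1 / 16) (fun x => (hun _ x (hVP x) (hTV x)).trans (le_of_eq (by ring))), 1 + ‖P‖,
    hproj, hcomm, fun x => ?_, hTV, hVP, fun x => ?_, fun x => hun _ x (hVP x) (hTV x), ?_,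
    fun x => ?_⟩
  · exact (huniq (P x) (T t₀ x) (hproj x) (hcomm x).symm).symm
  · have := h.stable 0 t₀ ht₀.le
    rw [sub_zero] at this
    have := ContinuousLinearMap.le_of_opNorm_le _ (this.trans hs) x
    refine le_trans (le_of_eq ?_) (this.trans (le_of_eq (by ring)))
    simp
  · linarith [norm_nonneg P]
  · refine (norm_sub_le _ _).trans ?_
    have := P.le_opNorm x
    linarith

lemma exists_radius_fderiv_le {f : X → X} (hf : ContDiff ℝ 1 f) (h0 : fderiv ℝ f 0 = 0)
    (hε : 0 < ε) : ∃ ρ : ℝ, 0 < ρ ∧ ∀ x, ‖x‖ ≤ ρ → ‖fderiv ℝ f x‖ ≤ ε := by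
  have hc : Continuous fun x => ‖fderiv ℝ f x‖ := (hf.continuous_fderiv one_ne_zero).norm
  have := (hc.continuousAt (x := (0 : X))).eventually_lt_const (u := ε) (by simpa [h0] using hε)
  obtain ⟨r, hr, hb⟩ := Metric.eventually_nhds_iff.1 this
  refine ⟨r / 2, by positivity, fun x hx => (hb ?_).le⟩
  rw [dist_zero_right]
  linarith

end Preparation

/-! ### Smallness along an orbit of the driving flow. -/

section Orbits

variable {Ω : Type*} {X : Type*} [NormedAddCommGroup X] [NormedSpace ℝ X] {θ : ℝ → Ω → Ω}

lemma IsRandomFlow.drive_drive [MeasurableSpace Ω] (hθ : IsRandomFlow θ) (t s : ℝ) (w : ℝ × Ω) :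
    drive θ t (drive θ s w) = drive θ (t + s) w := by
  simp only [drive, hθ.add, Function.comp_apply]
  rw [add_assoc]

/-- The size of an operator along an orbit. -/
noncomputable def supOp (θ : ℝ → Ω → Ω) (B : ℝ × Ω → X →L[ℝ] X) (w : ℝ × Ω) : ℝ≥0∞ :=
  ⨆ t : ℝ, ‖B (drive θ t w)‖ₑ

/-- The `C¹` distance of a map to `h₀` along an orbit. -/
noncomputable def supMap (θ : ℝ → Ω → Ω) (h : ℝ × Ω → X → X) (h₀ : X → X) (r : ℝ) (w : ℝ × Ω) :
    ℝ≥0∞ :=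
  ⨆ (t : ℝ) (x ∈ Metric.ball (0 : X) r),
    (‖h (drive θ t w) x - h₀ x‖ₑ + ‖fderiv ℝ (h (drive θ t w)) x - fderiv ℝ h₀ x‖ₑ)

/-- A supremum over all times is unchanged by translating time; this is the source of the invariance
of `η₀`. -/
lemma IsRandomFlow.iSup_drive [MeasurableSpace Ω] (hθ : IsRandomFlow θ) (f : ℝ × Ω → ℝ≥0∞) (s : ℝ)
    (w : ℝ × Ω) : ⨆ t : ℝ, f (drive θ t (drive θ s w)) = ⨆ t : ℝ, f (drive θ t w) := by
  simp only [hθ.drive_drive]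
  exact (Equiv.addRight s).iSup_comp (g := fun t => f (drive θ t w))

open Classical in
/-- A threshold below which `f` and `g` are at most `e` (junk if there is none). -/
noncomputable def threshold (f g : ℝ → ℝ≥0∞) (e : ℝ≥0∞) : ℝ :=
  if h : ∃ a ∈ Ioc (0 : ℝ) 1, ∀ η ∈ Ioc 0 a, f η ≤ e ∧ g η ≤ e then h.choose else 1

lemma threshold_spec {f g : ℝ → ℝ≥0∞} {e : ℝ≥0∞} (he : 0 < e)
    (hf : Tendsto f (𝓝[>] 0) (𝓝 0)) (hg : Tendsto g (𝓝[>] 0) (𝓝 0)) :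
    threshold f g e ∈ Ioc (0 : ℝ) 1 ∧ ∀ η ∈ Ioc 0 (threshold f g e), f η ≤ e ∧ g η ≤ e := by
  have h : ∃ a ∈ Ioc (0 : ℝ) 1, ∀ η ∈ Ioc 0 a, f η ≤ e ∧ g η ≤ e := by
    have := (hf.eventually_le_const he).and (hg.eventually_le_const he)
    rw [eventually_nhdsWithin_iff] at this
    obtain ⟨r, hr, hb⟩ := Metric.eventually_nhds_iff.1 this
    refine ⟨min (r / 2) 1, ⟨by positivity, min_le_right _ _⟩, fun η hη => hb ?_ hη.1⟩
    rw [Real.dist_0_eq_abs, abs_of_pos hη.1]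
    have := hη.2.trans (min_le_left _ _)
    linarith
  rw [threshold, dif_pos h]
  exact h.choose_spec

lemma le_toReal_of_enorm_le {E : Type*} [NormedAddCommGroup E] {x : E} {a : ℝ≥0∞}
    (h : ‖x‖ₑ ≤ a) (ha : a ≠ ∞) : ‖x‖ ≤ a.toReal := by
  rw [← toReal_enorm x]
  exact ENNReal.toReal_mono ha h

/-- Along the orbit of `w`, the operators `B` have norm at most `β`, and `h` is `κ`-close to `h₀`
in `C¹` on the ball of radius `ρ`. -/
structure IsGood (θ : ℝ → Ω → Ω) (B : ℝ × Ω → X →L[ℝ] X) (h : ℝ × Ω → X → X) (h₀ : X → X)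
    (ρ β κ : ℝ) (w : ℝ × Ω) : Prop where
  nonneg_left : 0 ≤ β
  nonneg_right : 0 ≤ κ
  op_le : ∀ t, ‖B (drive θ t w)‖ ≤ β
  map_le : ∀ t x, ‖x‖ ≤ ρ → ‖h (drive θ t w) x - h₀ x‖ ≤ κ
  fderiv_le : ∀ t x, ‖x‖ ≤ ρ → ‖fderiv ℝ (h (drive θ t w)) x - fderiv ℝ h₀ x‖ ≤ κ

/-- The radius `ρ + 1` makes the open ball in `supMap` contain the closed ball of radius `ρ`. -/
lemma isGood_of_ne_top {B : ℝ × Ω → X →L[ℝ] X} {h : ℝ × Ω → X → X} {h₀ : X → X} {ρ : ℝ}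
    {w : ℝ × Ω} (hB : supOp θ B w ≠ ∞) (hh : supMap θ h h₀ (ρ + 1) w ≠ ∞) :
    IsGood θ B h h₀ ρ (supOp θ B w).toReal (supMap θ h h₀ (ρ + 1) w).toReal w := by
  have key : ∀ t x, ‖x‖ ≤ ρ → ‖h (drive θ t w) x - h₀ x‖ₑ +
      ‖fderiv ℝ (h (drive θ t w)) x - fderiv ℝ h₀ x‖ₑ ≤ supMap θ h h₀ (ρ + 1) w := fun t x hx =>
    le_iSup_of_le t (le_iSup₂_of_le x (by rw [mem_ball_zero_iff]; linarith) le_rfl)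
  exact ⟨ENNReal.toReal_nonneg, ENNReal.toReal_nonneg,
    fun t => le_toReal_of_enorm_le (le_iSup (fun t => ‖B (drive θ t w)‖ₑ) t) hB,
    fun t x hx => le_toReal_of_enorm_le (le_self_add.trans (key t x hx)) hh,
    fun t x hx => le_toReal_of_enorm_le (le_add_self.trans (key t x hx)) hh⟩

/-- Of the Lipschitz constant `ε`, one quarter is spent on `B`, one on the derivative of `h - h₀`
and one on the derivative of `h₀`. -/
lemma IsGood.isSmallEquation [MeasurableSpace Ω] [MeasurableSpace X] (hθ : IsRandomFlow θ)
    {T : ℝ → X →L[ℝ] X} {B : ℝ × Ω → X →L[ℝ] X}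
    {h : ℝ × Ω → X → X} {h₀ : X → X} {t₀ K ε ρ β κ : ℝ} {w : ℝ × Ω} (hg : IsGood θ B h h₀ ρ β κ w)
    (ht₀ : 0 < t₀) (hK : 1 ≤ K) (hTK : ∀ t ∈ Icc 0 t₀, ‖T t‖ ≤ K) (hε : K * t₀ * ε ≤ 1 / 2)
    (hε0 : 0 ≤ ε) (hρ : 0 < ρ) (hβ : β ≤ ε / 4) (hκ : κ ≤ ε / 4)
    (hh₀ : ∀ x, ‖x‖ ≤ ρ → ‖fderiv ℝ h₀ x‖ ≤ ε / 4)
    (hC1 : ∀ w, ContDiff ℝ 1 (h w)) (hzero : ∀ w, h w 0 = 0) {ψ : ℝ → ℝ × Ω → X → X}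
    (hψ : IsCocycle θ ψ) (hmild : ∀ w z, IsMildSolution T (fun t => B (drive θ t w))
      (fun t => h (drive θ t w)) 0 (fun t => ψ t w z)) :
    IsSmallEquation T t₀ K ε ρ (fun t => B (drive θ t w)) (fun t => h (drive θ t w))
      (orbitProcess θ ψ w) where
  pos := ht₀
  one_le := hK
  bound := hTK
  small := hε
  nonneg := hε0
  radius_pos := hρ
  lip r x y hx hy := by
    have h1 : ‖h (drive θ r w) x - h (drive θ r w) y‖ ≤ (ε / 2) * ‖x - y‖ := by
      refine (convex_closedBall (0 : X) ρ).norm_image_sub_le_of_norm_fderiv_le (𝕜 := ℝ)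
        (fun z _ => ((hC1 _).differentiable one_ne_zero) z) (fun z hz => ?_)
        (by simpa using hy) (by simpa using hx)
      have hz' : ‖z‖ ≤ ρ := by simpa using hz
      have e : fderiv ℝ (h (drive θ r w)) z =
        (fderiv ℝ (h (drive θ r w)) z - fderiv ℝ h₀ z) + fderiv ℝ h₀ z := by abel
      rw [e]
      refine (norm_add_le _ _).trans ?_
      linarith [hg.fderiv_le r z hz', hh₀ z hz']
    have h2 := (B (drive θ r w)).le_of_opNorm_le (hg.op_le r) (x - y)
    have e : (B (drive θ r w) x + h (drive θ r w) x) - (B (drive θ r w) y + h (drive θ r w) y) =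
        B (drive θ r w) (x - y) + (h (drive θ r w) x - h (drive θ r w) y) := by
      rw [map_sub]; abel
    rw [e]
    refine (norm_add_le _ _).trans ?_
    nlinarith [norm_nonneg (x - y)]
  zero r := hzero _
  refl t x := by simp only [orbitProcess, sub_self, hψ.zero]
  comp t s r hrs hst x := by
    have := hψ.add (t - s) (s - r) (by linarith) (by linarith) (drive θ r w) x
    rw [hθ.drive_drive, sub_add_cancel, sub_add_sub_cancel] at this
    exact this.symm
  mild s x := by
    have := hmild (drive θ s w) x
    simpa only [orbitProcess, add_sub_cancel_right, hθ.drive_drive] using this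

lemma IsGood.isSmallLinear {T : ℝ → X →L[ℝ] X} (hT : IsC0Semigroup T) {B : ℝ × Ω → X →L[ℝ] X}
    {h : ℝ × Ω → X → X} {h₀ : X → X} {t₀ K ε ρ β κ : ℝ} {w : ℝ × Ω} (hg : IsGood θ B h h₀ ρ β κ w)
    (ht₀ : 0 < t₀) (hK : 1 ≤ K) (hTK : ∀ t ∈ Icc 0 t₀, ‖T t‖ ≤ K) (hε : K * t₀ * ε ≤ 1 / 2)
    (hβ : β ≤ ε) (hmeas : ∀ x, StronglyMeasurable (fun t => B (drive θ t w) x)) :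
    IsSmallLinear T t₀ K β (fun t => B (drive θ t w)) where
  semigroup := hT
  pos := ht₀
  one_le := hK
  bound := hTK
  small := le_trans (by gcongr) hε
  measurable := hmeas
  norm_le := hg.op_le

end Orbits

end RandomPerturbation

/-! ### Assembly of the main theorem. -/

open RandomPerturbation in
theorem mainTheorem3
    {Ω : Type*} [MeasurableSpace Ω] (ℙ : Measure Ω) [IsProbabilityMeasure ℙ]
    {X : Type*} [NormedAddCommGroup X] [NormedSpace ℝ X] [CompleteSpace X]
    [TopologicalSpace.SeparableSpace X] [MeasurableSpace X] [BorelSpace X]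
    -- the driving flow
    (θ : ℝ → Ω → Ω) (hθ : IsRandomFlow θ)
    -- the linear part `A_η(w) = A + B η w`, where `A` generates `T t = e^{At}`
    (T : ℝ → X →L[ℝ] X) (hT : IsC0Semigroup T)
    (B : ℝ → ℝ × Ω → X →L[ℝ] X)
    (hB_meas : ∀ η ∈ Icc (0 : ℝ) 1, ∀ w x, StronglyMeasurable (fun t => B η (drive θ t w) x))
    (hB_zero : ∀ w, B 0 w = 0)
    (hB_lim : ∀ w, Tendsto (fun η => ⨆ t : ℝ, ‖B η (drive θ t w)‖ₑ) (𝓝[>] 0) (𝓝 0))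
    -- the nonlinear part
    (h : ℝ → ℝ × Ω → X → X) (h₀ : X → X)
    (hh_meas : ∀ η ∈ Icc (0 : ℝ) 1, ∀ w x, StronglyMeasurable (fun t => h η (drive θ t w) x))
    (hh_C1 : ∀ η ∈ Icc (0 : ℝ) 1, ∀ w, ContDiff ℝ 1 (h η w))
    (hh_at_zero : ∀ η ∈ Icc (0 : ℝ) 1, ∀ w, h η w 0 = 0)
    (hh_deriv_at_zero : ∀ η ∈ Icc (0 : ℝ) 1, ∀ w, fderiv ℝ (h η w) 0 = 0)
    (hh_zero : ∀ w, h 0 w = h₀)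
    (hh_lim : ∀ r : ℝ, 0 < r → ∀ w, Tendsto
      (fun η => ⨆ (t : ℝ) (x ∈ Metric.ball (0 : X) r),
        (‖h η (drive θ t w) x - h₀ x‖ₑ + ‖fderiv ℝ (h η (drive θ t w)) x - fderiv ℝ h₀ x‖ₑ))
      (𝓝[>] 0) (𝓝 0))
    -- global well-posedness: the equation generates a co-cycle for each `η`
    (ψ : ℝ → ℝ → ℝ × Ω → X → X)
    (hψ : ∀ η ∈ Icc (0 : ℝ) 1, IsCocycle θ (ψ η))
    (hψ_mild : ∀ η ∈ Icc (0 : ℝ) 1, ∀ w z, IsMildSolution T (fun t => B η (drive θ t w))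
      (fun t => h η (drive θ t w)) 0 (fun t => ψ η t w z))
    -- `0` is hyperbolic for `η = 0`
    (Pu₀ : X →L[ℝ] X) (hPu₀ : HasExpDichotomy (fun t s => T (t - s)) (fun _ => Pu₀)) :
    ∃ (η₀ δ₀ : ℝ × Ω → ℝ) (L : ℝ) (φ : ℝ → ℝ → ℝ × Ω → X →L[ℝ] X)
      (Pu : ℝ → ℝ × Ω → X →L[ℝ] X) (Su : ℝ → ℝ × Ω → ℝ → X → X) (Su₀ : X → X),
      (IsThetaInvariant θ η₀ ∧ ∀ w, η₀ w ∈ Ioc (0 : ℝ) 1) ∧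
      (IsThetaInvariant θ δ₀ ∧ ∀ w, 0 < δ₀ w) ∧
      0 < L ∧
      -- for `η = 0` the projections and the graph map are the autonomous ones
      (∀ w, Pu 0 w = Pu₀) ∧ (∀ w s, Su 0 w s = Su₀) ∧
      -- (1) `0` is a hyperbolic solution for small `η`
      (∀ w, ∀ η ∈ Ioc (0 : ℝ) (η₀ w),
        IsGlobalSolution (orbitProcess θ (ψ η) w) (fun _ => 0) ∧
        IsLinearProcess T (fun t => B η (drive θ t w)) (orbitProcess θ (φ η) w) ∧
        HasExpDichotomy (orbitProcess θ (φ η) w) (fun s => Pu η (drive θ s w))) ∧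
      -- (2) uniform convergence of the projections
      (∀ w, Tendsto (fun η => ⨆ t : ℝ, ‖Pu η (drive θ t w) - Pu₀‖ₑ) (𝓝[>] 0) (𝓝 0)) ∧
      -- (3) the maps defining the graphs, and the local unstable sets as graphs
      (∀ w, ∀ η ∈ Icc (0 : ℝ) (η₀ w), ∀ s,
        (∀ z, ‖z‖ ≤ δ₀ w →
          Pu η (drive θ s w) (Su η w s (Pu η (drive θ s w) z)) = 0 ∧
          ‖Su η w s (Pu η (drive θ s w) z)‖ ≤ L) ∧
        (∀ z z', ‖z‖ ≤ δ₀ w → ‖z'‖ ≤ δ₀ w →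
          ‖Su η w s (Pu η (drive θ s w) z) - Su η w s (Pu η (drive θ s w) z')‖ ≤
            L * ‖Pu η (drive θ s w) z - Pu η (drive θ s w) z'‖)) ∧
      (∀ w, ∀ δ ∈ Ioo (0 : ℝ) (δ₀ w), ∃ δ' δ'' : ℝ, 0 < δ'' ∧ δ'' < δ' ∧ δ' < δ ∧
        ∀ η ∈ Icc (0 : ℝ) (η₀ w), ∀ s,
          localGraph (Pu η (drive θ s w)) (Su η w s) δ'' ⊆
            timeSection (localUnstableSet (orbitProcess θ (ψ η) w) (fun _ => 0) δ') s ∧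
          timeSection (localUnstableSet (orbitProcess θ (ψ η) w) (fun _ => 0) δ') s ⊆
            localGraph (Pu η (drive θ s w)) (Su η w s) δ) ∧
      -- (4) continuity of the graphs at `η = 0`
      (∀ w s, Tendsto
        (fun η => ⨆ (t : ℝ) (_ : t ≤ s) (z : X) (_ : ‖z‖ ≤ δ₀ w),
          (‖Pu η (drive θ t w) - Pu₀‖ₑ +
            ‖Su η w t (Pu η (drive θ t w) z) - Su₀ (Pu₀ z)‖ₑ))
        (𝓝[>] 0) (𝓝 0)) := by
  have hΩ : Nonempty Ω := ℙ.nonempty_of_neZero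
  obtain ⟨t₀, ht₀, V, q, hS⟩ := exists_isHypSplit hPu₀
  obtain ⟨K, hK, hTK⟩ := hT.exists_bound t₀
  have hq := hS.one_le
  -- Chosen so that `q * (4 * K ^ 2 * t₀ * ε) = 1 / 16`, the threshold for jump orbits.
  set ε : ℝ := 1 / (64 * q * K ^ 2 * t₀) with hεdef
  have hε : 0 < ε := by positivity
  have hε1 : K * t₀ * ε ≤ 1 / 2 := by
    have e : K * t₀ * ε = 1 / (64 * q * K) := by rw [hεdef]; field_simp
    rw [e]
    apply one_div_le_one_div_of_le (by norm_num)
    nlinarith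
  set ε' : ℝ := 4 * K ^ 2 * t₀ * ε with hε'def
  have hε'0 : 0 ≤ ε' := by positivity
  have hε2 : q * ε' ≤ 1 / 16 := by
    have e : q * ε' = 1 / 16 := by rw [hε'def, hεdef]; field_simp; norm_num
    exact e.le
  let w₀ : ℝ × Ω := (0, hΩ.some)
  have hmem0 : (0 : ℝ) ∈ Icc (0 : ℝ) 1 := ⟨le_rfl, zero_le_one⟩
  obtain ⟨ρ, hρ, hρb⟩ : ∃ ρ : ℝ, 0 < ρ ∧ ∀ x, ‖x‖ ≤ ρ → ‖fderiv ℝ h₀ x‖ ≤ ε / 4 := by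
    have h1 := hh_C1 0 hmem0 w₀
    have h2 := hh_deriv_at_zero 0 hmem0 w₀
    rw [hh_zero] at h1 h2
    exact exists_radius_fderiv_le h1 h2 (by positivity)
  set r₀ : ℝ := ρ / (4 * K) with hr₀def
  have hr₀ : 0 < r₀ := by positivity
  have hr : K * r₀ ≤ ρ / 4 := by
    have e : K * r₀ = ρ / 4 := by rw [hr₀def]; field_simp
    exact e.le
  let e₀ : ℝ≥0∞ := ENNReal.ofReal (ε / 4)
  have he₀ : 0 < e₀ := ENNReal.ofReal_pos.2 (by positivity)
  -- The choice in `threshold` sees `w` only through orbit suprema, so equal suprema give equal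
  -- thresholds.
  let η₀ : ℝ × Ω → ℝ := fun w =>
    threshold (fun η => supOp θ (B η) w) (fun η => supMap θ (h η) h₀ (ρ + 1) w) e₀
  have hη₀ : ∀ w, η₀ w ∈ Ioc (0 : ℝ) 1 ∧ ∀ η ∈ Ioc 0 (η₀ w),
      supOp θ (B η) w ≤ e₀ ∧ supMap θ (h η) h₀ (ρ + 1) w ≤ e₀ := fun w =>
    threshold_spec he₀ (hB_lim w) (hh_lim (ρ + 1) (by positivity) w)
  let b : ℝ → ℝ × Ω → ℝ → X →L[ℝ] X := fun η w t => B η (drive θ t w)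
  let Φ : ℝ → ℝ × Ω → ℝ → ℝ → X →L[ℝ] X := fun η w => linEvolution T (b η w)
  let Ψ : ℝ → ℝ × Ω → ℝ → ℝ → X → X := fun η w => orbitProcess θ (ψ η) w
  let φ : ℝ → ℝ → ℝ × Ω → X →L[ℝ] X := fun η t w => linSol T (b η w) t
  let Pu : ℝ → ℝ × Ω → X →L[ℝ] X := fun η w => projOf (fun n => stepSeq (Φ η w) t₀ 0 n)
  let Su : ℝ → ℝ × Ω → ℝ → X → X := fun η w s p =>
    jumpOrbit (mixSeq (T t₀) r₀ t₀ (Ψ η w) (Φ η w) s) p 0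
  have hφ : ∀ η w, orbitProcess θ (φ η) w = Φ η w := by
    intro η w
    funext t s
    simp only [orbitProcess, φ, Φ, b, linEvolution, hθ.drive_drive]
  -- Steps from time `0` along the orbit of `drive θ s w` are steps from time `s` along the orbit of
  -- `w`.
  have hPu : ∀ η w s, Pu η (drive θ s w) = projOf (fun n => stepSeq (Φ η w) t₀ s n) := by
    intro η w s
    simp only [Pu]
    congr 1
    funext n
    simp only [stepSeq, Φ, linEvolution, b, hθ.drive_drive]
    congr 2
    · funext r
      congr 2
      ring
    · ring
  have hgood : ∀ w, ∀ η ∈ Icc (0 : ℝ) (η₀ w), ∃ β κ, β ≤ ε / 4 ∧ κ ≤ ε / 4 ∧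
      IsGood θ (B η) (h η) h₀ ρ β κ w := by
    intro w η hη
    -- The limits give no information at `η = 0`, where the perturbations vanish identically.
    rcases hη.1.eq_or_lt with rfl | hpos
    · exact ⟨0, 0, by positivity, by positivity, le_rfl, le_rfl, by simp [hB_zero],
        by simp [hh_zero], by simp [hh_zero]⟩
    · have h1 := (hη₀ w).2 η ⟨hpos, hη.2⟩
      have h2 := isGood_of_ne_top (ne_top_of_le_ne_top ENNReal.ofReal_ne_top h1.1)
        (ne_top_of_le_ne_top ENNReal.ofReal_ne_top h1.2)
      exact ⟨_, _, ENNReal.toReal_le_of_le_ofReal (by positivity) h1.1,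
        ENNReal.toReal_le_of_le_ofReal (by positivity) h1.2, h2⟩
  have hIcc : ∀ w, ∀ η ∈ Icc (0 : ℝ) (η₀ w), η ∈ Icc (0 : ℝ) 1 := fun w η hη =>
    ⟨hη.1, hη.2.trans (hη₀ w).1.2⟩
  have heq : ∀ w, ∀ η ∈ Icc (0 : ℝ) (η₀ w), IsSmallEquation T t₀ K ε ρ (b η w)
      (fun t => h η (drive θ t w)) (Ψ η w) := by
    intro w η hη
    have hη1 := hIcc w η hη
    obtain ⟨β, κ, hβ, hκ, hg⟩ := hgood w η hη
    exact hg.isSmallEquation hθ ht₀ hK hTK hε1 hε.le hρ hβ hκ hρb (hh_C1 η hη1)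
      (hh_at_zero η hη1) (hψ η hη1) (hψ_mild η hη1)
  have hlin : ∀ w, ∀ η ∈ Icc (0 : ℝ) (η₀ w), ∀ β κ, β ≤ ε / 4 →
      IsGood θ (B η) (h η) h₀ ρ β κ w → IsSmallLinear T t₀ K β (b η w) :=
    fun w η hη β κ hβ hg => hg.isSmallLinear hT ht₀ hK hTK hε1 (by linarith)
      (hB_meas η (hIcc w η hη) w)
  have hΦ : ∀ w, ∀ η ∈ Icc (0 : ℝ) (η₀ w), IsNearEvolution (T t₀) ε' t₀ (2 * K) (Φ η w) := by
    intro w η hη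
    obtain ⟨β, κ, hβ, hκ, hg⟩ := hgood w η hη
    refine (hlin w η hη β κ hβ hg).isNearEvolution.mono ?_
    calc 2 * K ^ 2 * t₀ * β ≤ 2 * K ^ 2 * t₀ * ε := by gcongr; linarith
      _ ≤ ε' := by rw [hε'def]; gcongr; norm_num
  have hmem : ∀ w, (0 : ℝ) ∈ Icc (0 : ℝ) (η₀ w) := fun w => ⟨le_rfl, (hη₀ w).1.1.le⟩
  have hgood0 : ∀ w, IsGood θ (B 0) (h 0) h₀ ρ 0 0 w := fun w =>
    ⟨le_rfl, le_rfl, by simp [hB_zero], by simp [hh_zero], by simp [hh_zero]⟩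
  have hstep0 : ∀ w s n x, stepSeq (Φ 0 w) t₀ s n x = T t₀ x := by
    intro w s n x
    have := (hlin w 0 (hmem w) 0 0 (by positivity) (hgood0 w)).isNearEvolution.norm_stepSeq_sub s n x
    rw [mul_zero, zero_mul] at this
    exact sub_eq_zero.1 (norm_le_zero_iff.1 this)
  have hPu0 : ∀ w, Pu 0 w = Pu₀ := by
    intro w
    rw [← hS.projOf_eq]
    simp only [Pu]
    congr 1
    funext n x
    exact hstep0 w 0 n x
  have hPuz : ∀ w, ∀ η ∈ Icc (0 : ℝ) (η₀ w), ∀ s z, ‖Pu η (drive θ s w) z‖ ≤ 3 * q * ‖z‖ := by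
    intro w η hη s z
    rw [hPu]
    exact norm_projOf_le hS hε2 hε'0 ((hΦ w η hη).isNear s) z
  have hPu₀z : ∀ z, ‖Pu₀ z‖ ≤ 3 * q * ‖z‖ := by
    intro z
    have := hPuz w₀ 0 (hmem w₀) 0 z
    rwa [hPu0] at this
  have hPu_sub : ∀ w, ∀ η ∈ Icc (0 : ℝ) (η₀ w), ∀ β κ, β ≤ ε / 4 →
      IsGood θ (B η) (h η) h₀ ρ β κ w → ∀ s,
      ‖Pu η (drive θ s w) - Pu₀‖ ≤ 8 * q ^ 2 * K ^ 2 * t₀ * β := by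
    intro w η hη β κ hβ hg s
    have hl := hlin w η hη β κ hβ hg
    have hβ0 := hg.nonneg_left
    rw [hPu]
    refine (norm_projOf_sub_le hS hε2 hε'0 ((hΦ w η hη).isNear s) (by positivity)
      (hl.isNearEvolution.norm_stepSeq_sub s)).trans (le_of_eq (by ring))
  -- The orbits and times are allowed to differ: with `η = 0` and `β = κ = 0` this shows that the
  -- unperturbed graph map depends on neither, and for `η > 0` it gives the convergence.
  have hSu_sub : ∀ w w', ∀ η ∈ Icc (0 : ℝ) (η₀ w), ∀ β κ, β ≤ ε / 4 →
      IsGood θ (B η) (h η) h₀ ρ β κ w → ∀ s s' p p',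
      ‖Su η w s p - Su 0 w' s' p'‖ ≤ 2 * q * (2 * K * t₀ * (β * ρ + κ) +
        2 * K ^ 2 * t₀ * β * (2 * q * ‖p'‖) + ‖p - p'‖) := by
    intro w w' η hη β κ hβ hg s s' p p'
    have hl := hlin w η hη β κ hβ hg
    have hβ0 := hg.nonneg_left
    have hκ0 := hg.nonneg_right
    refine (heq w η hη).norm_jumpOrbit_sub_le (heq w' 0 (hmem w')) hS hε2 hr₀ hr (hΦ w η hη)
      (hΦ w' 0 (hmem w')) (by positivity) (by positivity) (fun r r' x hx => ?_) (fun n x => ?_) p p'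
    · have e : (b η w r x + h η (drive θ r w) x) - (b 0 w' r' x + h 0 (drive θ r' w') x) =
          b η w r x + (h η (drive θ r w) x - h₀ x) := by
        simp only [b, hB_zero, hh_zero, zero_apply, zero_add]
        abel
      rw [e]
      refine (norm_add_le _ _).trans (add_le_add ?_ (hg.map_le r x hx))
      exact (b η w r).le_of_opNorm_le_of_le (hg.op_le r) hx
    · rw [hstep0]
      exact hl.isNearEvolution.norm_stepSeq_sub s n x
  have hlim : ∀ w, Tendsto (fun η => supOp θ (B η) w + supMap θ (h η) h₀ (ρ + 1) w)
      (𝓝[>] 0) (𝓝 0) := fun w => by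
    have h1 : Tendsto (fun η => supOp θ (B η) w) (𝓝[>] 0) (𝓝 0) := hB_lim w
    have h2 : Tendsto (fun η => supMap θ (h η) h₀ (ρ + 1) w) (𝓝[>] 0) (𝓝 0) :=
      hh_lim (ρ + 1) (by positivity) w
    simpa using h1.add h2
  -- Both convergence claims reduce to a bound linear in `β + κ`, applied with the actual orbit
  -- suprema as `β` and `κ`.
  have htransfer : ∀ w (C : ℝ) (f : ℝ → ℝ≥0∞), 0 ≤ C → (∀ η ∈ Icc (0 : ℝ) (η₀ w), ∀ β κ,
      β ≤ ε / 4 → IsGood θ (B η) (h η) h₀ ρ β κ w → f η ≤ ENNReal.ofReal (C * (β + κ))) →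
      Tendsto f (𝓝[>] 0) (𝓝 0) := by
    intro w C f hC hf
    have h1 := ENNReal.Tendsto.const_mul (a := ENNReal.ofReal C) (hlim w)
      (Or.inr ENNReal.ofReal_ne_top)
    rw [mul_zero] at h1
    refine tendsto_of_tendsto_of_tendsto_of_le_of_le' tendsto_const_nhds h1
      (Eventually.of_forall fun _ => zero_le) ?_
    filter_upwards [Ioc_mem_nhdsGT (hη₀ w).1.1] with η hη
    have h2 := (hη₀ w).2 η hη
    have h3 := ne_top_of_le_ne_top ENNReal.ofReal_ne_top h2.1
    have h4 := ne_top_of_le_ne_top ENNReal.ofReal_ne_top h2.2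
    refine (hf η ⟨hη.1.le, hη.2⟩ _ _ (ENNReal.toReal_le_of_le_ofReal (by positivity) h2.1)
      (isGood_of_ne_top h3 h4)).trans (le_of_eq ?_)
    rw [ENNReal.ofReal_mul hC, ENNReal.ofReal_add ENNReal.toReal_nonneg ENNReal.toReal_nonneg,
      ENNReal.ofReal_toReal h3, ENNReal.ofReal_toReal h4]
  have hSu0 : ∀ w s, Su 0 w s = Su 0 w₀ 0 := by
    intro w s
    funext p
    have := hSu_sub w w₀ 0 (hmem w) 0 0 (by positivity) (hgood0 w) s 0 p p
    simp only [zero_mul, mul_zero, add_zero, sub_self, norm_zero] at this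
    exact sub_eq_zero.1 (norm_le_zero_iff.1 this)
  have hSu_lip : ∀ w, ∀ η ∈ Icc (0 : ℝ) (η₀ w), ∀ s p p',
      ‖Su η w s p - Su η w s p'‖ ≤ 2 * q * ‖p - p'‖ := by
    intro w η hη s p p'
    exact norm_jumpOrbit_sub_le hS hε2 hε'0 ((heq w η hη).mixSeq_isNear hr₀ hr (hΦ w η hη) s) p p' 0
  have hSu_le : ∀ w, ∀ η ∈ Icc (0 : ℝ) (η₀ w), ∀ s p, ‖Su η w s p‖ ≤ 2 * q * ‖p‖ := by
    intro w η hη s p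
    have hF := (heq w η hη).mixSeq_isNear hr₀ hr (hΦ w η hη) s
    exact (isJump_jumpOrbit hS hε2 hε'0 hF p).norm_le hS hε2 hε'0 hF 0
  -- In `L`, the summand `2 * q` is the Lipschitz constant of the graph maps, and `2 * q * (3 * q *
  -- r₀)` bounds their values.
  refine ⟨η₀, fun _ => r₀, 2 * q + 6 * q ^ 2 * r₀, φ, Pu, Su, Su 0 w₀ 0, ⟨fun w t => ?_,
    fun w => (hη₀ w).1⟩, ⟨fun _ _ => rfl, fun _ => hr₀⟩, by positivity, hPu0, hSu0,
    fun w η hη => ?_, fun w => ?_, fun w η hη s => ⟨fun z hz => ⟨?_, ?_⟩, fun z z' _ _ => ?_⟩,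
    fun w δ hδ => ?_, fun w s => ?_⟩
  · simp only [η₀, supOp, supMap]
    congr 1
    · funext η
      exact hθ.iSup_drive (fun w => ‖B η w‖ₑ) t w
    · funext η
      exact hθ.iSup_drive (fun w => ⨆ x ∈ Metric.ball (0 : X) (ρ + 1),
        (‖h η w x - h₀ x‖ₑ + ‖fderiv ℝ (h η w) x - fderiv ℝ h₀ x‖ₑ)) t w
  · have hη' : η ∈ Icc 0 (η₀ w) := ⟨hη.1.le, hη.2⟩
    obtain ⟨β, κ, hβ, hκ, hg⟩ := hgood w η hη'
    refine ⟨fun s t hst => (heq w η hη').apply_zero hst, ?_, 4 * q * (2 * K), Real.log 2 / t₀, ?_,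
      div_pos (Real.log_pos one_lt_two) ht₀, ?_⟩
    · rw [hφ]
      exact (hlin w η hη' β κ hβ hg).isLinearEvolution
    · nlinarith
    · rw [hφ]
      simp only [hPu]
      exact (hΦ w η hη').isExpDichotomy hS hε2 hε'0
  · refine htransfer w (8 * q ^ 2 * K ^ 2 * t₀) _ (by positivity) fun η hη β κ hβ hg => ?_
    refine iSup_le fun t => ?_
    rw [← ofReal_norm]
    apply ENNReal.ofReal_le_ofReal
    refine (hPu_sub w η hη β κ hβ hg t).trans ?_
    have := hg.nonneg_right
    gcongr
    linarith
  · rw [hPu]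
    exact (heq w η hη).projOf_jumpOrbit hS hε2 hr₀ hr (hΦ w η hη) s _
  · calc _ ≤ 2 * q * ‖Pu η (drive θ s w) z‖ := hSu_le w η hη s _
      _ ≤ 2 * q * (3 * q * r₀) := by
        gcongr; exact (hPuz w η hη s z).trans (by gcongr)
      _ ≤ _ := by nlinarith
  · refine (hSu_lip w η hη s _ _).trans ?_
    gcongr
    have : 0 ≤ 6 * q ^ 2 * r₀ := by positivity
    linarith
  · obtain ⟨hδ0, hδ1⟩ := hδ
    have hδ'' : δ / (24 * K * q ^ 2) ≤ δ / 24 := by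
      apply div_le_div_of_nonneg_left hδ0.le (by norm_num)
      nlinarith [mul_le_mul hK (one_le_pow₀ hq : 1 ≤ q ^ 2) (by norm_num) (by linarith)]
    -- The inner radius satisfies `4 * K * q * (3 * q * δ'') = δ / 2`: projecting costs `3 * q`, and
    -- following the solution backwards costs `4 * K * q`.
    refine ⟨δ / 2, δ / (24 * K * q ^ 2), by positivity, by linarith, by linarith,
      fun η hη s => ⟨?_, ?_⟩⟩
    · rintro _ ⟨z, hz, rfl⟩
      have h1 : ‖Pu η (drive θ s w) z‖ ≤ 3 * q * (δ / (24 * K * q ^ 2)) :=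
        (hPuz w η hη s z).trans (by gcongr)
      have h2 : 4 * K * q * ‖Pu η (drive θ s w) z‖ ≤ δ / 2 := by
        calc _ ≤ 4 * K * q * (3 * q * (δ / (24 * K * q ^ 2))) := by gcongr
          _ = δ / 2 := by field_simp; norm_num
      have h3 : 2 * q * ‖Pu η (drive θ s w) z‖ ≤ r₀ := by
        have h4 : 2 * q * ‖Pu η (drive θ s w) z‖ ≤ 4 * K * q * ‖Pu η (drive θ s w) z‖ := by
          gcongr
          linarith
        linarith
      obtain ⟨ζ, hζ, hζs, hζb, hζ0⟩ :=
        (heq w η hη).exists_globalSolution hS hε2 hr₀ hr (hΦ w η hη) (s := s) h3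
      refine ⟨ζ, hζ, hζs, fun t ht => ?_, ?_⟩
      · rw [sub_zero]
        exact (hζb t ht).trans h2
      · simpa using hζ0.norm
    · rintro x ⟨ζ, hζ, hζs, hζb, -⟩
      obtain rfl : ζ s = x := hζs
      simp only [sub_zero] at hζb
      have h1 := (heq w η hη).eq_of_globalSolution hS hε2 hr₀ hr (hΦ w η hη) hζ
        (fun t ht => (hζb t ht).trans (by linarith))
      -- The point itself serves as the parameter `z` of the graph, since only its projection
      -- matters.
      refine ⟨ζ s, (hζb s le_rfl).trans (by linarith), ?_⟩
      rw [hPu]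
      exact h1
  · refine htransfer w (8 * q ^ 2 * K ^ 2 * t₀ + 2 * q * (2 * K * t₀ * (ρ + 1) +
      2 * K ^ 2 * t₀ * (2 * q * (3 * q * r₀)) + 8 * q ^ 2 * K ^ 2 * t₀ * r₀)) _ (by positivity)
      fun η hη β κ hβ hg => ?_
    refine iSup₂_le fun t _ => iSup₂_le fun z hz => ?_
    have hβ0 := hg.nonneg_left
    have hκ0 := hg.nonneg_right
    have h1 := hPu_sub w η hη β κ hβ hg t
    have h2 : ‖Pu η (drive θ t w) z - Pu₀ z‖ ≤ 8 * q ^ 2 * K ^ 2 * t₀ * β * r₀ := by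
      rw [← sub_apply]
      exact ContinuousLinearMap.le_of_opNorm_le_of_le _ h1 hz
    have h3 : ‖Pu₀ z‖ ≤ 3 * q * r₀ := (hPu₀z z).trans (by gcongr)
    have h4 := hSu_sub w w₀ η hη β κ hβ hg t 0 (Pu η (drive θ t w) z) (Pu₀ z)
    rw [← ofReal_norm, ← ofReal_norm, ← ENNReal.ofReal_add (norm_nonneg _) (norm_nonneg _)]
    apply ENNReal.ofReal_le_ofReal
    have e1 : β ≤ β + κ := by linarith
    have e2 : β * ρ + κ ≤ (ρ + 1) * (β + κ) := by nlinarith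
    calc _ ≤ 8 * q ^ 2 * K ^ 2 * t₀ * (β + κ) + 2 * q * (2 * K * t₀ * ((ρ + 1) * (β + κ)) +
          2 * K ^ 2 * t₀ * (β + κ) * (2 * q * (3 * q * r₀)) +
            8 * q ^ 2 * K ^ 2 * t₀ * (β + κ) * r₀) := by
          refine add_le_add (h1.trans (by gcongr)) (h4.trans ?_)
          gcongr
          exact h2.trans (by gcongr)
      _ = _ := by ring
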